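/- Let $n\ge 1$, $q\in\mathbb Z/4\mathbb Z$, $s\in\mathbb C$. Write $(\theta,y)\in\mathbb R\times\mathbb R^n$, $\rho=\|y\|$, $E_n=\sum_j y_j\partial_j$, and let $\Delta_n$ be the Laplacian in $y$. Let $$I''=\{F\in C^\infty(\mathbb R\times\mathbb R^n,\mathbb C)\ :\ F(\theta+j\pi,(-1)^jy)=i^{-jq}F(\theta,y)\ \text{for all } j\in\mathbb Z\},$$ on which $\mathfrak{sl}_2(\mathbb C)$ acts through its standard basis $\kappa,\eta^\pm$ by $$\kappa=i\partial_\theta,\qquad \eta^{\pm}=\tfrac12e^{\mp2i\theta}\bigl(-E_n\mp i\partial_\theta-(\tfrac n2\pm 2is\rho^2)\bigr),$$ and $O(n)$ acts by $(u.F)(\theta,y)=F(\theta,u^{-1}y)$. Let $\Omega''=\rho^2(4s\partial_\theta+4s^2\rho^2+\Delta_n)$ and, for $\lambda\in\mathbb Z$, let $\ker(\Omega''-2\lambda)_K$ be the space of those $F\in I''$ with $\Omega''F=2\lambda F$ whose translates $F(\theta-\varphi,u^{-1}y)$ ($\varphi\in\mathbb R$, $u\in O(n)$) span a finite-dimensional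 space. Call $\lambda$ admissible if $\lambda=\frac12L(L-1)$ for some integer $L\ge0$ (when $n=1$), respectively $\lambda=l(n+2j)$ for some integers $1\le l\le j+1$ (when $n\ge2$). A pair of integers $(l,k)$ is $\lambda$-admissible if $\lambda=l(2l+2k+n-2)$ and, when $n\ge2$, $l\ge1$ and $k\ge0$; when $n=1$, $l\ge0$ and $k\in\{0,1\}$. Let $\mathcal H_k(\mathbb R^n)$ be the space of complex harmonic polynomials on $\mathbb R^n$ that are homogeneous of degree $k$. For $m\in\mathbb Z$ and $h\in\mathcal H_k(\mathbb R^n)$ put $$F_{m,l,k}(\theta,y)=e^{-im\theta/2}e^{-is\rho^2}\rho^{2l}h(y)\,{}_1F_1\bigl(\tfrac{m+4l+2k+n}{4},\,2l+k+\tfrac n2,\,2is\rho^2\bigr).$$ Let $H_{l,k}$ be the complex span of all $F_{m,l,k}$ with $m\equiv 2k+q \bmod 4$ and $h\in\mathcal H_k(\mathbb R^n)$. Let $H^+_{l,k}$ (if $q\equiv n \bmod 4$) and $H^-_{l,k}$ (if $q\equiv -n\bmod 4$) be the spans of those with, in addition, $m\ge 2k+4l+n$, respectively $m\le-(2k+4l+n)$.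 Proposition. Let $\lambda$ be admissible and $(l,k)$ a $\lambda$-admissible pair. Then $\ker(\Omega''-2\lambda)_K$ and its subspace $H_{l,k}$ are $\mathfrak{sl}_2\times O(n)$-modules, and, as $\mathfrak{sl}_2\times O(n)$-modules: 1. If $q\not\equiv n$ and $q\not\equiv -n \bmod 4$, then $H_{l,k}$ is irreducible. Moreover $\ker(\Omega''-2\lambda)_K=\bigoplus H_{l',k'}$, the sum over all $\lambda$-admissible pairs $(l',k')$. 2. If $q\equiv n$ and $q\not\equiv -n\bmod 4$, then $H^+_{l,k}$ is the unique irreducible submodule of $H_{l,k}$. 3. If $q\not\equiv n$ and $q\equiv -n\bmod 4$, then $H^-_{l,k}$ is the unique irreducible submodule of $H_{l,k}$. 4. If $q\equiv n$ and $q\equiv -n\bmod 4$, then $H^+_{l,k}$ and $H^-_{l,k}$ are the only irreducible submodules of $H_{l,k}$, their sum is direct, and $$0\subset H^+_{l,k}\subset H^+_{l,k}\oplus H^-_{l,k}\subset H_{l,k}$$ is a composition series of $H_{l,k}$. -/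

import Mathlib

open scoped ContDiff

noncomputable section

namespace SingularSchrodinger

/-- `ℝⁿ` with its Euclidean norm. -/
abbrev Eucl (n : ℕ) : Type := EuclideanSpace ℝ (Fin n)

/-- Complex functions `F(θ, y)` on `ℝ × ℝⁿ`. -/
abbrev Fn (n : ℕ) : Type := ℝ × Eucl n → ℂ

/-- The orthogonal group `O(n)`. -/
abbrev OrthGroup (n : ℕ) : Type := Eucl n ≃ₗᵢ[ℝ] Eucl n

/-! ### The representation space and its operators -/

/-- The compact picture `I''(q, -n/2, s)`: smooth functions on `ℝ × ℝⁿ` with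
`F(θ + jπ, (-1)^j y) = i^{-jq} F(θ, y)`. The class `q ∈ ℤ/4` is given by an integer representative.
The parameter `s` does not restrict the functions; it enters through the operators below. -/
def compactPicture (n : ℕ) (q : ℤ) : Submodule ℂ (Fn n) where
  carrier := {F | ContDiff ℝ ∞ F ∧ ∀ (j : ℤ) (θ : ℝ) (y : Eucl n),
    F (θ + j * Real.pi, ((-1 : ℝ) ^ j) • y) = Complex.I ^ (-(j * q)) * F (θ, y)}
  add_mem' := by
    rintro F G ⟨hF, hF'⟩ ⟨hG, hG'⟩
    refine ⟨hF.add hG, fun j θ y => ?_⟩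
    simp only [Pi.add_apply, hF' j θ y, hG' j θ y, mul_add]
  zero_mem' := ⟨contDiff_const, fun j θ y => by simp⟩
  smul_mem' := by
    rintro c F ⟨hF, hF'⟩
    refine ⟨hF.const_smul c, fun j θ y => ?_⟩
    simp only [Pi.smul_apply, hF' j θ y, smul_eq_mul]
    ring

/-- `∂_θ F`. -/
def dTheta {n : ℕ} (F : Fn n) : Fn n := fun p => fderiv ℝ F p (1, 0)

/-- The Euler operator `E_n F = ∑ⱼ yⱼ ∂ⱼ F`, i.e. the derivative at `(θ, y)` in the
direction `(0, y)`. -/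
def euler {n : ℕ} (F : Fn n) : Fn n := fun p => fderiv ℝ F p (0, p.2)

/-- `Δ_n F`, the Laplacian in the variable `y`. -/
def lap {n : ℕ} (F : Fn n) : Fn n :=
  fun p => Laplacian.laplacian (fun y : Eucl n => F (p.1, y)) p.2

/-- `κ = i ∂_θ`. -/
def kappa {n : ℕ} (F : Fn n) : Fn n := fun p => Complex.I * dTheta F p

/-- `η⁺ = ½ e^{-2iθ} (-E_n - i ∂_θ - (n/2 + 2is‖y‖²))`. -/
def etaPlus {n : ℕ} (s : ℂ) (F : Fn n) : Fn n := fun p =>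
  (1 / 2 : ℂ) * Complex.exp (-2 * Complex.I * p.1) *
    (-euler F p - Complex.I * dTheta F p
      - ((n : ℂ) / 2 + 2 * Complex.I * s * (‖p.2‖ : ℂ) ^ 2) * F p)

/-- `η⁻ = ½ e^{2iθ} (-E_n + i ∂_θ - (n/2 - 2is‖y‖²))`. -/
def etaMinus {n : ℕ} (s : ℂ) (F : Fn n) : Fn n := fun p =>
  (1 / 2 : ℂ) * Complex.exp (2 * Complex.I * p.1) *
    (-euler F p + Complex.I * dTheta F p
      - ((n : ℂ) / 2 - 2 * Complex.I * s * (‖p.2‖ : ℂ) ^ 2) * F p)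

/-- `Ω'' = ‖y‖² (4s ∂_θ + 4s² ‖y‖² + Δ_n)`. -/
def omega {n : ℕ} (s : ℂ) (F : Fn n) : Fn n := fun p =>
  (‖p.2‖ : ℂ) ^ 2 * (4 * s * dTheta F p + 4 * s ^ 2 * (‖p.2‖ : ℂ) ^ 2 * F p + lap F p)

/-- The action of `K = K₂ × O(n)`: the rotation of angle `φ` in `K₂` and `u ∈ O(n)` act by
`F ↦ ((θ, y) ↦ F(θ - φ, u⁻¹ y))`. Angles are taken in `ℝ`, which covers `K₂`. -/
def kAct {n : ℕ} (φ : ℝ) (u : OrthGroup n) : Fn n →ₗ[ℂ] Fn n where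
  toFun F := fun p => F (p.1 - φ, u⁻¹ p.2)
  map_add' _ _ := rfl
  map_smul' _ _ := rfl

/-- `F` is `K`-finite: its `K`-orbit spans a finite-dimensional space. -/
def IsKFinite {n : ℕ} (F : Fn n) : Prop :=
  FiniteDimensional ℂ
    (Submodule.span ℂ (Set.range fun g : ℝ × OrthGroup n => kAct g.1 g.2 F))

theorem IsKFinite.add {n : ℕ} {F G : Fn n} (hF : IsKFinite F) (hG : IsKFinite G) :
    IsKFinite (F + G) := by
  unfold IsKFinite at *
  refine Submodule.finiteDimensional_of_le
    (S₂ := Submodule.span ℂ (Set.range fun g : ℝ × OrthGroup n => kAct g.1 g.2 F) ⊔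
      Submodule.span ℂ (Set.range fun g : ℝ × OrthGroup n => kAct g.1 g.2 G))
    (Submodule.span_le.2 ?_)
  rintro _ ⟨g, rfl⟩
  simp only [map_add]
  exact Submodule.add_mem_sup (Submodule.subset_span ⟨g, rfl⟩) (Submodule.subset_span ⟨g, rfl⟩)

theorem IsKFinite.smul {n : ℕ} {F : Fn n} (c : ℂ) (hF : IsKFinite F) : IsKFinite (c • F) := by
  unfold IsKFinite at *
  refine Submodule.finiteDimensional_of_le
    (S₂ := Submodule.span ℂ (Set.range fun g : ℝ × OrthGroup n => kAct g.1 g.2 F))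
    (Submodule.span_le.2 ?_)
  rintro _ ⟨g, rfl⟩
  simp only [map_smul]
  exact Submodule.smul_mem _ _ (Submodule.subset_span ⟨g, rfl⟩)

theorem IsKFinite.zero {n : ℕ} : IsKFinite (0 : Fn n) := by
  have h : (Set.range fun g : ℝ × OrthGroup n => kAct g.1 g.2 (0 : Fn n)) ⊆ {0} := by
    rintro _ ⟨g, rfl⟩
    rfl
  exact FiniteDimensional.span_of_finite ℂ ((Set.finite_singleton _).subset h)

theorem omega_add {n : ℕ} (s : ℂ) {F G : Fn n} (hF : ContDiff ℝ ∞ F) (hG : ContDiff ℝ ∞ G) :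
    omega s (F + G) = omega s F + omega s G := by
  funext p
  have hs : ∀ {H : Fn n}, ContDiff ℝ ∞ H →
      ContDiffAt ℝ 2 (fun y : Eucl n => H (p.1, y)) p.2 := fun h =>
    ((h.of_le (by simpa using (WithTop.coe_le_coe.2 (le_top : (2 : ℕ∞) ≤ ⊤)))).comp (contDiff_prodMk_right p.1)).contDiffAt
  have hd : ∀ {H : Fn n}, ContDiff ℝ ∞ H → DifferentiableAt ℝ H p := fun h =>
    (h.differentiable (by simp)).differentiableAt
  have h1 : dTheta (F + G) p = dTheta F p + dTheta G p := by
    simp only [dTheta, fderiv_add (hd hF) (hd hG)]; rfl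
  have h2 : lap (F + G) p = lap F p + lap G p :=
    (hs hF).laplacian_add (hs hG)
  simp only [omega, Pi.add_apply, h1, h2]
  ring

theorem omega_smul {n : ℕ} (s c : ℂ) {F : Fn n} (hF : ContDiff ℝ ∞ F) :
    omega s (c • F) = c • omega s F := by
  funext p
  have hs : ContDiffAt ℝ 2 (fun y : Eucl n => F (p.1, y)) p.2 :=
    ((hF.of_le (by simpa using (WithTop.coe_le_coe.2 (le_top : (2 : ℕ∞) ≤ ⊤)))).comp (contDiff_prodMk_right p.1)).contDiffAt
  have hd : DifferentiableAt ℝ F p := (hF.differentiable (by simp)).differentiableAt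
  have h1 : dTheta (c • F) p = c * dTheta F p := by
    simp only [dTheta, fderiv_const_smul hd]; rfl
  have h2 : lap (c • F) p = c * lap F p :=
    InnerProductSpace.laplacian_smul c hs
  simp only [omega, Pi.smul_apply, smul_eq_mul, h1, h2]
  ring

/-- `ker(Ω'' - 2λ)_K`: the `K`-finite vectors of the kernel of `Ω'' - 2λ` in
`I''(q, -n/2, s)`. -/
def kerK (n : ℕ) (q : ℤ) (s : ℂ) (lam : ℤ) : Submodule ℂ (Fn n) where
  carrier := {F | F ∈ compactPicture n q ∧ omega s F = (2 * (lam : ℂ)) • F ∧ IsKFinite F}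
  add_mem' := by
    rintro F G ⟨hF, hF', hF''⟩ ⟨hG, hG', hG''⟩
    refine ⟨add_mem hF hG, ?_, hF''.add hG''⟩
    rw [omega_add s hF.1 hG.1, hF', hG', smul_add]
  zero_mem' := by
    refine ⟨zero_mem _, ?_, IsKFinite.zero⟩
    have := omega_smul s 0 (F := (0 : Fn n)) contDiff_const
    simpa using this
  smul_mem' := by
    rintro c F ⟨hF, hF', hF''⟩
    refine ⟨Submodule.smul_mem _ _ hF, ?_, hF''.smul c⟩
    rw [omega_smul s c hF.1, hF', smul_comm]

/-! ### Submodules for `sl₂ × O(n)` -/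

/-- `W` is an `sl₂ × O(n)`-submodule of `I''(q, -n/2, s)`: a subspace stable under the basis
`κ, η⁺, η⁻` of `sl₂(ℂ)` and under `O(n)`. -/
structure IsSubrep (n : ℕ) (q : ℤ) (s : ℂ) (W : Submodule ℂ (Fn n)) : Prop where
  le : W ≤ compactPicture n q
  kappa_mem : ∀ F ∈ W, kappa F ∈ W
  etaPlus_mem : ∀ F ∈ W, etaPlus s F ∈ W
  etaMinus_mem : ∀ F ∈ W, etaMinus s F ∈ W
  orth_mem : ∀ u : OrthGroup n, ∀ F ∈ W, kAct 0 u F ∈ W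

/-- `V ⊂ W` are `sl₂ × O(n)`-submodules and `W / V` is irreducible: `V ≠ W` and no submodule lies
strictly between them. -/
structure IsSimpleStep (n : ℕ) (q : ℤ) (s : ℂ) (V W : Submodule ℂ (Fn n)) : Prop where
  left : IsSubrep n q s V
  right : IsSubrep n q s W
  lt : V < W
  eq_or_eq : ∀ U, IsSubrep n q s U → V ≤ U → U ≤ W → U = V ∨ U = W

/-- `W` is an irreducible `sl₂ × O(n)`-submodule: it is nonzero and has no submodules other than
`0` and itself. -/
def IsIrred (n : ℕ) (q : ℤ) (s : ℂ) (W : Submodule ℂ (Fn n)) : Prop :=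
  IsSimpleStep n q s ⊥ W

/-! ### The vectors `F_{m,l,k}` -/

/-- `𝓗_k(ℝⁿ)`: complex harmonic polynomials that are homogeneous of degree `k`. -/
def harmonicPoly (n k : ℕ) : Set (MvPolynomial (Fin n) ℂ) :=
  {h | h.IsHomogeneous k ∧ ∑ j, MvPolynomial.pderiv j (MvPolynomial.pderiv j h) = 0}

/-- The confluent hypergeometric function `₁F₁(a, b, z) = ∑ⱼ (a)ⱼ / (b)ⱼ zʲ / j!`. -/
def oneFone (a b z : ℂ) : ℂ :=
  ∑' j : ℕ, (ascPochhammer ℂ j).eval a / ((ascPochhammer ℂ j).eval b * (j.factorial : ℂ)) * z ^ j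

/-- `F_{m,l,k}(θ, y) = e^{-imθ/2} e^{-isρ²} ρ^{2l} h(y) ₁F₁((m+4l+2k+n)/4, 2l+k+n/2, 2isρ²)`,
where `ρ = ‖y‖` and `h ∈ 𝓗_k(ℝⁿ)`. -/
def vec (n : ℕ) (s : ℂ) (m : ℤ) (l k : ℕ) (h : MvPolynomial (Fin n) ℂ) : Fn n := fun p =>
  Complex.exp (-Complex.I * m * p.1 / 2) * Complex.exp (-Complex.I * s * (‖p.2‖ : ℂ) ^ 2) *
    (‖p.2‖ : ℂ) ^ (2 * l) * MvPolynomial.eval (fun j => ((p.2 j : ℝ) : ℂ)) h *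
    oneFone (((m : ℂ) + 4 * l + 2 * k + n) / 4) (2 * l + k + (n : ℂ) / 2)
      (2 * Complex.I * s * (‖p.2‖ : ℂ) ^ 2)

/-- The span of the `F_{m,l,k}` over all `h ∈ 𝓗_k(ℝⁿ)` and all `m ∈ S` with
`m ≡ 2k + q mod 4`. -/
def vecSpan (n : ℕ) (q : ℤ) (s : ℂ) (l k : ℕ) (S : Set ℤ) : Submodule ℂ (Fn n) :=
  Submodule.span ℂ
    {F | ∃ m ∈ S, m ≡ 2 * k + q [ZMOD 4] ∧ ∃ h ∈ harmonicPoly n k, F = vec n s m l k h}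

/-- `H_{l,k}`. -/
def modH (n : ℕ) (q : ℤ) (s : ℂ) (l k : ℕ) : Submodule ℂ (Fn n) :=
  vecSpan n q s l k Set.univ

/-- `H⁺_{l,k}`, spanned by the `F_{m,l,k}` with `m ≥ 2k + 4l + n`. -/
def modHPlus (n : ℕ) (q : ℤ) (s : ℂ) (l k : ℕ) : Submodule ℂ (Fn n) :=
  vecSpan n q s l k {m | 2 * k + 4 * l + n ≤ m}

/-- `H⁻_{l,k}`, spanned by the `F_{m,l,k}` with `m ≤ -(2k + 4l + n)`. -/
def modHMinus (n : ℕ) (q : ℤ) (s : ℂ) (l k : ℕ) : Submodule ℂ (Fn n) :=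
  vecSpan n q s l k {m | m ≤ -(2 * k + 4 * l + n)}

/-! ### Admissibility -/

/-- Admissible eigenvalues: the triangular numbers `L(L-1)/2` if `n = 1`, and the numbers
`l(n + 2j)` with `1 ≤ l ≤ j + 1` if `n ≥ 2`. -/
def IsAdmissible (n : ℕ) (lam : ℤ) : Prop :=
  (n = 1 ∧ ∃ L : ℕ, 2 * lam = (L : ℤ) * ((L : ℤ) - 1)) ∨
  (2 ≤ n ∧ ∃ l j : ℤ, 1 ≤ l ∧ l ≤ j + 1 ∧ lam = l * (n + 2 * j))

/-- `λ`-admissible pairs: `λ = l(2l + 2k + n - 2)`, with `l ≥ 1` and `k ≥ 0` if `n ≥ 2`, and with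
`l ≥ 0` and `k ∈ {0, 1}` if `n = 1` (where `𝓗_k(ℝ) = 0` for `k ≥ 2`, and where the equation says
`λ = L(L-1)/2` with `L = 2l + k`). -/
def IsAdmissiblePair (n : ℕ) (lam : ℤ) (l k : ℕ) : Prop :=
  lam = (l : ℤ) * (2 * l + 2 * k + n - 2) ∧ ((2 ≤ n ∧ 1 ≤ l) ∨ (n = 1 ∧ k ≤ 1))

end SingularSchrodinger

end

open SingularSchrodinger

open scoped ContDiff

noncomputable section

namespace SingularSchrodinger

/-! The proof separates variables. A function of weight `m` is e^{-imθ/2} g(y), and on such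
functions Ω'' - 2λ becomes an equation for g alone, involving only r² and Δ (`RadialEq`). The
Casimir operator C of the rotations satisfies C = 2(r²Δ - E² - (n-2)E), where E is the Euler
operator (`casimir_eq`). A solution g that is also an eigenfunction of C therefore satisfies a
second order equation in E, that is, an ordinary differential equation on each ray with a regular
singularity at the origin. Two facts determine g. A solution flat at the origin vanishes
(`eq_zero_of_flat`). The lowest Taylor component is an eigenvector of r²Δ on homogeneous
polynomials, hence equals r^{2l} h with h harmonic of degree k (`exists_harmonic_of_r2lap_eq`), and
then λ = l(2l+2k+n-2). Subtracting the explicit Kummer solution with the same lowest term leaves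
zero; a second exponent could interfere only for n = 1, where parity excludes it (`exists_radVec`).

A K-finite vector lies in a finite-dimensional K-stable space. Such a space is stable under ∂_θ and
under C. The operator ∂_θ is diagonalizable there by periodicity (`eq_zero_of_generalized`), and C
is diagonalizable on each weight space because r²Δ is semisimple on polynomials (`r2lap_eq_of_sq`).
Hence the kernel is the sum of the H_{l,k} (`kerK_eq_iSup`). The sum is direct because different
weights are independent and different admissible pairs have different lowest degrees 2l + k
(`iSupIndep_modH`).

Put A = 2k + 4l + n. The contiguous relations of ₁F₁ show that η^± moves F_{m,l,k} to a multiple of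
F_{m±4,l,k}, and that the multiple is zero only for η⁺ at m = -A and for η⁻ at m = A (`etaPlus_vec`,
`etaMinus_vec`). Since 𝓗_k is irreducible under O(n) (`harmonic_irreducible`, proved with zonal
harmonics), the submodules of H_{l,k} correspond to the sets of weights closed under the nonzero
steps (`exists_stepClosed`). The weight A occurs exactly when q ≡ n and -A exactly when q ≡ -n
modulo 4, so the four cases become statements about sets of integers. -/

/-! ### Coordinates and commuting partial derivatives -/

/-- Coordinates `x i` and commuting derivations `d i` with `d i (x j) = δ i j` on a commutative
`ℂ`-algebra. -/
structure CoordSystem (n : ℕ) (A : Type*) [CommRing A] [Algebra ℂ A] where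
  x : Fin n → A
  d : Fin n → Derivation ℂ A A
  comm : ∀ i j a, d i (d j a) = d j (d i a)
  d_x : ∀ i j, d i (x j) = if i = j then 1 else 0

namespace CoordSystem

variable {n : ℕ} {A : Type*} [CommRing A] [Algebra ℂ A] (S : CoordSystem n A)

/-- The Euler operator. -/
def E : A →ₗ[ℂ] A := ∑ i, (LinearMap.mulLeft ℂ (S.x i)) ∘ₗ (S.d i : A →ₗ[ℂ] A)

/-- The Laplacian. -/
def lap : A →ₗ[ℂ] A := ∑ i, (S.d i : A →ₗ[ℂ] A) ∘ₗ (S.d i : A →ₗ[ℂ] A)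

/-- The squared radius. -/
def r2 : A := ∑ i, S.x i ^ 2

/-- The infinitesimal rotation `x i ∂ j - x j ∂ i`. -/
def rot (i j : Fin n) : A →ₗ[ℂ] A :=
  (LinearMap.mulLeft ℂ (S.x i)) ∘ₗ (S.d j : A →ₗ[ℂ] A) -
    (LinearMap.mulLeft ℂ (S.x j)) ∘ₗ (S.d i : A →ₗ[ℂ] A)

/-- The Casimir operator of the rotations, `∑ (x i ∂ j - x j ∂ i) ^ 2` over ordered pairs. -/
def casimir : A →ₗ[ℂ] A := ∑ i, ∑ j, (S.rot i j) ∘ₗ (S.rot i j)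

/-- The operator `r² Δ`. -/
def r2lap : A →ₗ[ℂ] A := (LinearMap.mulLeft ℂ S.r2) ∘ₗ S.lap

theorem E_apply (a : A) : S.E a = ∑ i, S.x i * S.d i a := by simp [E]

theorem lap_apply (a : A) : S.lap a = ∑ i, S.d i (S.d i a) := by simp [lap]

theorem rot_apply (i j : Fin n) (a : A) : S.rot i j a = S.x i * S.d j a - S.x j * S.d i a := by
  simp [rot]

theorem r2lap_apply (a : A) : S.r2lap a = S.r2 * S.lap a := by simp [r2lap]

theorem casimir_apply (a : A) : S.casimir a = ∑ i, ∑ j, S.rot i j (S.rot i j a) := by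
  simp [casimir]

theorem d_r2 (i : Fin n) : S.d i S.r2 = 2 * S.x i := by
  simp [r2, map_sum, Derivation.leibniz_pow, S.d_x]

theorem E_mul (a b : A) : S.E (a * b) = S.E a * b + a * S.E b := by
  simp only [E_apply, Derivation.leibniz, smul_eq_mul, Finset.sum_mul, Finset.mul_sum,
    ← Finset.sum_add_distrib]
  exact Finset.sum_congr rfl fun i _ => by ring

theorem lap_mul (a b : A) :
    S.lap (a * b) = S.lap a * b + 2 * ∑ i, S.d i a * S.d i b + a * S.lap b := by
  simp only [lap_apply, Derivation.leibniz, smul_eq_mul, Finset.sum_mul, Finset.mul_sum,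
    ← Finset.sum_add_distrib, map_add]
  exact Finset.sum_congr rfl fun i _ => by ring

theorem lap_r2 : S.lap S.r2 = 2 * n := by
  have h2 : ∀ i, S.d i (2 : A) = 0 := fun i => by
    simpa using (S.d i).map_natCast 2
  simp [lap_apply, d_r2, Derivation.leibniz, S.d_x, h2, mul_comm]

/-- The commutation relation [Δ, r²] = 4E + 2n. It drives the inductions on powers of r² below. -/
theorem lap_r2_mul (a : A) :
    S.lap (S.r2 * a) = S.r2lap a + 4 * S.E a + 2 * n * a := by
  rw [lap_mul, lap_r2, r2lap_apply, E_apply]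
  simp only [d_r2, Finset.mul_sum]
  have : ∀ i, (2 : A) * (2 * S.x i * S.d i a) = 4 * (S.x i * S.d i a) := fun i => by ring
  simp only [this]
  ring

theorem E_E (a : A) :
    S.E (S.E a) = S.E a + ∑ i, ∑ j, S.x i * S.x j * S.d i (S.d j a) := by
  have h : ∀ i, S.x i * S.d i (S.E a) =
      S.x i * S.d i a + ∑ j, S.x i * S.x j * S.d i (S.d j a) := by
    intro i
    have : ∀ j, S.d i (S.x j * S.d j a) =
        (if i = j then S.d j a else 0) + S.x j * S.d i (S.d j a) := by
      intro j
      rw [Derivation.leibniz, S.d_x, smul_eq_mul, smul_eq_mul]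
      split_ifs <;> ring
    rw [E_apply, map_sum, Finset.sum_congr rfl fun j _ => this j, Finset.sum_add_distrib,
      Finset.sum_ite_eq, if_pos (Finset.mem_univ i), mul_add, Finset.mul_sum]
    simp only [mul_assoc]
  rw [S.E_apply (S.E a), Finset.sum_congr rfl fun i _ => h i, Finset.sum_add_distrib, ← E_apply]

/-- Expands the squares and collects the terms by order of differentiation. The factor 2 comes from
summing over ordered pairs. The identity trades the angular part of r²Δ for the derivative along
rays. -/
theorem casimir_eq (a : A) :
    S.casimir a = 2 * (S.r2lap a - S.E (S.E a) - ((n : A) - 2) * S.E a) := by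
  have h : ∀ i j, S.rot i j (S.rot i j a) =
      (if j = i then S.x i * S.d j a else 0) + S.x i ^ 2 * S.d j (S.d j a) - S.x i * S.d i a
        - S.x i * S.x j * S.d i (S.d j a) - S.x j * S.d j a - S.x i * S.x j * S.d i (S.d j a)
        + (if i = j then S.x j * S.d i a else 0) + S.x j ^ 2 * S.d i (S.d i a) := by
    intro i j
    simp only [rot_apply, map_sub, Derivation.leibniz, smul_eq_mul, S.d_x, if_true, S.comm j i a]
    split_ifs <;> ring
  have h1 : ∑ i, ∑ j, S.x i ^ 2 * S.d j (S.d j a) = S.r2lap a := by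
    simp only [r2lap_apply, r2, lap_apply, Finset.sum_mul_sum]
  have h2 : ∑ i, ∑ j, S.x j ^ 2 * S.d i (S.d i a) = S.r2lap a := by
    rw [Finset.sum_comm, h1]
  have h3 : ∑ i, ∑ _j : Fin n, S.x i * S.d i a = n * S.E a := by
    simp [E_apply, Finset.mul_sum]
  simp only [casimir_apply, h, Finset.sum_add_distrib, Finset.sum_sub_distrib, E_E, h1, h2, h3,
    Finset.sum_ite_eq, Finset.sum_ite_eq', Finset.mem_univ, if_true, ← E_apply]
  simp only [Finset.sum_const, Finset.card_univ, Fintype.card_fin, nsmul_eq_mul]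
  ring

theorem rot_mul (i j : Fin n) (a b : A) :
    S.rot i j (a * b) = S.rot i j a * b + a * S.rot i j b := by
  simp only [rot_apply, Derivation.leibniz, smul_eq_mul]
  ring

end CoordSystem

/-! ### Homogeneous and harmonic polynomials -/

open MvPolynomial in
/-- The coordinates and partial derivatives of `ℂ[X₁, …, Xₙ]`. -/
def polyCoord (n : ℕ) : CoordSystem n (MvPolynomial (Fin n) ℂ) where
  x := X
  d := pderiv
  comm i j a := by
    have h : ⁅pderiv (R := ℂ) i, pderiv (R := ℂ) j⁆ = 0 := by
      refine derivation_ext fun k => ?_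
      simp [Derivation.commutator_apply, pderiv_X, Pi.single_apply, apply_ite]
    have := congrArg (fun D => D a) h
    simpa [Derivation.commutator_apply, sub_eq_zero] using this
  d_x i j := by
    rw [pderiv_X]; simp [Pi.single_apply, eq_comm]

variable {n : ℕ}

theorem mem_harmonicPoly {k : ℕ} {h : MvPolynomial (Fin n) ℂ} :
    h ∈ harmonicPoly n k ↔ h.IsHomogeneous k ∧ (polyCoord n).lap h = 0 := by
  rw [CoordSystem.lap_apply]; rfl

/-- `𝓗_k(ℝⁿ)` as a subspace. -/
def harmonicSubmodule (n k : ℕ) : Submodule ℂ (MvPolynomial (Fin n) ℂ) :=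
  MvPolynomial.homogeneousSubmodule (Fin n) ℂ k ⊓ LinearMap.ker (polyCoord n).lap

theorem mem_harmonicSubmodule {k : ℕ} {h : MvPolynomial (Fin n) ℂ} :
    h ∈ harmonicSubmodule n k ↔ h ∈ harmonicPoly n k := by
  rw [mem_harmonicPoly]; rfl

theorem polyCoord_E {N : ℕ} {P : MvPolynomial (Fin n) ℂ} (hP : P.IsHomogeneous N) :
    (polyCoord n).E P = (N : ℂ) • P := by
  rw [CoordSystem.E_apply]
  have := hP.sum_X_mul_pderiv
  rw [Nat.cast_smul_eq_nsmul]
  exact this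

theorem isHomogeneous_lap {N : ℕ} {P : MvPolynomial (Fin n) ℂ} (hP : P.IsHomogeneous N) :
    ((polyCoord n).lap P).IsHomogeneous (N - 2) := by
  rw [CoordSystem.lap_apply]
  exact MvPolynomial.IsHomogeneous.sum _ _ _ fun i _ => hP.pderiv.pderiv

theorem isHomogeneous_r2 : ((polyCoord n).r2).IsHomogeneous 2 :=
  MvPolynomial.IsHomogeneous.sum _ _ _ fun i _ => (MvPolynomial.isHomogeneous_X ℂ i).pow 2

theorem isHomogeneous_smul {N : ℕ} {P : MvPolynomial (Fin n) ℂ}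
    (hP : P.IsHomogeneous N) (c : ℂ) : (c • P).IsHomogeneous N :=
  (MvPolynomial.homogeneousSubmodule (Fin n) ℂ N).smul_mem c hP

theorem lap_r2_mul_poly {N : ℕ} {Q : MvPolynomial (Fin n) ℂ} (hQ : Q.IsHomogeneous N) :
    (polyCoord n).lap ((polyCoord n).r2 * Q) =
      (polyCoord n).r2lap Q + (4 * N + 2 * n : ℂ) • Q := by
  rw [CoordSystem.lap_r2_mul, polyCoord_E hQ, add_assoc]
  simp only [MvPolynomial.smul_eq_C_mul, map_add, map_mul, map_natCast, map_ofNat]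
  ring

theorem r2_ne_zero (hn : 1 ≤ n) : (polyCoord n).r2 ≠ 0 := by
  intro h
  have := (polyCoord n).lap_r2
  rw [h, map_zero] at this
  have h2 : ((2 * n : ℕ) : MvPolynomial (Fin n) ℂ) = 0 := by push_cast; exact this.symm
  rw [Nat.cast_eq_zero] at h2
  omega

/-- An eigenvector of `r² Δ` on homogeneous polynomials is `r^{2l} h` with `h` harmonic. -/
theorem exists_harmonic_of_r2lap_eq (hn : 1 ≤ n) (N : ℕ) :
    ∀ (P : MvPolynomial (Fin n) ℂ) (μ : ℂ), P.IsHomogeneous N → P ≠ 0 →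
      (polyCoord n).r2lap P = μ • P →
      ∃ l k : ℕ, N = 2 * l + k ∧ μ = 2 * l * (2 * l + 2 * k + n - 2) ∧
        ∃ h ∈ harmonicPoly n k, P = (polyCoord n).r2 ^ l * h := by
  induction N using Nat.strong_induction_on with
  | _ N ih =>
  intro P μ hP h0 hμ
  by_cases hm : μ = 0
  · refine ⟨0, N, by simp, by simp [hm], P, mem_harmonicPoly.2 ⟨hP, ?_⟩, by simp⟩
    rw [hm, zero_smul, CoordSystem.r2lap_apply] at hμ
    exact (mul_eq_zero.1 hμ).resolve_left (r2_ne_zero hn)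
  -- For μ ≠ 0 the eigenvalue equation itself exhibits P as r² Q. By [Δ, r²] = 4E + 2n, Q is again
  -- an eigenvector, with eigenvalue lowered by 4(N - 2) + 2n.
  set Q := μ⁻¹ • (polyCoord n).lap P with hQ
  have hPQ : P = (polyCoord n).r2 * Q := by
    rw [hQ, mul_smul_comm, ← CoordSystem.r2lap_apply, hμ, smul_smul, inv_mul_cancel₀ hm, one_smul]
  have hQh : Q.IsHomogeneous (N - 2) := isHomogeneous_smul (isHomogeneous_lap hP) _
  have hQ0 : Q ≠ 0 := by
    rintro h; rw [h, mul_zero] at hPQ; exact h0 hPQ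
  -- Comparing degrees of a nonzero polynomial shows that `N - 2` is not truncated.
  have hdeg : N = 2 + (N - 2) := by
    refine hP.inj_right ?_ h0
    nth_rewrite 1 [hPQ]
    exact isHomogeneous_r2.mul hQh
  have hQe : (polyCoord n).r2lap Q = (μ - (4 * (N - 2 : ℕ) + 2 * n)) • Q := by
    have h1 := lap_r2_mul_poly hQh
    rw [← hPQ] at h1
    have h2 : (polyCoord n).lap P = μ • Q := by
      rw [hQ, smul_smul, mul_inv_cancel₀ hm, one_smul]
    rw [sub_smul, ← h2, h1]
    simp
  obtain ⟨l, k, h1, h2, h, hh, h3⟩ := ih (N - 2) (by omega) Q _ hQh hQ0 hQe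
  refine ⟨l + 1, k, by omega, ?_, h, hh, ?_⟩
  · rw [sub_eq_iff_eq_add] at h2
    rw [h2, h1]; push_cast; ring
  · rw [hPQ, h3]; ring

theorem lap_eq_zero_of_lt_two {N : ℕ} {P : MvPolynomial (Fin n) ℂ} (hP : P.IsHomogeneous N)
    (hN : N < 2) : (polyCoord n).lap P = 0 := by
  rw [CoordSystem.lap_apply]
  refine Finset.sum_eq_zero fun i _ => ?_
  have h1 : ((polyCoord n).d i P).IsHomogeneous (N - 1) := hP.pderiv
  have h2 := h1.totalDegree_le
  rw [show N - 1 = 0 by omega, Nat.le_zero, MvPolynomial.totalDegree_eq_zero_iff_eq_C] at h2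
  rw [h2]
  exact MvPolynomial.pderiv_C

theorem isHomogeneous_r2lap {N : ℕ} {P : MvPolynomial (Fin n) ℂ} (hP : P.IsHomogeneous N) :
    ((polyCoord n).r2lap P).IsHomogeneous N := by
  rw [CoordSystem.r2lap_apply]
  by_cases hN : N < 2
  · rw [lap_eq_zero_of_lt_two hP hN, mul_zero]
    exact MvPolynomial.isHomogeneous_zero _ _ _
  · have := (isHomogeneous_r2 (n := n)).mul (isHomogeneous_lap hP)
    rwa [show 2 + (N - 2) = N by omega] at this

/-- `r² Δ` is semisimple on homogeneous polynomials. -/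
theorem r2lap_eq_of_sq (hn : 1 ≤ n) (N : ℕ) :
    ∀ (P R : MvPolynomial (Fin n) ℂ) (μ : ℂ), P.IsHomogeneous N →
      (polyCoord n).r2lap P = μ • P + R → (polyCoord n).r2lap R = μ • R → R = 0 := by
  induction N using Nat.strong_induction_on with
  | _ N ih =>
  intro P R μ hP hPR hR
  have hRe : R = (polyCoord n).r2lap P - μ • P := by rw [hPR]; simp
  -- If μ = 0, then R = r² Q with Q = ΔP, and Q would be an eigenvector of r²Δ with the negative
  -- eigenvalue -(4(N-2) + 2n), whereas all eigenvalues 2l(2l+2k+n-2) are nonnegative.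
  by_cases hm : μ = 0
  · subst hm
    rw [zero_smul] at hR
    rw [zero_smul, zero_add] at hPR
    rw [← hPR, CoordSystem.r2lap_apply, CoordSystem.r2lap_apply] at hR
    have hl := (mul_eq_zero.1 hR).resolve_left (r2_ne_zero hn)
    set Q := (polyCoord n).lap P with hQ
    have hQh : Q.IsHomogeneous (N - 2) := isHomogeneous_lap hP
    rw [lap_r2_mul_poly hQh] at hl
    by_cases hQ0 : Q = 0
    · rw [← hPR, CoordSystem.r2lap_apply, ← hQ, hQ0, mul_zero]
    obtain ⟨l, k, h1, h2, -⟩ := exists_harmonic_of_r2lap_eq hn _ Q _ hQh hQ0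
      ((eq_neg_of_add_eq_zero_left hl).trans (neg_smul _ _).symm)
    exfalso
    have h3 : ((2 * l * (2 * l + 2 * k + n) + 4 * (N - 2 : ℕ) + 2 * n : ℕ) : ℂ) =
        ((4 * l : ℕ) : ℂ) := by
      push_cast
      linear_combination -h2
    rw [Nat.cast_inj] at h3
    nlinarith [Nat.zero_le (l * k), Nat.zero_le (l * n), Nat.zero_le (N - 2)]
  have hRh : R.IsHomogeneous N := by
    rw [hRe]
    exact (isHomogeneous_r2lap hP).sub (isHomogeneous_smul hP _)
  -- The two equations give μ r²ΔP - r²ΔR = μ² P, so P is divisible by r².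
  set Q := (μ ^ 2)⁻¹ • (μ • (polyCoord n).lap P - (polyCoord n).lap R) with hQ
  have hPQ : P = (polyCoord n).r2 * Q := by
    have : P = (μ ^ 2)⁻¹ • (μ • (polyCoord n).r2lap P - (polyCoord n).r2lap R) := by
      rw [hPR, hR, smul_add, add_sub_cancel_right, smul_smul, smul_smul, mul_assoc, ← sq,
        inv_mul_cancel₀ (pow_ne_zero 2 hm), one_smul]
    rw [hQ, mul_smul_comm, mul_sub, mul_smul_comm, ← CoordSystem.r2lap_apply,
      ← CoordSystem.r2lap_apply]
    exact this
  have hQh : Q.IsHomogeneous (N - 2) :=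
    isHomogeneous_smul ((isHomogeneous_smul (isHomogeneous_lap hP) _).sub (isHomogeneous_lap hRh)) _
  by_cases hN : N < 2
  · have hP0 : P = 0 := by
      by_contra h0
      have : N = 2 + (N - 2) := by
        refine hP.inj_right ?_ h0
        nth_rewrite 1 [hPQ]
        exact isHomogeneous_r2.mul hQh
      omega
    rw [hP0] at hPR
    simpa using hPR.symm
  have hTQ := lap_r2_mul_poly hQh
  rw [← hPQ] at hTQ
  set c : ℂ := 4 * (N - 2 : ℕ) + 2 * n
  -- R' measures how far Q is from being an eigenvector for μ - c. It satisfies R = r² R', so the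
  -- pair (Q, R') has the same shape in degree N - 2.
  set R' := (polyCoord n).r2lap Q - (μ - c) • Q with hR'
  have hRR : R = (polyCoord n).r2 * R' := by
    calc R = (polyCoord n).r2 * (polyCoord n).lap P - μ • ((polyCoord n).r2 * Q) := by
          rw [← hPQ, ← CoordSystem.r2lap_apply, hRe]
      _ = (polyCoord n).r2 * R' := by
          rw [hTQ, hR', ← mul_smul_comm, ← mul_sub, sub_smul]
          congr 1
          abel
  have hR'h : R'.IsHomogeneous (N - 2) :=
    (isHomogeneous_r2lap hQh).sub (isHomogeneous_smul hQh _)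
  have h5 := lap_r2_mul_poly hR'h
  rw [← hRR] at h5
  have h6 : (polyCoord n).r2 * ((polyCoord n).r2lap R' + c • R') =
      (polyCoord n).r2 * (μ • R') := by
    rw [← h5, ← CoordSystem.r2lap_apply, hR, mul_smul_comm, ← hRR]
  have h7 := mul_left_cancel₀ (r2_ne_zero hn) h6
  rw [hRR, ih (N - 2) (by omega) Q R' (μ - c) hQh (by rw [hR']; abel)
    (by rw [sub_smul, ← h7]; simp), mul_zero]

/-! ### Smooth functions on `ℝⁿ` -/

/-- The algebra of smooth complex functions on `ℝⁿ`. -/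
def Sm (n : ℕ) : Subalgebra ℂ (Eucl n → ℂ) where
  carrier := {f | ContDiff ℝ ∞ f}
  mul_mem' {f g} hf hg := by
    change ContDiff ℝ ∞ f at hf
    exact hf.mul hg
  add_mem' {f g} hf hg := by
    change ContDiff ℝ ∞ f at hf
    exact hf.add hg
  algebraMap_mem' c := by
    change ContDiff ℝ ∞ (fun _ => c)
    exact contDiff_const

theorem contDiff_coe (f : Sm n) : ContDiff ℝ ∞ (f : Eucl n → ℂ) := f.2

theorem differentiable_coe (f : Sm n) : Differentiable ℝ (f : Eucl n → ℂ) :=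
  (contDiff_coe f).differentiable (by simp)

/-- The partial derivative of a smooth function in the direction of a basis vector. -/
def pd (i : Fin n) : Derivation ℂ (Sm n) (Sm n) :=
  Derivation.mk'
    { toFun := fun f => ⟨fun y => fderiv ℝ (f : Eucl n → ℂ) y (EuclideanSpace.single i 1),
        ((contDiff_coe f).fderiv_right (m := ∞) (by simp)).clm_apply contDiff_const⟩
      map_add' := fun f g => by
        ext y
        have := fderiv_add (differentiable_coe f y) (differentiable_coe g y)
        simpa using congrArg (fun L => L (EuclideanSpace.single i 1)) this
      map_smul' := fun c f => by
        ext y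
        have := fderiv_const_smul (differentiable_coe f y) c
        simpa using congrArg (fun L => L (EuclideanSpace.single i 1)) this }
    fun f g => by
      ext y
      have := fderiv_mul (differentiable_coe f y) (differentiable_coe g y)
      simpa using congrArg (fun L => L (EuclideanSpace.single i 1)) this

theorem pd_apply (i : Fin n) (f : Sm n) (y : Eucl n) :
    (pd i f : Eucl n → ℂ) y = fderiv ℝ (f : Eucl n → ℂ) y (EuclideanSpace.single i 1) := rfl

/-- The coordinate functions. -/
def coord (i : Fin n) : Sm n :=
  ⟨fun y => ((y i : ℝ) : ℂ),
    show ContDiff ℝ ∞ _ from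
      (Complex.ofRealCLM.comp (EuclideanSpace.proj i : Eucl n →L[ℝ] ℝ)).contDiff⟩

theorem coord_apply (i : Fin n) (y : Eucl n) : (coord i : Eucl n → ℂ) y = ((y i : ℝ) : ℂ) := rfl

theorem pd_pd_apply (i j : Fin n) (f : Sm n) (y : Eucl n) :
    (pd i (pd j f) : Eucl n → ℂ) y =
      fderiv ℝ (fderiv ℝ (f : Eucl n → ℂ)) y (EuclideanSpace.single i 1)
        (EuclideanSpace.single j 1) := by
  rw [pd_apply]
  have h : DifferentiableAt ℝ (fderiv ℝ (f : Eucl n → ℂ)) y :=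
    ((contDiff_coe f).fderiv_right (m := ∞) (by simp)).differentiable (by simp) y
  have := fderiv_clm_apply h (differentiableAt_const (EuclideanSpace.single j (1 : ℝ)))
  have h2 : ((pd j f : Sm n) : Eucl n → ℂ) =
      fun y => (fderiv ℝ (f : Eucl n → ℂ) y) (EuclideanSpace.single j 1) := rfl
  rw [h2, this]
  simp

/-- The coordinates and partial derivatives of smooth functions. -/
def smCoord (n : ℕ) : CoordSystem n (Sm n) where
  x := coord
  d := pd
  comm i j f := by
    ext y
    rw [pd_pd_apply, pd_pd_apply]
    have h : IsSymmSndFDerivAt ℝ (f : Eucl n → ℂ) y :=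
      ((contDiff_coe f).contDiffAt).isSymmSndFDerivAt
        (by simpa using WithTop.coe_le_coe.2 (le_top : (2 : ℕ∞) ≤ ⊤))
    exact h _ _
  d_x i j := by
    ext y
    rw [pd_apply]
    have : ((coord j : Sm n) : Eucl n → ℂ) =
        ⇑(Complex.ofRealCLM.comp (EuclideanSpace.proj j : Eucl n →L[ℝ] ℝ)) := rfl
    rw [this, ContinuousLinearMap.fderiv]
    by_cases h : i = j
    · subst h; simp
    · simp [h, Ne.symm h]

theorem sum_coord_single (y : Eucl n) : y = ∑ i, y i • EuclideanSpace.single i (1 : ℝ) := by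
  ext j
  simp [Finset.sum_apply, Pi.single_apply]

theorem smCoord_E_apply (f : Sm n) (y : Eucl n) :
    ((smCoord n).E f : Eucl n → ℂ) y = fderiv ℝ (f : Eucl n → ℂ) y y := by
  rw [CoordSystem.E_apply]
  nth_rewrite 3 [sum_coord_single y]
  rw [map_sum]
  simp [smCoord, pd_apply, coord_apply]

theorem smCoord_r2_apply (y : Eucl n) :
    ((smCoord n).r2 : Eucl n → ℂ) y = (‖y‖ : ℂ) ^ 2 := by
  rw [← Complex.ofReal_pow, EuclideanSpace.real_norm_sq_eq]
  simp [CoordSystem.r2, smCoord, coord_apply]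

theorem smCoord_lap_apply (f : Sm n) (y : Eucl n) :
    ((smCoord n).lap f : Eucl n → ℂ) y = Laplacian.laplacian (f : Eucl n → ℂ) y := by
  rw [CoordSystem.lap_apply,
    InnerProductSpace.laplacian_eq_iteratedFDeriv_orthonormalBasis _ (EuclideanSpace.basisFun (Fin n) ℝ)]
  simp only [smCoord, AddSubmonoidClass.coe_finsetSum, Finset.sum_apply, pd_pd_apply,
    iteratedFDeriv_two_apply]
  simp

/-- Polynomials as smooth functions. -/
def ev : MvPolynomial (Fin n) ℂ →ₐ[ℂ] Sm n := MvPolynomial.aeval coord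

theorem ev_apply (P : MvPolynomial (Fin n) ℂ) (y : Eucl n) :
    (ev P : Eucl n → ℂ) y = MvPolynomial.eval (fun j => ((y j : ℝ) : ℂ)) P := by
  induction P using MvPolynomial.induction_on with
  | C a => simp [ev]
  | add p q hp hq => simp [hp, hq]
  | mul_X p i hp =>
    have h2 : ev (MvPolynomial.X i) = (coord i : Sm n) := by simp [ev]
    simp [hp, h2, coord_apply]

theorem pd_ev (i : Fin n) (P : MvPolynomial (Fin n) ℂ) :
    pd i (ev P) = ev (MvPolynomial.pderiv i P) := by
  induction P using MvPolynomial.induction_on with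
  | C a => simp [ev]
  | add p q hp hq => simp [hp, hq]
  | mul_X p j hp =>
    have h1 : pd i (coord j : Sm n) = ev (MvPolynomial.pderiv i (MvPolynomial.X j)) := by
      have := (smCoord n).d_x i j
      rw [show (smCoord n).d i ((smCoord n).x j) = pd i (coord j) from rfl] at this
      rw [this, MvPolynomial.pderiv_X]
      by_cases h : i = j
      · subst h; simp
      · simp [h, Ne.symm h]
    have h2 : ev (MvPolynomial.X j) = (coord j : Sm n) := by simp [ev]
    rw [map_mul, Derivation.leibniz, Derivation.leibniz, hp, h2, h1]
    simp [h2]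

theorem ev_lap (P : MvPolynomial (Fin n) ℂ) : (smCoord n).lap (ev P) = ev ((polyCoord n).lap P) := by
  simp only [CoordSystem.lap_apply, map_sum]
  exact Finset.sum_congr rfl fun i _ => by
    rw [show (smCoord n).d = pd from rfl, show (polyCoord n).d = MvPolynomial.pderiv from rfl,
      pd_ev, pd_ev]

theorem ev_E (P : MvPolynomial (Fin n) ℂ) : (smCoord n).E (ev P) = ev ((polyCoord n).E P) := by
  simp only [CoordSystem.E_apply, map_sum, map_mul]
  exact Finset.sum_congr rfl fun i _ => by
    rw [show (smCoord n).d = pd from rfl, show (polyCoord n).d = MvPolynomial.pderiv from rfl,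
      pd_ev, show (smCoord n).x = coord from rfl, show (polyCoord n).x = MvPolynomial.X from rfl]
    simp [ev]

theorem ev_r2 : ev ((polyCoord n).r2) = (smCoord n).r2 := by
  simp [CoordSystem.r2, ev, polyCoord, smCoord]

/-! ### Homogeneous Taylor components at the origin -/

/-- The homogeneous component of degree `d` of the Taylor series at the origin. -/
def taylorPart : ℕ → Sm n →ₗ[ℂ] MvPolynomial (Fin n) ℂ
  | 0 => (Algebra.linearMap ℂ (MvPolynomial (Fin n) ℂ)) ∘ₗ (LinearMap.proj (0 : Eucl n)) ∘ₗ (Sm n).val.toLinearMap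
  -- Euler's identity (d+1) T_{d+1} g = ∑ xᵢ T_d(∂ᵢ g) serves as the definition, so neither
  -- multi-indices nor higher derivatives are needed.
  | d + 1 => ((d + 1 : ℂ)⁻¹) •
      ∑ i, (LinearMap.mulLeft ℂ (MvPolynomial.X i)) ∘ₗ taylorPart d ∘ₗ (pd i : Sm n →ₗ[ℂ] Sm n)

theorem taylorPart_zero (g : Sm n) : taylorPart 0 g = MvPolynomial.C ((g : Eucl n → ℂ) 0) := rfl

theorem taylorPart_succ (d : ℕ) (g : Sm n) :
    taylorPart (d + 1) g = ((d + 1 : ℂ)⁻¹) • ∑ i, MvPolynomial.X i * taylorPart d (pd i g) := by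
  simp [taylorPart]

theorem smul_taylorPart_succ (d : ℕ) (g : Sm n) :
    (d + 1 : ℂ) • taylorPart (d + 1) g = ∑ i, MvPolynomial.X i * taylorPart d (pd i g) := by
  rw [taylorPart_succ, smul_smul, mul_inv_cancel₀ (Nat.cast_add_one_ne_zero d), one_smul]

theorem isHomogeneous_taylorPart (d : ℕ) (g : Sm n) : (taylorPart d g).IsHomogeneous d := by
  induction d generalizing g with
  | zero => exact MvPolynomial.isHomogeneous_C (Fin n) ((g : Eucl n → ℂ) 0)
  | succ d ih =>
    rw [taylorPart_succ]
    refine isHomogeneous_smul (MvPolynomial.IsHomogeneous.sum _ _ _ fun i _ => ?_) _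
    rw [add_comm]
    exact (MvPolynomial.isHomogeneous_X ℂ i).mul (ih _)

/-- The product rule applied to the recursion leaves the components of ∂ⱼ g; the induction
hypothesis and ∂ᵢ∂ⱼ = ∂ⱼ∂ᵢ turn these into the recursion for ∂ᵢ g. -/
theorem pderiv_taylorPart_succ (d : ℕ) (i : Fin n) (g : Sm n) :
    MvPolynomial.pderiv i (taylorPart (d + 1) g) = taylorPart d (pd i g) := by
  have key : ∀ d, ∀ g : Sm n, MvPolynomial.pderiv i (∑ j, MvPolynomial.X j * taylorPart d (pd j g)) =
      taylorPart d (pd i g) + ∑ j, MvPolynomial.X j * MvPolynomial.pderiv i (taylorPart d (pd j g)) := by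
    intro d g
    rw [map_sum]
    simp only [Derivation.leibniz, smul_eq_mul, MvPolynomial.pderiv_X, Finset.sum_add_distrib]
    rw [add_comm]
    congr 1
    simp [Pi.single_apply]
  have hne : ((d : ℂ) + 1) ≠ 0 := Nat.cast_add_one_ne_zero d
  induction d generalizing g with
  | zero =>
    rw [taylorPart_succ, Derivation.map_smul, key]
    simp [taylorPart_zero]
  | succ d ih =>
    rw [taylorPart_succ, Derivation.map_smul, key]
    have : ∀ j, MvPolynomial.pderiv i (taylorPart (d + 1) (pd j g)) = taylorPart d (pd j (pd i g)) := by
      intro j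
      rw [ih _ (Nat.cast_add_one_ne_zero d), show pd i (pd j g) = pd j (pd i g) from (smCoord n).comm i j g]
    simp only [this]
    rw [← smul_taylorPart_succ, inv_smul_eq_iff₀ hne]
    push_cast
    module

theorem pd_coord_mul (i j : Fin n) (g : Sm n) :
    pd j (coord i * g) = (if j = i then g else 0) + coord i * pd j g := by
  have := (smCoord n).d_x j i
  rw [show (smCoord n).d j ((smCoord n).x i) = pd j (coord i) from rfl] at this
  rw [Derivation.leibniz, this, smul_eq_mul, smul_eq_mul]
  split_ifs <;> ring

theorem taylorPart_zero_coord_mul (i : Fin n) (g : Sm n) : taylorPart 0 (coord i * g) = 0 := by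
  simp [taylorPart_zero, coord_apply]

theorem taylorPart_succ_coord_mul (d : ℕ) (i : Fin n) (g : Sm n) :
    taylorPart (d + 1) (coord i * g) = MvPolynomial.X i * taylorPart d g := by
  induction d generalizing g with
  | zero =>
    rw [taylorPart_succ]
    simp only [pd_coord_mul, map_add, mul_add, Finset.sum_add_distrib, taylorPart_zero_coord_mul]
    rw [Finset.sum_eq_single i (by simp +contextual) (by simp)]
    simp
  | succ d ih =>
    rw [taylorPart_succ]
    simp only [pd_coord_mul, map_add, mul_add, Finset.sum_add_distrib, ih]
    rw [Finset.sum_eq_single i (by simp +contextual) (by simp), if_pos rfl]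
    have h : ∑ j, MvPolynomial.X j * (MvPolynomial.X i * taylorPart d (pd j g)) =
        (d + 1 : ℂ) • (MvPolynomial.X i * taylorPart (d + 1) g) := by
      rw [← mul_smul_comm, smul_taylorPart_succ, Finset.mul_sum]
      exact Finset.sum_congr rfl fun j _ => by ring
    have hne : ((d + 1 : ℕ) : ℂ) + 1 ≠ 0 := Nat.cast_add_one_ne_zero (d + 1)
    rw [h, inv_smul_eq_iff₀ hne]
    push_cast
    module

theorem taylorPart_E (d : ℕ) (g : Sm n) : taylorPart d ((smCoord n).E g) = (d : ℂ) • taylorPart d g := by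
  rw [CoordSystem.E_apply, map_sum]
  cases d with
  | zero =>
    rw [Nat.cast_zero, zero_smul]
    exact Finset.sum_eq_zero fun i _ => taylorPart_zero_coord_mul i _
  | succ d =>
    rw [Nat.cast_add, Nat.cast_one, smul_taylorPart_succ]
    exact Finset.sum_congr rfl fun i _ => taylorPart_succ_coord_mul d i _

/-- Multiplication by a homogeneous polynomial shifts the Taylor components. -/
theorem taylorPart_ev_mul {a : ℕ} {P : MvPolynomial (Fin n) ℂ} (hP : P.IsHomogeneous a) (g : Sm n) :
    (∀ d, taylorPart (a + d) (ev P * g) = P * taylorPart d g) ∧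
      ∀ d < a, taylorPart d (ev P * g) = 0 := by
  induction a generalizing P with
  | zero =>
    have h2 := hP.totalDegree_le
    rw [Nat.le_zero, MvPolynomial.totalDegree_eq_zero_iff_eq_C] at h2
    rw [h2]
    set c := MvPolynomial.coeff 0 P
    have h3 : ev (MvPolynomial.C c) * g = c • g := by
      rw [ev, MvPolynomial.aeval_C, Algebra.smul_def]
    refine ⟨fun d => ?_, fun d hd => absurd hd (Nat.not_lt_zero d)⟩
    rw [h3, map_smul, zero_add, MvPolynomial.smul_eq_C_mul]
  | succ a ih =>
    have hX : ∀ i, ev (MvPolynomial.X i) = (coord i : Sm n) := fun i => by simp [ev]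
    have hi : ∀ i, (MvPolynomial.pderiv i P).IsHomogeneous a := fun i => hP.pderiv
    have hE : ((a : ℂ) + 1) • P = ∑ i, MvPolynomial.X i * MvPolynomial.pderiv i P := by
      have := polyCoord_E hP
      rw [CoordSystem.E_apply] at this
      push_cast at this
      exact this.symm
    have hPg : ((a : ℂ) + 1) • (ev P * g) = ∑ i, coord i * (ev (MvPolynomial.pderiv i P) * g) := by
      rw [← smul_mul_assoc, ← map_smul, hE, map_sum, Finset.sum_mul]
      simp only [map_mul, hX, mul_assoc]
    have hne : (a : ℂ) + 1 ≠ 0 := Nat.cast_add_one_ne_zero a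
    refine ⟨fun d => ?_, fun d hd => ?_⟩
    · refine smul_right_injective _ hne ?_
      beta_reduce
      rw [← map_smul, hPg, ← smul_mul_assoc, hE, map_sum, Finset.sum_mul]
      refine Finset.sum_congr rfl fun i _ => ?_
      rw [show a + 1 + d = (a + d) + 1 by ring, taylorPart_succ_coord_mul, (ih (hi i)).1, mul_assoc]
    · refine smul_right_injective _ hne ?_
      beta_reduce
      rw [← map_smul, hPg, smul_zero, map_sum]
      refine Finset.sum_eq_zero fun i _ => ?_
      cases d with
      | zero => exact taylorPart_zero_coord_mul i _
      | succ d => rw [taylorPart_succ_coord_mul, (ih (hi i)).2 d (by omega), mul_zero]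

theorem taylorPart_lap (d : ℕ) (g : Sm n) :
    taylorPart d ((smCoord n).lap g) = (polyCoord n).lap (taylorPart (d + 2) g) := by
  rw [CoordSystem.lap_apply, CoordSystem.lap_apply, map_sum]
  refine Finset.sum_congr rfl fun i _ => ?_
  rw [show (polyCoord n).d = MvPolynomial.pderiv from rfl, pderiv_taylorPart_succ,
    pderiv_taylorPart_succ]
  rfl

theorem taylorPart_r2_mul (d : ℕ) (g : Sm n) :
    taylorPart (2 + d) ((smCoord n).r2 * g) = (polyCoord n).r2 * taylorPart d g := by
  rw [← ev_r2]
  exact (taylorPart_ev_mul isHomogeneous_r2 g).1 d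

theorem taylorPart_r2_mul_of_lt {d : ℕ} (hd : d < 2) (g : Sm n) :
    taylorPart d ((smCoord n).r2 * g) = 0 := by
  rw [← ev_r2]
  exact (taylorPart_ev_mul isHomogeneous_r2 g).2 d hd

/-- Since r²Δ preserves the degree, it acts on each Taylor component separately, which reduces
differential equations to statements about homogeneous polynomials. -/
theorem taylorPart_r2lap (d : ℕ) (g : Sm n) :
    taylorPart d ((smCoord n).r2lap g) = (polyCoord n).r2lap (taylorPart d g) := by
  rw [CoordSystem.r2lap_apply, CoordSystem.r2lap_apply]
  by_cases hd : d < 2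
  · rw [taylorPart_r2_mul_of_lt hd, lap_eq_zero_of_lt_two (isHomogeneous_taylorPart d g) hd, mul_zero]
  · obtain ⟨e, rfl⟩ : ∃ e, d = 2 + e := ⟨d - 2, by omega⟩
    rw [taylorPart_r2_mul, taylorPart_lap, add_comm e 2]

/-! ### Flat solutions of the radial equation -/

theorem hasDerivAt_ray (g : Sm n) (y : Eucl n) (t : ℝ) :
    HasDerivAt (fun t : ℝ => (g : Eucl n → ℂ) (t • y)) (fderiv ℝ (g : Eucl n → ℂ) (t • y) y) t := by
  have h1 : HasDerivAt (fun t : ℝ => t • y) y t := by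
    simpa using (hasDerivAt_id t).smul_const y
  exact (differentiable_coe g (t • y)).hasFDerivAt.comp_hasDerivAt t h1

theorem fderiv_eq_sum_pd (g : Sm n) (z y : Eucl n) :
    fderiv ℝ (g : Eucl n → ℂ) z y = ∑ i, (y i : ℂ) * (pd i g : Eucl n → ℂ) z := by
  nth_rewrite 1 [sum_coord_single y]
  rw [map_sum]
  simp [pd_apply]

theorem flat_pd {g : Sm n} (hg : ∀ d, taylorPart d g = 0) (i : Fin n) (d : ℕ) :
    taylorPart d (pd i g) = 0 := by
  rw [← pderiv_taylorPart_succ, hg, map_zero]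

/-- A flat smooth function vanishes to all orders along rays. -/
theorem exists_bound_of_flat (y : Eucl n) (N : ℕ) :
    ∀ g : Sm n, (∀ d, taylorPart d g = 0) →
      ∃ K : ℝ, 0 ≤ K ∧ ∀ t ∈ Set.Icc (0 : ℝ) 1, ‖(g : Eucl n → ℂ) (t • y)‖ ≤ K * t ^ N := by
  induction N with
  | zero =>
    intro g _
    have hc : ContinuousOn (fun t : ℝ => (g : Eucl n → ℂ) (t • y)) (Set.Icc 0 1) :=
      ((contDiff_coe g).continuous.comp (by fun_prop : Continuous fun t : ℝ => t • y)).continuousOn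
    obtain ⟨K, hK⟩ := isCompact_Icc.exists_bound_of_continuousOn hc
    exact ⟨K, (norm_nonneg _).trans (hK 0 (by simp)), fun t ht => by simpa using hK t ht⟩
  | succ N ih =>
    intro g hg
    choose K hK0 hK using fun i => ih (pd i g) (flat_pd hg i)
    have h0 : (g : Eucl n → ℂ) 0 = 0 := by
      have := hg 0
      rw [taylorPart_zero] at this
      simpa using this
    set M := ∑ i, |y i| * K i with hM
    have hM0 : 0 ≤ M := Finset.sum_nonneg fun i _ => mul_nonneg (abs_nonneg _) (hK0 i)
    refine ⟨M, hM0, fun t ht => ?_⟩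
    -- The derivative along the ray is ∑ yᵢ ∂ᵢ g, whose factors ∂ᵢ g are flat as well and so are
    -- O(t^N). The mean value inequality then gains one power of t.
    have hb : ∀ r ∈ Set.Icc (0 : ℝ) t, ‖fderiv ℝ (g : Eucl n → ℂ) (r • y) y‖ ≤ M * t ^ N := by
      intro r hr
      rw [fderiv_eq_sum_pd, hM, Finset.sum_mul]
      refine (norm_sum_le _ _).trans (Finset.sum_le_sum fun i _ => ?_)
      rw [norm_mul, Complex.norm_real, Real.norm_eq_abs, mul_assoc]
      refine mul_le_mul_of_nonneg_left ?_ (abs_nonneg _)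
      refine (hK i r ⟨hr.1, hr.2.trans ht.2⟩).trans ?_
      exact mul_le_mul_of_nonneg_left (pow_le_pow_left₀ hr.1 hr.2 N) (hK0 i)
    have := (convex_Icc (0 : ℝ) t).norm_image_sub_le_of_norm_hasDerivWithin_le
      (fun r _ => (hasDerivAt_ray g y r).hasDerivWithinAt) hb
      (Set.left_mem_Icc.2 ht.1) (Set.right_mem_Icc.2 ht.1)
    rw [zero_smul, h0, sub_zero, sub_zero, Real.norm_eq_abs, abs_of_nonneg ht.1] at this
    rw [pow_succ, ← mul_assoc]
    exact this

/-- A smooth function that is flat at the origin and solves a second order equation in the Euler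
operator with coefficients bounded on rays vanishes. -/
theorem eq_zero_of_flat {g : Sm n} (hg : ∀ d, taylorPart d g = 0) (a : ℂ) (b : Sm n)
    (h : (smCoord n).E ((smCoord n).E g) = a • (smCoord n).E g + b * g) : g = 0 := by
  ext y
  have hEg : ∀ d, taylorPart d ((smCoord n).E g) = 0 := fun d => by rw [taylorPart_E, hg, smul_zero]
  have hc : ContinuousOn (fun t : ℝ => (b : Eucl n → ℂ) (t • y)) (Set.Icc 0 1) :=
    ((contDiff_coe b).continuous.comp (by fun_prop : Continuous fun t : ℝ => t • y)).continuousOn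
  obtain ⟨B, hB⟩ := isCompact_Icc.exists_bound_of_continuousOn hc
  have hB0 : 0 ≤ B := (norm_nonneg _).trans (hB 0 (by simp))
  -- On the ray let φ = g and ψ = Eg, so that tφ' = ψ and tψ' = aψ + bφ. This M bounds the
  -- logarithmic growth: t (|φ|² + |ψ|²)' ≤ M (|φ|² + |ψ|²).
  obtain ⟨M, hM⟩ := exists_nat_ge (1 + B + 2 * ‖a‖ : ℝ)
  have hM1 : (1 : ℝ) ≤ M := by linarith [norm_nonneg a]
  obtain ⟨K, hK0, hK⟩ := exists_bound_of_flat y M g hg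
  obtain ⟨K', hK0', hK'⟩ := exists_bound_of_flat y M _ hEg
  set φ : ℝ → ℂ := fun t => (g : Eucl n → ℂ) (t • y) with hφ
  set ψ : ℝ → ℂ := fun t => ((smCoord n).E g : Eucl n → ℂ) (t • y) with hψ
  set φ' : ℝ → ℂ := fun t => fderiv ℝ (g : Eucl n → ℂ) (t • y) y
  set ψ' : ℝ → ℂ := fun t => fderiv ℝ ((smCoord n).E g : Eucl n → ℂ) (t • y) y
  have hdφ : ∀ t, HasDerivAt φ (φ' t) t := hasDerivAt_ray g y
  have hdψ : ∀ t, HasDerivAt ψ (ψ' t) t := hasDerivAt_ray _ y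
  have h1 : ∀ t : ℝ, (t : ℂ) * φ' t = ψ t := fun t => by
    simp only [hψ, smCoord_E_apply, map_smul, φ', Complex.real_smul]
  have h2 : ∀ t : ℝ, (t : ℂ) * ψ' t = a * ψ t + (b : Eucl n → ℂ) (t • y) * φ t := fun t => by
    have := congrFun (congrArg (Subtype.val) h) (t • y)
    rw [smCoord_E_apply, map_smul, Complex.real_smul] at this
    exact this
  -- By the growth bound this quotient is nonincreasing on (0, 1], while flatness makes it tend to 0
  -- at the origin. Hence it is at most 0 at t = 1.
  set w : ℝ → ℝ := fun t => (‖φ t‖ ^ 2 + ‖ψ t‖ ^ 2) / t ^ M with hw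
  have hdw : ∀ t ≠ 0, HasDerivAt w (((2 * inner ℝ (φ t) (φ' t) + 2 * inner ℝ (ψ t) (ψ' t)) * t ^ M -
      (‖φ t‖ ^ 2 + ‖ψ t‖ ^ 2) * (M * t ^ (M - 1))) / (t ^ M) ^ 2) t := by
    intro t ht
    have := ((hdφ t).norm_sq.add (hdψ t).norm_sq).div (hasDerivAt_pow M t) (pow_ne_zero M ht)
    exact this
  have hanti : AntitoneOn w (Set.Ioc 0 1) := by
    refine antitoneOn_of_deriv_nonpos (convex_Ioc 0 1)
      (fun t ht => (hdw t ht.1.ne').continuousAt.continuousWithinAt)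
      (fun t ht => (hdw t ?_).differentiableAt.differentiableWithinAt) fun t ht => ?_
    · rw [interior_Ioc] at ht; exact ht.1.ne'
    rw [interior_Ioc] at ht
    rw [(hdw t ht.1.ne').deriv]
    refine div_nonpos_of_nonpos_of_nonneg ?_ (sq_nonneg _)
    have e1 : t * inner ℝ (φ t) (φ' t) ≤ ‖φ t‖ * ‖ψ t‖ := by
      rw [← h1 t, ← real_inner_smul_right, Complex.real_smul]
      exact real_inner_le_norm _ _
    have e2 : t * inner ℝ (ψ t) (ψ' t) ≤ ‖ψ t‖ * (‖a‖ * ‖ψ t‖ + B * ‖φ t‖) := by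
      rw [← real_inner_smul_right, Complex.real_smul, h2]
      refine (real_inner_le_norm _ _).trans (mul_le_mul_of_nonneg_left ?_ (norm_nonneg _))
      refine (norm_add_le _ _).trans ?_
      rw [norm_mul, norm_mul]
      gcongr
      exact hB t ⟨ht.1.le, ht.2.le⟩
    have e3 : t * (2 * inner ℝ (φ t) (φ' t) + 2 * inner ℝ (ψ t) (ψ' t)) ≤
        M * (‖φ t‖ ^ 2 + ‖ψ t‖ ^ 2) := by
      have : (1 + B + 2 * ‖a‖) * (‖φ t‖ ^ 2 + ‖ψ t‖ ^ 2) ≤ M * (‖φ t‖ ^ 2 + ‖ψ t‖ ^ 2) :=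
        mul_le_mul_of_nonneg_right hM (by positivity)
      nlinarith [mul_nonneg hB0 (sq_nonneg (‖φ t‖ - ‖ψ t‖)), sq_nonneg (‖φ t‖ - ‖ψ t‖),
        mul_nonneg (norm_nonneg a) (sq_nonneg ‖φ t‖)]
    have hMpos : 0 < M := by exact_mod_cast (lt_of_lt_of_le one_pos hM1)
    obtain ⟨M', rfl⟩ : ∃ M', M = M' + 1 := ⟨M - 1, by omega⟩
    rw [Nat.add_sub_cancel, pow_succ]
    have := mul_le_mul_of_nonneg_left e3 (pow_nonneg ht.1.le M')
    nlinarith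
  have hlim : ∀ t ∈ Set.Ioc (0 : ℝ) 1, w t ≤ (K ^ 2 + K' ^ 2) * t ^ M := by
    intro t ht
    have ht' : t ∈ Set.Icc (0 : ℝ) 1 := ⟨ht.1.le, ht.2⟩
    rw [hw]
    beta_reduce
    rw [div_le_iff₀ (pow_pos ht.1 M)]
    have a1 := pow_le_pow_left₀ (norm_nonneg _) (hK t ht') 2
    have a2 := pow_le_pow_left₀ (norm_nonneg _) (hK' t ht') 2
    calc ‖φ t‖ ^ 2 + ‖ψ t‖ ^ 2 ≤ (K * t ^ M) ^ 2 + (K' * t ^ M) ^ 2 := add_le_add a1 a2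
      _ = _ := by ring
  have hle : w 1 ≤ 0 := by
    have ht : Filter.Tendsto (fun t : ℝ => (K ^ 2 + K' ^ 2) * t ^ M) (nhdsWithin 0 (Set.Ioi 0))
        (nhds 0) := by
      have : Continuous fun t : ℝ => (K ^ 2 + K' ^ 2) * t ^ M := by fun_prop
      have h0 := (this.tendsto 0).mono_left (nhdsWithin_le_nhds (s := Set.Ioi (0 : ℝ)))
      have hM0 : M ≠ 0 := by rintro rfl; norm_num at hM1
      simpa [hM0] using h0
    refine ge_of_tendsto ht ?_
    filter_upwards [Ioc_mem_nhdsGT (zero_lt_one' ℝ)] with t ht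
    exact (hanti ht (by simp) ht.2).trans (hlim t ht)
  have h3 : ‖φ 1‖ ^ 2 + ‖ψ 1‖ ^ 2 ≤ 0 := by simpa [hw] using hle
  have h4 : ‖φ 1‖ = 0 := by nlinarith [sq_nonneg ‖φ 1‖, sq_nonneg ‖ψ 1‖]
  simpa [hφ] using h4

/-! ### Entire power series and the confluent hypergeometric function -/

/-- Coefficients bounded by those of an exponential. -/
def EntireCoeff (c : ℕ → ℂ) : Prop :=
  ∃ K M : ℝ, 0 ≤ K ∧ 0 ≤ M ∧ ∀ j, ‖c j‖ ≤ K * (M ^ j / j.factorial)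

/-- The sum of a power series. -/
def psum (c : ℕ → ℂ) (z : ℂ) : ℂ := ∑' j, c j * z ^ j

/-- Coefficients of the derived power series. -/
def shift (c : ℕ → ℂ) : ℕ → ℂ := fun j => (j + 1) * c (j + 1)

theorem EntireCoeff.shift {c : ℕ → ℂ} (hc : EntireCoeff c) : EntireCoeff (shift c) := by
  obtain ⟨K, M, hK, hM, h⟩ := hc
  refine ⟨K * M, M, mul_nonneg hK hM, hM, fun j => ?_⟩
  have hj : ‖((j : ℂ) + 1)‖ = (j : ℝ) + 1 := by
    rw [← Nat.cast_add_one, Complex.norm_natCast]; push_cast; ring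
  rw [SingularSchrodinger.shift, norm_mul, hj]
  refine (mul_le_mul_of_nonneg_left (h (j + 1)) (by positivity)).trans (le_of_eq ?_)
  rw [Nat.factorial_succ]
  have : (j.factorial : ℝ) ≠ 0 := by positivity
  push_cast
  field_simp
  ring

theorem EntireCoeff.summable_norm {c : ℕ → ℂ} (hc : EntireCoeff c) (r : ℝ) (hr : 0 ≤ r) :
    Summable fun j => ‖c j‖ * r ^ j := by
  obtain ⟨K, M, hK, hM, h⟩ := hc
  refine Summable.of_nonneg_of_le (fun j => by positivity)
    (fun j => mul_le_mul_of_nonneg_right (h j) (pow_nonneg hr j)) ?_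
  have := (Real.summable_pow_div_factorial (M * r)).mul_left K
  refine this.congr fun j => ?_
  rw [mul_pow]; ring

theorem EntireCoeff.summable {c : ℕ → ℂ} (hc : EntireCoeff c) (z : ℂ) :
    Summable fun j => c j * z ^ j := by
  refine Summable.of_norm ((hc.summable_norm ‖z‖ (norm_nonneg z)).congr fun j => ?_)
  rw [norm_mul, norm_pow]

theorem EntireCoeff.hasDerivAt {c : ℕ → ℂ} (hc : EntireCoeff c) (z : ℂ) :
    HasDerivAt (psum c) (psum (SingularSchrodinger.shift c) z) z := by
  set R := ‖z‖ + 1 with hR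
  have hR0 : 0 ≤ R := by positivity
  have hu : Summable fun j : ℕ => ‖c j‖ * (j * R ^ (j - 1)) := by
    rw [← summable_nat_add_iff 1]
    refine (hc.shift.summable_norm R hR0).congr fun j => ?_
    have hj : ‖((j : ℂ) + 1)‖ = (j : ℝ) + 1 := by
      rw [← Nat.cast_add_one, Complex.norm_natCast]; push_cast; ring
    rw [SingularSchrodinger.shift, norm_mul, hj]
    push_cast
    ring
  have hz : z ∈ Metric.ball (0 : ℂ) R := by simp [hR]
  have h := hasDerivAt_tsum_of_isPreconnected (g := fun j (w : ℂ) => c j * w ^ j)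
    (g' := fun j w => c j * (j * w ^ (j - 1))) hu Metric.isOpen_ball
    (convex_ball (0 : ℂ) R).isPreconnected
    (fun j w _ => (hasDerivAt_pow j w).const_mul (c j))
    (fun j w hw => by
      rw [norm_mul, norm_mul, norm_pow, Complex.norm_natCast]
      have : ‖w‖ ≤ R := by simpa using (Metric.mem_ball.1 hw).le
      gcongr) hz (hc.summable z) hz
  have hs : Summable fun j : ℕ => c j * (j * z ^ (j - 1)) := by
    refine Summable.of_norm_bounded hu fun j => ?_
    rw [norm_mul, norm_mul, norm_pow, Complex.norm_natCast]
    have : ‖z‖ ≤ R := by simp [hR]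
    gcongr
  have he : ∑' j : ℕ, c j * (j * z ^ (j - 1)) = psum (SingularSchrodinger.shift c) z := by
    rw [hs.tsum_eq_zero_add, psum]
    simp only [Nat.cast_zero, zero_mul, mul_zero, zero_add, Nat.add_sub_cancel]
    refine tsum_congr fun j => ?_
    rw [SingularSchrodinger.shift]; push_cast; ring
  rw [← he]
  exact h

theorem EntireCoeff.contDiff {c : ℕ → ℂ} (hc : EntireCoeff c) : ContDiff ℂ ∞ (psum c) :=
  Differentiable.contDiff fun z => (hc.hasDerivAt z).differentiableAt

theorem EntireCoeff.mul_psum_shift {c : ℕ → ℂ} (hc : EntireCoeff c) (z : ℂ) :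
    HasSum (fun j : ℕ => j * c j * z ^ j) (z * psum (SingularSchrodinger.shift c) z) := by
  rw [← hasSum_nat_add_iff' 1]
  simp only [Finset.range_one, Finset.sum_singleton, Nat.cast_zero, zero_mul, sub_zero]
  refine HasSum.congr_fun ((hc.shift.summable z).hasSum.mul_left z) fun j => ?_
  rw [SingularSchrodinger.shift]; push_cast; ring

/-- The coefficients of `₁F₁`. -/
def kummerCoeff (a b : ℂ) (j : ℕ) : ℂ :=
  (ascPochhammer ℂ j).eval a / ((ascPochhammer ℂ j).eval b * (j.factorial : ℂ))

theorem oneFone_eq (a b : ℂ) : oneFone a b = psum (kummerCoeff a b) := rfl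

theorem add_natCast_ne_zero {b : ℝ} (hb : 0 < b) (j : ℕ) : (b : ℂ) + j ≠ 0 := by
  have : (b : ℂ) + j = ((b + j : ℝ) : ℂ) := by push_cast; ring
  rw [this, Complex.ofReal_ne_zero]
  positivity

theorem ascPochhammer_ne_zero {b : ℝ} (hb : 0 < b) (j : ℕ) : (ascPochhammer ℂ j).eval (b : ℂ) ≠ 0 := by
  induction j with
  | zero => simp
  | succ j ih =>
    rw [ascPochhammer_succ_eval]
    exact mul_ne_zero ih (add_natCast_ne_zero hb j)

/-- The two-term recurrence, with cleared denominators, yields both the growth bound on the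
coefficients and Kummer's equation. -/
theorem kummerCoeff_succ (a : ℂ) {b : ℝ} (hb : 0 < b) (j : ℕ) :
    (b + j) * ((j + 1) * kummerCoeff a b (j + 1)) = (a + j) * kummerCoeff a b j := by
  have h1 := ascPochhammer_ne_zero hb j
  have h2 := add_natCast_ne_zero hb j
  have h3 : (j.factorial : ℂ) ≠ 0 := Nat.cast_ne_zero.2 j.factorial_ne_zero
  have h4 : (j : ℂ) + 1 ≠ 0 := Nat.cast_add_one_ne_zero j
  rw [kummerCoeff, kummerCoeff, ascPochhammer_succ_eval, ascPochhammer_succ_eval, Nat.factorial_succ]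
  push_cast
  field_simp

theorem entireCoeff_kummer (a : ℂ) {b : ℝ} (hb : 0 < b) : EntireCoeff (kummerCoeff a b) := by
  -- This constant satisfies |a + j| ≤ (‖a‖/b + 1)(b + j) for all j, so each step of the recurrence
  -- costs at most the factor (‖a‖/b + 1)/(j + 1).
  refine ⟨1, ‖a‖ / b + 1, zero_le_one, by positivity, fun j => ?_⟩
  rw [one_mul]
  induction j with
  | zero => simp [kummerCoeff]
  | succ j ih =>
    have h := congrArg norm (kummerCoeff_succ a hb j)
    have hj : ‖((j : ℂ) + 1)‖ = (j : ℝ) + 1 := by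
      rw [← Nat.cast_add_one, Complex.norm_natCast]; push_cast; ring
    have hbj : ‖(b : ℂ) + j‖ = b + j := by
      have : (b : ℂ) + j = ((b + j : ℝ) : ℂ) := by push_cast; ring
      rw [this, Complex.norm_real, Real.norm_of_nonneg (by positivity)]
    have haj : ‖a + j‖ ≤ (‖a‖ / b + 1) * (b + j) := by
      refine (norm_add_le _ _).trans ?_
      rw [Complex.norm_natCast]
      have : (‖a‖ / b + 1) * (b + j) = ‖a‖ + j + (b + ‖a‖ / b * j) := by field_simp; ring
      rw [this]
      have : 0 ≤ ‖a‖ / b * j := by positivity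
      linarith
    rw [norm_mul, norm_mul, norm_mul, hj, hbj] at h
    have hp : 0 < (b + j) * ((j : ℝ) + 1) := by positivity
    rw [Nat.factorial_succ]
    refine le_of_mul_le_mul_left ?_ hp
    rw [mul_assoc, h]
    refine (mul_le_mul haj ih (norm_nonneg _) (by positivity)).trans (le_of_eq ?_)
    have : (j.factorial : ℝ) ≠ 0 := by positivity
    push_cast
    field_simp
    rw [pow_succ]
    field_simp

/-- Kummer's equation. -/
theorem kummer_ode (a : ℂ) {b : ℝ} (hb : 0 < b) (z : ℂ) :
    z * psum (shift (shift (kummerCoeff a b))) z + (b - z) * psum (shift (kummerCoeff a b)) z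
      - a * psum (kummerCoeff a b) z = 0 := by
  have hc := entireCoeff_kummer a hb
  have h1 := hc.shift.mul_psum_shift z
  have h2 := hc.mul_psum_shift z
  have h3 := (hc.shift.summable z).hasSum.mul_left (b : ℂ)
  have h4 := (hc.summable z).hasSum.mul_left a
  have h5 := ((h1.add h3).sub h2).sub h4
  have h6 : ∀ j : ℕ, (j * shift (kummerCoeff a b) j * z ^ j + b * (shift (kummerCoeff a b) j * z ^ j)
      - j * kummerCoeff a b j * z ^ j - a * (kummerCoeff a b j * z ^ j)) = 0 := by
    intro j
    have := kummerCoeff_succ a hb j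
    rw [shift]
    linear_combination z ^ j * this
  rw [funext h6] at h5
  have := h5.unique hasSum_zero
  simp only [psum] at this ⊢
  linear_combination this

theorem mul_ascPochhammer_add_one (a : ℂ) (j : ℕ) :
    a * (ascPochhammer ℂ j).eval (a + 1) = (ascPochhammer ℂ j).eval a * (a + j) := by
  rw [← ascPochhammer_succ_eval, ascPochhammer_succ_left]
  simp

/-- Coefficientwise this is (a + j)(a)_j = a (a+1)_j. It is the contiguous relation behind η⁺. -/
theorem kummer_raise (a : ℂ) {b : ℝ} (hb : 0 < b) (z : ℂ) :
    z * psum (shift (kummerCoeff a b)) z + a * psum (kummerCoeff a b) z =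
      a * psum (kummerCoeff (a + 1) b) z := by
  have hc := entireCoeff_kummer a hb
  have h2 := hc.mul_psum_shift z
  have h4 := (hc.summable z).hasSum.mul_left a
  have h5 := (((entireCoeff_kummer (a + 1) hb).summable z).hasSum.mul_left a)
  refine (h2.add h4).unique (HasSum.congr_fun h5 fun j => ?_)
  have h := mul_ascPochhammer_add_one a j
  rw [kummerCoeff, kummerCoeff]
  linear_combination -(z ^ j / ((ascPochhammer ℂ j).eval (b : ℂ) * (j.factorial : ℂ))) * h

/-- The contiguous relation behind η⁻. -/
theorem kummer_lower (a : ℂ) {b : ℝ} (hb : 0 < b) (z : ℂ) :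
    (b - a) * psum (kummerCoeff (a - 1) b) z =
      (b - a - z) * psum (kummerCoeff a b) z + z * psum (shift (kummerCoeff a b)) z := by
  have hc := entireCoeff_kummer a hb
  have h1 := hc.mul_psum_shift z
  have h2 := (hc.summable z).hasSum.mul_left ((b : ℂ) - a)
  have h3 := ((entireCoeff_kummer (a - 1) hb).summable z).hasSum.mul_left ((b : ℂ) - a)
  have h4 := (hc.summable z).hasSum.mul_left z
  have h5 := (h2.add h1).sub h3
  -- The constant terms cancel, so they are split off first; the coefficient of index j + 1 is then
  -- matched with that of index j in z ₁F₁.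
  rw [← hasSum_nat_add_iff' 1] at h5
  have h6 : (fun j : ℕ => (↑b - a) * (kummerCoeff a b (j + 1) * z ^ (j + 1)) +
      ((j + 1 : ℕ) : ℂ) * kummerCoeff a b (j + 1) * z ^ (j + 1) -
      (↑b - a) * (kummerCoeff (a - 1) b (j + 1) * z ^ (j + 1))) =
      fun j => z * (kummerCoeff a b j * z ^ j) := by
    funext j
    have e1 := ascPochhammer_ne_zero hb j
    have e2 := add_natCast_ne_zero hb j
    have e3 : (j.factorial : ℂ) ≠ 0 := Nat.cast_ne_zero.2 j.factorial_ne_zero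
    have e4 : (j : ℂ) + 1 ≠ 0 := Nat.cast_add_one_ne_zero j
    have e5 : (ascPochhammer ℂ (j + 1)).eval (a - 1) = (a - 1) * (ascPochhammer ℂ j).eval a := by
      simp [ascPochhammer_succ_left]
    rw [kummerCoeff, kummerCoeff, kummerCoeff, e5, ascPochhammer_succ_eval, ascPochhammer_succ_eval,
      Nat.factorial_succ]
    push_cast
    field_simp
    ring
  rw [h6] at h5
  have h7 := h5.unique h4
  simp only [Finset.range_one, Finset.sum_singleton, kummerCoeff, ascPochhammer_zero,
    Polynomial.eval_one, Nat.factorial_zero, Nat.cast_one, Nat.cast_zero, pow_zero] at h7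
  simp only [psum, kummerCoeff] at h7 ⊢
  linear_combination -h7

/-! ### Radial functions -/

/-- The smooth function `y ↦ f (‖y‖²)`. -/
def rad (n : ℕ) (f : ℝ → ℂ) (hf : ContDiff ℝ ∞ f) : Sm n :=
  ⟨fun y => f (‖y‖ ^ 2), show ContDiff ℝ ∞ _ from hf.comp (contDiff_norm_sq ℝ)⟩

theorem pd_rad {f f' : ℝ → ℂ} (hf : ContDiff ℝ ∞ f) (hf' : ContDiff ℝ ∞ f')
    (h : ∀ x, HasDerivAt f (f' x) x) (i : Fin n) :
    pd i (rad n f hf) = 2 * coord i * rad n f' hf' := by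
  ext y
  rw [pd_apply]
  have h1 : HasFDerivAt (fun y : Eucl n => ‖y‖ ^ 2) (2 • innerSL ℝ y) y :=
    (hasStrictFDerivAt_norm_sq y).hasFDerivAt
  have h2 := (h (‖y‖ ^ 2)).hasFDerivAt.comp y h1
  have h3 : HasFDerivAt (rad n f hf : Eucl n → ℂ) _ y := h2
  rw [h3.fderiv]
  have h4 : ((2 * coord i * rad n f' hf' : Sm n) : Eucl n → ℂ) y = 2 * (y i : ℂ) * f' (‖y‖ ^ 2) := rfl
  rw [h4]
  simp [EuclideanSpace.inner_single_right]
  ring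

/-- The gradient of a radial function is parallel to y. Hence the Casimir operator treats radial
factors as constants. -/
theorem rot_rad {f f' : ℝ → ℂ} (hf : ContDiff ℝ ∞ f) (hf' : ContDiff ℝ ∞ f')
    (h : ∀ x, HasDerivAt f (f' x) x) (i j : Fin n) : (smCoord n).rot i j (rad n f hf) = 0 := by
  rw [CoordSystem.rot_apply, show (smCoord n).d = pd from rfl, pd_rad hf hf' h, pd_rad hf hf' h,
    show (smCoord n).x = coord from rfl]
  ring

theorem E_rad {f f' : ℝ → ℂ} (hf : ContDiff ℝ ∞ f) (hf' : ContDiff ℝ ∞ f')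
    (h : ∀ x, HasDerivAt f (f' x) x) :
    (smCoord n).E (rad n f hf) = 2 * (smCoord n).r2 * rad n f' hf' := by
  simp only [CoordSystem.E_apply, CoordSystem.r2, show (smCoord n).d = pd from rfl, pd_rad hf hf' h,
    show (smCoord n).x = coord from rfl, Finset.mul_sum, Finset.sum_mul]
  exact Finset.sum_congr rfl fun i _ => by ring

/-- The Laplacian of a homogeneous function times a radial function. -/
theorem lap_mul_rad {f f' f'' : ℝ → ℂ} (hf : ContDiff ℝ ∞ f) (hf' : ContDiff ℝ ∞ f')
    (hf'' : ContDiff ℝ ∞ f'') (h : ∀ x, HasDerivAt f (f' x) x) (h' : ∀ x, HasDerivAt f' (f'' x) x)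
    (g : Sm n) :
    (smCoord n).lap (g * rad n f hf) = (smCoord n).lap g * rad n f hf +
      4 * (smCoord n).E g * rad n f' hf' +
      g * (4 * (smCoord n).r2 * rad n f'' hf'' + 2 * n * rad n f' hf') := by
  rw [CoordSystem.lap_mul]
  congr 1
  · congr 1
    simp only [CoordSystem.E_apply, show (smCoord n).d = pd from rfl, pd_rad hf hf' h,
      show (smCoord n).x = coord from rfl, Finset.mul_sum, Finset.sum_mul]
    exact Finset.sum_congr rfl fun i _ => by ring
  · congr 1
    have h2 : ∀ i, pd i (2 : Sm n) = 0 := fun i => by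
      simpa using (pd i).map_natCast 2
    have h1 : ∀ i, pd i (coord i : Sm n) = 1 := fun i => by
      have := (smCoord n).d_x i i
      rwa [if_pos rfl] at this
    have : ∀ i : Fin n, pd i (pd i (rad n f hf)) =
        4 * coord i ^ 2 * rad n f'' hf'' + 2 * rad n f' hf' := by
      intro i
      rw [pd_rad hf hf' h, mul_assoc, Derivation.leibniz, Derivation.leibniz, h1, h2,
        pd_rad hf' hf'' h']
      simp only [smul_eq_mul]
      ring
    simp only [CoordSystem.lap_apply, CoordSystem.r2, show (smCoord n).d = pd from rfl, this,
      show (smCoord n).x = coord from rfl, Finset.mul_sum, Finset.sum_mul, Finset.sum_add_distrib]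
    congr 1
    simp
    ring

/-! ### The radial profiles -/

/-- `e^{-isx} g(2isx)` for the entire function `g` with coefficients `c`. -/
def prof (s : ℂ) (c : ℕ → ℂ) (x : ℝ) : ℂ :=
  Complex.exp (-Complex.I * s * x) * psum c (2 * Complex.I * s * x)

theorem contDiff_prof (s : ℂ) {c : ℕ → ℂ} (hc : EntireCoeff c) : ContDiff ℝ ∞ (prof s c) := by
  have h1 : ContDiff ℝ ∞ fun x : ℝ => Complex.exp (-Complex.I * s * x) :=
    (contDiff_const.mul Complex.ofRealCLM.contDiff).cexp
  have h2 : ContDiff ℝ ∞ fun x : ℝ => psum c (2 * Complex.I * s * x) :=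
    (hc.contDiff.restrict_scalars ℝ).comp (contDiff_const.mul Complex.ofRealCLM.contDiff)
  exact h1.mul h2

theorem hasDerivAt_prof (s : ℂ) {c : ℕ → ℂ} (hc : EntireCoeff c) (x : ℝ) :
    HasDerivAt (prof s c)
      (-Complex.I * s * prof s c x + 2 * Complex.I * s * prof s (shift c) x) x := by
  have h0 : ∀ a : ℂ, HasDerivAt (fun x : ℝ => a * (x : ℂ)) a x := fun a => by
    simpa using (Complex.ofRealCLM.hasDerivAt (x := x)).const_mul a
  have h1 := (h0 (-Complex.I * s)).cexp
  have h2 := (hc.hasDerivAt (2 * Complex.I * s * x)).comp x (h0 (2 * Complex.I * s))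
  have h3 := h1.mul h2
  refine h3.congr_deriv ?_
  simp only [prof, Function.comp]
  ring

/-- The parameter `2l + k + n/2`. -/
def bpar (n l k : ℕ) : ℝ := 2 * l + k + n / 2

theorem bpar_pos (hn : 1 ≤ n) (l k : ℕ) : 0 < bpar n l k := by
  have : (1 : ℝ) ≤ n := by exact_mod_cast hn
  unfold bpar; positivity

/-- The parameter `(m + 4l + 2k + n) / 4`. -/
def apar (n : ℕ) (m : ℤ) (l k : ℕ) : ℂ := ((m : ℂ) + 4 * l + 2 * k + n) / 4

/-- The factor of `F_{m,l,k}` depending on `y`. -/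
def radVec (n : ℕ) (hn : 1 ≤ n) (s : ℂ) (m : ℤ) (l k : ℕ) : MvPolynomial (Fin n) ℂ →ₗ[ℂ] Sm n :=
  (LinearMap.mulRight ℂ (rad n (prof s (kummerCoeff (apar n m l k) (bpar n l k)))
    (contDiff_prof s (entireCoeff_kummer _ (bpar_pos hn l k))))) ∘ₗ ev.toLinearMap ∘ₗ
      LinearMap.mulLeft ℂ ((polyCoord n).r2 ^ l)

theorem radVec_apply (hn : 1 ≤ n) (s : ℂ) (m : ℤ) (l k : ℕ) (h : MvPolynomial (Fin n) ℂ) :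
    radVec n hn s m l k h = ev ((polyCoord n).r2 ^ l * h) *
      rad n (prof s (kummerCoeff (apar n m l k) (bpar n l k)))
        (contDiff_prof s (entireCoeff_kummer _ (bpar_pos hn l k))) := rfl

/-! ### Functions of weight `m` -/

/-- `e^{-imθ/2} g(y)`. -/
def sep (n : ℕ) (m : ℤ) : Sm n →ₗ[ℂ] Fn n where
  toFun g := fun p => Complex.exp (-Complex.I * m * p.1 / 2) * (g : Eucl n → ℂ) p.2
  map_add' f g := by
    funext p
    simp [mul_add]
  map_smul' c f := by
    funext p
    simp; ring

theorem sep_apply (m : ℤ) (g : Sm n) (p : ℝ × Eucl n) :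
    sep n m g p = Complex.exp (-Complex.I * m * p.1 / 2) * (g : Eucl n → ℂ) p.2 := rfl

theorem sep_injective (m : ℤ) : Function.Injective (sep n m) := by
  intro f g h
  ext y
  have := congrFun h (0, y)
  simpa [sep_apply] using this

/-- Transfers F_{m,l,k} to the algebra of smooth functions of y, where all the operators become
algebraic expressions in r², E and Δ. -/
theorem vec_eq_sep (hn : 1 ≤ n) (s : ℂ) (m : ℤ) (l k : ℕ) (h : MvPolynomial (Fin n) ℂ) :
    vec n s m l k h = sep n m (radVec n hn s m l k h) := by
  funext p
  rw [sep_apply, radVec_apply]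
  have h1 : ((ev ((polyCoord n).r2 ^ l * h) *
      rad n (prof s (kummerCoeff (apar n m l k) (bpar n l k)))
        (contDiff_prof s (entireCoeff_kummer _ (bpar_pos hn l k))) : Sm n) : Eucl n → ℂ) p.2 =
      ((ev ((polyCoord n).r2 ^ l * h) : Sm n) : Eucl n → ℂ) p.2 *
        prof s (kummerCoeff (apar n m l k) (bpar n l k)) (‖p.2‖ ^ 2) := rfl
  have h2 : ((ev ((polyCoord n).r2 ^ l * h) : Sm n) : Eucl n → ℂ) p.2 =
      (‖p.2‖ : ℂ) ^ (2 * l) * MvPolynomial.eval (fun j => ((p.2 j : ℝ) : ℂ)) h := by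
    rw [map_mul, map_pow, ev_r2, pow_mul, ← smCoord_r2_apply, ← ev_apply]
    rfl
  rw [h1, h2, vec, oneFone_eq, prof, apar, bpar]
  push_cast
  ring

theorem contDiff_sep (m : ℤ) (g : Sm n) : ContDiff ℝ ∞ (sep n m g) := by
  have h1 : ContDiff ℝ ∞ fun p : ℝ × Eucl n => Complex.exp (-Complex.I * m * p.1 / 2) :=
    ((contDiff_const.mul (Complex.ofRealCLM.contDiff.comp contDiff_fst)).div_const _).cexp
  exact h1.mul ((contDiff_coe g).comp contDiff_snd)

theorem fderiv_sep (m : ℤ) (g : Sm n) (p v : ℝ × Eucl n) :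
    fderiv ℝ (sep n m g) p v = Complex.exp (-Complex.I * m * p.1 / 2) *
      (-Complex.I * m / 2 * v.1 * (g : Eucl n → ℂ) p.2 + fderiv ℝ (g : Eucl n → ℂ) p.2 v.2) := by
  have h0 : HasFDerivAt (fun p : ℝ × Eucl n => -Complex.I * m * (p.1 : ℂ) / 2)
      ((-Complex.I * m / 2) • (Complex.ofRealCLM.comp (ContinuousLinearMap.fst ℝ ℝ (Eucl n)))) p := by
    have := ((Complex.ofRealCLM.comp (ContinuousLinearMap.fst ℝ ℝ (Eucl n))).hasFDerivAt (x := p)).const_mul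
      (-Complex.I * m / 2)
    refine this.congr_of_eventuallyEq (Filter.Eventually.of_forall fun q => ?_)
    simp; ring
  have h2 : HasFDerivAt (fun p : ℝ × Eucl n => (g : Eucl n → ℂ) p.2) _ p :=
    (differentiable_coe g p.2).hasFDerivAt.comp p hasFDerivAt_snd
  have h3 : HasFDerivAt (sep n m g) _ p := h0.cexp.mul h2
  rw [h3.fderiv]
  simp
  ring

theorem dTheta_sep (m : ℤ) (g : Sm n) : dTheta (sep n m g) = sep n m ((-Complex.I * m / 2) • g) := by
  funext p
  rw [dTheta, fderiv_sep, sep_apply]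
  simp

theorem euler_sep (m : ℤ) (g : Sm n) : euler (sep n m g) = sep n m ((smCoord n).E g) := by
  funext p
  rw [euler, fderiv_sep, sep_apply, smCoord_E_apply]
  simp

theorem lap_sep (m : ℤ) (g : Sm n) : lap (sep n m g) = sep n m ((smCoord n).lap g) := by
  funext p
  rw [lap, sep_apply, smCoord_lap_apply]
  have h : ContDiffAt ℝ 2 (g : Eucl n → ℂ) p.2 :=
    ((contDiff_coe g).of_le (by simpa using (WithTop.coe_le_coe.2 (le_top : (2 : ℕ∞) ≤ ⊤)))).contDiffAt
  exact InnerProductSpace.laplacian_smul (Complex.exp (-Complex.I * m * p.1 / 2)) h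

theorem kappa_sep (m : ℤ) (g : Sm n) : kappa (sep n m g) = ((m : ℂ) / 2) • sep n m g := by
  funext p
  rw [kappa, dTheta_sep, map_smul]
  simp only [Pi.smul_apply, smul_eq_mul]
  linear_combination (-(m : ℂ) / 2 * sep n m g p) * Complex.I_mul_I

theorem omega_sep (s : ℂ) (m : ℤ) (g : Sm n) :
    omega s (sep n m g) = sep n m ((smCoord n).r2 * ((-2 * Complex.I * m * s) • g +
      (4 * s ^ 2) • ((smCoord n).r2 * g) + (smCoord n).lap g)) := by
  funext p
  rw [omega, dTheta_sep, lap_sep, ← smCoord_r2_apply]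
  simp [sep_apply]
  ring

/-- The factor e^{-2iθ} accounts for the shift of the weight by 4, since weight m is e^{-imθ/2}. -/
theorem etaPlus_sep (s : ℂ) (m : ℤ) (g : Sm n) :
    etaPlus s (sep n m g) = sep n (m + 4) ((-1 / 2 : ℂ) • ((smCoord n).E g +
      ((m : ℂ) / 2 + n / 2) • g + (2 * Complex.I * s) • ((smCoord n).r2 * g))) := by
  funext p
  rw [etaPlus, dTheta_sep, euler_sep, ← smCoord_r2_apply]
  have he : Complex.exp (-Complex.I * ((m + 4 : ℤ) : ℂ) * p.1 / 2) =
      Complex.exp (-2 * Complex.I * p.1) * Complex.exp (-Complex.I * m * p.1 / 2) := by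
    rw [← Complex.exp_add]; congr 1; push_cast; ring
  simp only [sep_apply, he]
  simp
  linear_combination (Complex.exp (-(2 * Complex.I * p.1)) * Complex.exp (-(Complex.I * m * p.1) / 2) *
    (m : ℂ) / 4 * (g : Eucl n → ℂ) p.2) * Complex.I_mul_I

theorem etaMinus_sep (s : ℂ) (m : ℤ) (g : Sm n) :
    etaMinus s (sep n m g) = sep n (m - 4) ((-1 / 2 : ℂ) • ((smCoord n).E g +
      (n / 2 - (m : ℂ) / 2) • g - (2 * Complex.I * s) • ((smCoord n).r2 * g))) := by
  funext p
  rw [etaMinus, dTheta_sep, euler_sep, ← smCoord_r2_apply]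
  have he : Complex.exp (-Complex.I * ((m - 4 : ℤ) : ℂ) * p.1 / 2) =
      Complex.exp (2 * Complex.I * p.1) * Complex.exp (-Complex.I * m * p.1 / 2) := by
    rw [← Complex.exp_add]; congr 1; push_cast; ring
  simp only [sep_apply, he]
  simp
  linear_combination (-Complex.exp (2 * Complex.I * p.1) * Complex.exp (-(Complex.I * m * p.1) / 2) *
    (m : ℂ) / 4 * (g : Eucl n → ℂ) p.2) * Complex.I_mul_I

/-! ### The operators on the vectors `F_{m,l,k}` -/

theorem isHomogeneous_r2_pow_mul {k : ℕ} (l : ℕ) {h : MvPolynomial (Fin n) ℂ} (hh : h.IsHomogeneous k) :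
    ((polyCoord n).r2 ^ l * h).IsHomogeneous (2 * l + k) :=
  (isHomogeneous_r2.pow l).mul hh

theorem r2lap_r2_pow_mul {k : ℕ} (l : ℕ) {h : MvPolynomial (Fin n) ℂ} (hh : h ∈ harmonicPoly n k) :
    (polyCoord n).r2lap ((polyCoord n).r2 ^ l * h) =
      (2 * l * (2 * l + 2 * k + n - 2) : ℂ) • ((polyCoord n).r2 ^ l * h) := by
  rw [mem_harmonicPoly] at hh
  induction l with
  | zero => simp [CoordSystem.r2lap_apply, hh.2]
  | succ l ih =>
    rw [CoordSystem.r2lap_apply, pow_succ', mul_assoc,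
      lap_r2_mul_poly (isHomogeneous_r2_pow_mul l hh.1), ih, ← add_smul, mul_smul_comm]
    congr 1
    push_cast
    ring

/-- The derivative of a profile. -/
def prof' (s : ℂ) (c : ℕ → ℂ) (x : ℝ) : ℂ :=
  -Complex.I * s * prof s c x + 2 * Complex.I * s * prof s (shift c) x

theorem contDiff_prof' (s : ℂ) {c : ℕ → ℂ} (hc : EntireCoeff c) : ContDiff ℝ ∞ (prof' s c) :=
  (contDiff_const.mul (contDiff_prof s hc)).add (contDiff_const.mul (contDiff_prof s hc.shift))

/-- The second derivative of a profile. -/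
def prof'' (s : ℂ) (c : ℕ → ℂ) (x : ℝ) : ℂ :=
  -Complex.I * s * prof' s c x + 2 * Complex.I * s * prof' s (shift c) x

theorem contDiff_prof'' (s : ℂ) {c : ℕ → ℂ} (hc : EntireCoeff c) : ContDiff ℝ ∞ (prof'' s c) :=
  (contDiff_const.mul (contDiff_prof' s hc)).add (contDiff_const.mul (contDiff_prof' s hc.shift))

theorem hasDerivAt_prof' (s : ℂ) {c : ℕ → ℂ} (hc : EntireCoeff c) (x : ℝ) :
    HasDerivAt (prof' s c) (prof'' s c x) x :=
  ((hasDerivAt_prof s hc x).const_mul _).add ((hasDerivAt_prof s hc.shift x).const_mul _)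

theorem rad_apply {f : ℝ → ℂ} (hf : ContDiff ℝ ∞ f) (y : Eucl n) :
    (rad n f hf : Eucl n → ℂ) y = f (‖y‖ ^ 2) := rfl

theorem apar_add_four (m : ℤ) (l k : ℕ) : apar n (m + 4) l k = apar n m l k + 1 := by
  simp only [apar]; push_cast; ring

theorem apar_sub_four (m : ℤ) (l k : ℕ) : apar n (m - 4) l k = apar n m l k - 1 := by
  simp only [apar]; push_cast; ring

theorem E_ev {N : ℕ} {P : MvPolynomial (Fin n) ℂ} (hP : P.IsHomogeneous N) :
    (smCoord n).E (ev P) = (N : ℂ) • ev P := by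
  rw [ev_E, polyCoord_E hP, map_smul]

theorem E_radVec (hn : 1 ≤ n) (s : ℂ) (m : ℤ) (l : ℕ) {k : ℕ} {h : MvPolynomial (Fin n) ℂ}
    (hh : h.IsHomogeneous k) :
    (smCoord n).E (radVec n hn s m l k h) = (2 * l + k : ℂ) • radVec n hn s m l k h +
      2 * (smCoord n).r2 * (ev ((polyCoord n).r2 ^ l * h) *
        rad n (prof' s (kummerCoeff (apar n m l k) (bpar n l k)))
          (contDiff_prof' s (entireCoeff_kummer _ (bpar_pos hn l k)))) := by
  rw [radVec_apply, CoordSystem.E_mul, E_ev (isHomogeneous_r2_pow_mul l hh),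
    E_rad _ (contDiff_prof' s (entireCoeff_kummer _ (bpar_pos hn l k)))
      (hasDerivAt_prof s (entireCoeff_kummer _ (bpar_pos hn l k))), smul_mul_assoc]
  push_cast
  ring

/-- The derivative of e^{-isρ²} cancels the term 2isρ², and what remains is `kummer_raise` at z =
2isρ². The coefficient is minus the parameter a of ₁F₁, so it vanishes only at m = -(4l + 2k + n).
-/
theorem etaPlus_vec (hn : 1 ≤ n) (s : ℂ) (m : ℤ) (l k : ℕ) {h : MvPolynomial (Fin n) ℂ}
    (hh : h.IsHomogeneous k) :
    etaPlus s (vec n s m l k h) = (-(m + (4 * l + 2 * k + n)) / 4 : ℂ) • vec n s (m + 4) l k h := by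
  rw [vec_eq_sep hn, vec_eq_sep hn, etaPlus_sep, E_radVec hn s m l hh,
    ← (sep n (m + 4)).map_smul]
  congr 1
  have hb := bpar_pos hn l k
  ext y
  have key := kummer_raise (apar n m l k) hb (2 * Complex.I * s * ((‖y‖ ^ 2 : ℝ) : ℂ))
  have ha : (m : ℂ) = 4 * apar n m l k - (4 * l + 2 * k + n) := by rw [apar]; ring
  simp only [radVec_apply, apar_add_four, Subalgebra.coe_smul, Subalgebra.coe_add, Subalgebra.coe_mul,
    Pi.smul_apply, Pi.add_apply, Pi.mul_apply, rad_apply, smCoord_r2_apply, smul_eq_mul, prof', prof]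
  -- Once the values of ₁F₁ are opaque, the claim is a multiple of the contiguous relation.
  generalize psum (shift (kummerCoeff (apar n m l k) (bpar n l k))) (2 * Complex.I * s * ((‖y‖ ^ 2 : ℝ) : ℂ)) = Φ1 at *
  generalize psum (kummerCoeff (apar n m l k) (bpar n l k)) (2 * Complex.I * s * ((‖y‖ ^ 2 : ℝ) : ℂ)) = Φ at *
  generalize psum (kummerCoeff (apar n m l k + 1) (bpar n l k)) (2 * Complex.I * s * ((‖y‖ ^ 2 : ℝ) : ℂ)) = Φp at *
  generalize apar n m l k = a at *
  rw [ha]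
  push_cast at key ⊢
  simp
  rw [show (((2 : Sm n) : Eucl n → ℂ)) y = 2 from rfl]
  linear_combination (-(ev h : Eucl n → ℂ) y * (ev (polyCoord n).r2 : Eucl n → ℂ) y ^ l *
    Complex.exp (-(Complex.I * s * (‖y‖ : ℂ) ^ 2))) * key

/-- Here the exponential and the term -2isρ² add up, which produces the z in `kummer_lower`. The
coefficient is a - b for the parameters a, b of ₁F₁, so it vanishes only at m = 4l + 2k + n. -/
theorem etaMinus_vec (hn : 1 ≤ n) (s : ℂ) (m : ℤ) (l k : ℕ) {h : MvPolynomial (Fin n) ℂ}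
    (hh : h.IsHomogeneous k) :
    etaMinus s (vec n s m l k h) = (-((4 * l + 2 * k + n) - m) / 4 : ℂ) • vec n s (m - 4) l k h := by
  rw [vec_eq_sep hn, vec_eq_sep hn, etaMinus_sep, E_radVec hn s m l hh,
    ← (sep n (m - 4)).map_smul]
  congr 1
  have hb := bpar_pos hn l k
  ext y
  have key := kummer_lower (apar n m l k) hb (2 * Complex.I * s * ((‖y‖ ^ 2 : ℝ) : ℂ))
  have ha : (m : ℂ) = 4 * apar n m l k - (4 * l + 2 * k + n) := by rw [apar]; ring
  simp only [radVec_apply, apar_sub_four, Subalgebra.coe_smul, Subalgebra.coe_add, Subalgebra.coe_mul,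
    Subalgebra.coe_sub, Pi.sub_apply,
    Pi.smul_apply, Pi.add_apply, Pi.mul_apply, rad_apply, smCoord_r2_apply, smul_eq_mul, prof', prof]
  generalize psum (shift (kummerCoeff (apar n m l k) (bpar n l k))) (2 * Complex.I * s * ((‖y‖ ^ 2 : ℝ) : ℂ)) = Φ1 at *
  generalize psum (kummerCoeff (apar n m l k) (bpar n l k)) (2 * Complex.I * s * ((‖y‖ ^ 2 : ℝ) : ℂ)) = Φ at *
  generalize psum (kummerCoeff (apar n m l k - 1) (bpar n l k)) (2 * Complex.I * s * ((‖y‖ ^ 2 : ℝ) : ℂ)) = Φp at *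
  generalize apar n m l k = a at *
  rw [ha]
  rw [bpar] at key
  push_cast at key ⊢
  simp
  rw [show (((2 : Sm n) : Eucl n → ℂ)) y = 2 from rfl]
  linear_combination ((ev h : Eucl n → ℂ) y * (ev (polyCoord n).r2 : Eucl n → ℂ) y ^ l *
    Complex.exp (-(Complex.I * s * (‖y‖ : ℂ) ^ 2))) * key

/-- The equation `Ω'' F = 2λ F` for the factor depending on `y`. -/
theorem radial_eq_radVec (hn : 1 ≤ n) (s : ℂ) (m : ℤ) (l k : ℕ) {h : MvPolynomial (Fin n) ℂ}
    (hh : h ∈ harmonicPoly n k) :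
    (smCoord n).r2 * ((-2 * Complex.I * m * s) • radVec n hn s m l k h +
      (4 * s ^ 2) • ((smCoord n).r2 * radVec n hn s m l k h) +
        (smCoord n).lap (radVec n hn s m l k h)) =
      (2 * l * (2 * l + 2 * k + n - 2) : ℂ) • radVec n hn s m l k h := by
  have hb := bpar_pos hn l k
  have hc := entireCoeff_kummer (apar n m l k) hb
  have hT : (smCoord n).r2 * (smCoord n).lap (ev ((polyCoord n).r2 ^ l * h)) =
      (2 * l * (2 * l + 2 * k + n - 2) : ℂ) • ev ((polyCoord n).r2 ^ l * h) := by
    rw [ev_lap, ← ev_r2, ← map_mul, ← CoordSystem.r2lap_apply, r2lap_r2_pow_mul l hh, map_smul]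
  rw [radVec_apply, lap_mul_rad _ (contDiff_prof' s hc) (contDiff_prof'' s hc)
      (hasDerivAt_prof s hc) (hasDerivAt_prof' s hc),
    E_ev (isHomogeneous_r2_pow_mul l (mem_harmonicPoly.1 hh).1)]
  ext y
  have hTy := congrFun (congrArg Subtype.val hT) y
  have key := kummer_ode (apar n m l k) hb (2 * Complex.I * s * ((‖y‖ ^ 2 : ℝ) : ℂ))
  have ha : (m : ℂ) = 4 * apar n m l k - (4 * l + 2 * k + n) := by rw [apar]; ring
  simp only [Subalgebra.coe_smul, Subalgebra.coe_add, Subalgebra.coe_mul,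
    Pi.smul_apply, Pi.add_apply, Pi.mul_apply, rad_apply, smCoord_r2_apply, smul_eq_mul, prof'', prof', prof] at hTy ⊢
  generalize psum (shift (shift (kummerCoeff (apar n m l k) (bpar n l k)))) (2 * Complex.I * s * ((‖y‖ ^ 2 : ℝ) : ℂ)) = Φ2 at *
  generalize psum (shift (kummerCoeff (apar n m l k) (bpar n l k))) (2 * Complex.I * s * ((‖y‖ ^ 2 : ℝ) : ℂ)) = Φ1 at *
  generalize psum (kummerCoeff (apar n m l k) (bpar n l k)) (2 * Complex.I * s * ((‖y‖ ^ 2 : ℝ) : ℂ)) = Φ at *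
  generalize apar n m l k = a at *
  rw [ha]
  rw [bpar] at key
  generalize Complex.exp (-Complex.I * s * ((‖y‖ ^ 2 : ℝ) : ℂ)) = e at *
  generalize ((smCoord n).lap (ev ((polyCoord n).r2 ^ l * h)) : Eucl n → ℂ) y = LP at *
  generalize (ev ((polyCoord n).r2 ^ l * h) : Eucl n → ℂ) y = P at *
  have h4 : (((4 : Sm n) : Eucl n → ℂ)) y = 4 := rfl
  have h2 : (((2 : Sm n) : Eucl n → ℂ)) y = 2 := rfl
  have hnn : (((n : Sm n) : Eucl n → ℂ)) y = n := rfl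
  rw [h4, h2, hnn]
  push_cast at key ⊢
  have hI := Complex.I_mul_I
  -- The polynomial factor contributes the eigenvalue of r²Δ through `hTy`. The terms that
  -- differentiate the profile are Kummer's equation at z = 2isρ², up to i² = -1.
  linear_combination (e * Φ) * hTy + (8 * Complex.I * s * (‖y‖ : ℂ) ^ 2 * P * e) * key +
    (‖y‖ : ℂ) ^ 4 * P * e * s ^ 2 * (4 * Φ) * hI

/-- The rotations see only the polynomial r^{2l} h of degree N = 2l + k, and there 2l(2l+2k+n-2) -
N² - (n-2)N = -k(k+n-2). -/
theorem casimir_radVec (hn : 1 ≤ n) (s : ℂ) (m : ℤ) (l k : ℕ) {h : MvPolynomial (Fin n) ℂ}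
    (hh : h ∈ harmonicPoly n k) :
    (smCoord n).casimir (radVec n hn s m l k h) =
      (-2 * k * (k + n - 2) : ℂ) • radVec n hn s m l k h := by
  have hb := bpar_pos hn l k
  have hc := entireCoeff_kummer (apar n m l k) hb
  have hhom := isHomogeneous_r2_pow_mul l (mem_harmonicPoly.1 hh).1
  have h1 : ∀ g : Sm n, (smCoord n).casimir (g * rad n _ (contDiff_prof s hc)) =
      (smCoord n).casimir g * rad n _ (contDiff_prof s hc) := by
    intro g
    simp only [CoordSystem.casimir_apply, CoordSystem.rot_mul,
      rot_rad _ (contDiff_prof' s hc) (hasDerivAt_prof s hc), mul_zero, add_zero, Finset.sum_mul]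
  rw [radVec_apply, h1, CoordSystem.casimir_eq, E_ev hhom, map_smul, E_ev hhom,
    CoordSystem.r2lap_apply, ev_lap, ← ev_r2, ← map_mul, ← CoordSystem.r2lap_apply,
    r2lap_r2_pow_mul l hh, map_smul]
  rw [← smul_mul_assoc]
  congr 1
  have h2 : (2 : Sm n) = algebraMap ℂ (Sm n) 2 := rfl
  have hn' : ((n : Sm n) - 2) = algebraMap ℂ (Sm n) (n - 2) := by
    rw [h2, map_sub, map_natCast]
  rw [hn', h2, ← Algebra.smul_def, ← Algebra.smul_def]
  simp only [smul_smul, ← sub_smul]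
  congr 1
  push_cast
  ring

/-- The profile e^{-isx} ₁F₁(2isx) equals 1 at the origin. The lowest Taylor component thus recovers
h, and it is the source of all uniqueness and independence statements. -/
theorem taylorPart_radVec (hn : 1 ≤ n) (s : ℂ) (m : ℤ) (l k : ℕ) {h : MvPolynomial (Fin n) ℂ}
    (hh : h.IsHomogeneous k) :
    taylorPart (2 * l + k) (radVec n hn s m l k h) = (polyCoord n).r2 ^ l * h ∧
      ∀ d < 2 * l + k, taylorPart d (radVec n hn s m l k h) = 0 := by
  rw [radVec_apply]
  have := taylorPart_ev_mul (isHomogeneous_r2_pow_mul l hh)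
    (rad n (prof s (kummerCoeff (apar n m l k) (bpar n l k)))
        (contDiff_prof s (entireCoeff_kummer _ (bpar_pos hn l k))))
  refine ⟨?_, this.2⟩
  have h0 := this.1 0
  rw [add_zero] at h0
  rw [h0, taylorPart_zero, rad_apply, prof, psum, tsum_eq_single 0 (by simp +contextual)]
  simp [kummerCoeff]

theorem radVec_injective (hn : 1 ≤ n) (s : ℂ) (m : ℤ) (l k : ℕ) {h : MvPolynomial (Fin n) ℂ}
    (hh : h.IsHomogeneous k) (h0 : radVec n hn s m l k h = 0) : h = 0 := by
  have := (taylorPart_radVec hn s m l k hh).1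
  rw [h0, map_zero] at this
  exact (mul_eq_zero.1 this.symm).resolve_left (pow_ne_zero l (r2_ne_zero hn))

/-! ### The orthogonal group -/

/-- A complex polynomial vanishing at all real points is zero, because ℝ is infinite. -/
theorem ev_injective : Function.Injective (ev : MvPolynomial (Fin n) ℂ →ₐ[ℂ] Sm n) := by
  intro P Q h
  refine MvPolynomial.funext_set (fun _ => Set.range ((↑) : ℝ → ℂ))
    (fun _ => Set.infinite_range_of_injective Complex.ofReal_injective) fun x hx => ?_
  choose y hy using fun i => hx i (Set.mem_univ i)
  have := congrFun (congrArg Subtype.val h) (WithLp.toLp 2 y)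
  rw [ev_apply, ev_apply] at this
  simpa [hy] using this

theorem ev_smul_apply {N : ℕ} {P : MvPolynomial (Fin n) ℂ} (hP : P.IsHomogeneous N) (t : ℝ)
    (y : Eucl n) : (ev P : Eucl n → ℂ) (t • y) = (t : ℂ) ^ N * (ev P : Eucl n → ℂ) y := by
  induction N generalizing P with
  | zero =>
    have h2 := hP.totalDegree_le
    rw [Nat.le_zero, MvPolynomial.totalDegree_eq_zero_iff_eq_C] at h2
    rw [h2, ev_apply, ev_apply]
    simp
  | succ N ih =>
    have h : ((N : ℂ) + 1) • ev P = ∑ i, coord i * ev (MvPolynomial.pderiv i P) := by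
      have := E_ev hP
      rw [CoordSystem.E_apply] at this
      push_cast at this
      rw [← this]
      exact Finset.sum_congr rfl fun i _ => by rw [← pd_ev]; rfl
    have hz : ∀ z : Eucl n, ((N : ℂ) + 1) * (ev P : Eucl n → ℂ) z =
        ∑ i, (z i : ℂ) * (ev (MvPolynomial.pderiv i P) : Eucl n → ℂ) z := fun z => by
      have := congrFun (congrArg Subtype.val h) z
      simpa [coord_apply] using this
    have hne : (N : ℂ) + 1 ≠ 0 := Nat.cast_add_one_ne_zero N
    refine mul_left_cancel₀ hne ?_
    rw [hz, mul_left_comm, hz, Finset.mul_sum]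
    refine Finset.sum_congr rfl fun i _ => ?_
    rw [ih hP.pderiv]
    simp
    ring

/-- Composition of a smooth function with an orthogonal transformation. -/
def smComp (u : OrthGroup n) : Sm n →ₐ[ℂ] Sm n where
  toFun g := ⟨fun y => (g : Eucl n → ℂ) (u y), show ContDiff ℝ ∞ _ from (contDiff_coe g).comp u.contDiff⟩
  map_one' := rfl
  map_mul' _ _ := rfl
  map_zero' := rfl
  map_add' _ _ := rfl
  commutes' _ := rfl

theorem smComp_apply (u : OrthGroup n) (g : Sm n) (y : Eucl n) :
    (smComp u g : Eucl n → ℂ) y = (g : Eucl n → ℂ) (u y) := rfl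

/-- The Laplacian is the trace of the second derivative in any orthonormal basis: a basis on one
side is matched with its image under u on the other. -/
theorem laplacian_comp_orth (u : OrthGroup n) {g : Eucl n → ℂ} (hg : ContDiff ℝ ∞ g) (y : Eucl n) :
    Laplacian.laplacian (fun y => g (u y)) y = Laplacian.laplacian g (u y) := by
  have b := EuclideanSpace.basisFun (Fin n) ℝ
  rw [InnerProductSpace.laplacian_eq_iteratedFDeriv_orthonormalBasis _ b,
    InnerProductSpace.laplacian_eq_iteratedFDeriv_orthonormalBasis _ (b.map u)]
  beta_reduce
  refine Finset.sum_congr rfl fun i _ => ?_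
  have h2 : ((2 : ℕ) : WithTop ℕ∞) ≤ ∞ := by
    simpa using WithTop.coe_le_coe.2 (le_top : (2 : ℕ∞) ≤ ⊤)
  have := (u : Eucl n →L[ℝ] Eucl n).iteratedFDeriv_comp_right hg y (i := 2) h2
  have h3 : (g ∘ (u : Eucl n →L[ℝ] Eucl n)) = fun y => g (u y) := rfl
  rw [h3] at this
  rw [this]
  simp only [ContinuousMultilinearMap.compContinuousLinearMap_apply]
  congr 1
  funext j
  fin_cases j <;> rfl

theorem lap_smComp (u : OrthGroup n) (g : Sm n) :
    (smCoord n).lap (smComp u g) = smComp u ((smCoord n).lap g) := by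
  ext y
  rw [smComp_apply, smCoord_lap_apply, smCoord_lap_apply]
  exact laplacian_comp_orth u (contDiff_coe g) y

/-- The substitution `h ↦ h ∘ u` on polynomials. -/
def polyComp (u : OrthGroup n) : MvPolynomial (Fin n) ℂ →ₐ[ℂ] MvPolynomial (Fin n) ℂ :=
  MvPolynomial.aeval fun i =>
    ∑ j, MvPolynomial.C ((u (EuclideanSpace.single j 1) i : ℝ) : ℂ) * MvPolynomial.X j

theorem ev_polyComp (u : OrthGroup n) (P : MvPolynomial (Fin n) ℂ) :
    ev (polyComp u P) = smComp u (ev P) := by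
  have hX : ∀ i, ev (MvPolynomial.X i) = (coord i : Sm n) := fun i => by simp [ev]
  have hC : ∀ c : ℂ, ev (MvPolynomial.C c) = algebraMap ℂ (Sm n) c := fun c => by simp [ev]
  suffices h : (ev.comp (polyComp u)) = (smComp u).comp ev from
    congrArg (fun f => f P) h
  refine MvPolynomial.algHom_ext fun i => ?_
  simp only [AlgHom.comp_apply, hX, polyComp, MvPolynomial.aeval_X, map_sum, map_mul, hC]
  ext y
  rw [smComp_apply, coord_apply]
  nth_rewrite 2 [sum_coord_single y]
  rw [map_sum]
  simp only [map_smul, AddSubmonoidClass.coe_finsetSum, Finset.sum_apply, Subalgebra.coe_mul,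
    Pi.mul_apply, coord_apply, WithLp.ofLp_sum, WithLp.ofLp_smul, Pi.smul_apply, Complex.ofReal_sum,
    smul_eq_mul, Complex.ofReal_mul]
  refine Finset.sum_congr rfl fun j _ => ?_
  rw [mul_comm]
  rfl

theorem polyComp_mem {k : ℕ} (u : OrthGroup n) {h : MvPolynomial (Fin n) ℂ} (hh : h ∈ harmonicPoly n k) :
    polyComp u h ∈ harmonicPoly n k := by
  rw [mem_harmonicPoly] at hh ⊢
  constructor
  · have := hh.1.aeval (S := ℂ) (n := 1)
      (fun i => ∑ j, MvPolynomial.C ((u (EuclideanSpace.single j 1) i : ℝ) : ℂ) * MvPolynomial.X j)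
      (fun i => MvPolynomial.IsHomogeneous.sum _ _ _ fun j _ => (MvPolynomial.isHomogeneous_X ℂ j).C_mul _)
    rwa [one_mul] at this
  · apply ev_injective
    rw [← ev_lap, ev_polyComp, lap_smComp, ev_lap, hh.2, map_zero, map_zero]

theorem smComp_radVec (hn : 1 ≤ n) (s : ℂ) (m : ℤ) (l k : ℕ) (u : OrthGroup n)
    (h : MvPolynomial (Fin n) ℂ) :
    smComp u (radVec n hn s m l k h) = radVec n hn s m l k (polyComp u h) := by
  have hr : smComp u (ev ((polyCoord n).r2 ^ l)) = ev ((polyCoord n).r2 ^ l) := by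
    ext y
    rw [smComp_apply, map_pow, ev_r2]
    simp only [Subalgebra.coe_pow, Pi.pow_apply, smCoord_r2_apply, u.norm_map]
  rw [radVec_apply, radVec_apply, map_mul, map_mul, map_mul, map_mul, hr, ev_polyComp]
  congr 1
  ext y
  rw [smComp_apply, rad_apply, rad_apply, u.norm_map]

theorem kAct_sep (m : ℤ) (φ : ℝ) (u : OrthGroup n) (g : Sm n) :
    kAct φ u (sep n m g) = Complex.exp (Complex.I * m * φ / 2) • sep n m (smComp u⁻¹ g) := by
  funext p
  change sep n m g (p.1 - φ, u⁻¹ p.2) = _ * _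
  rw [sep_apply, sep_apply, smComp_apply, ← mul_assoc, ← Complex.exp_add]
  congr 2
  push_cast
  ring

theorem kAct_vec (hn : 1 ≤ n) (s : ℂ) (m : ℤ) (l k : ℕ) (φ : ℝ) (u : OrthGroup n)
    (h : MvPolynomial (Fin n) ℂ) :
    kAct φ u (vec n s m l k h) =
      Complex.exp (Complex.I * m * φ / 2) • vec n s m l k (polyComp u⁻¹ h) := by
  rw [vec_eq_sep hn, kAct_sep, smComp_radVec, ← vec_eq_sep hn]

instance (k : ℕ) : FiniteDimensional ℂ (harmonicSubmodule n k) := by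
  have : FiniteDimensional ℂ (MvPolynomial.homogeneousSubmodule (Fin n) ℂ k) :=
    Module.Finite.iff_fg.2 (MvPolynomial.homogeneousSubmodule_fg (R := ℂ) (σ := Fin n) k)
  exact Submodule.finiteDimensional_of_le (inf_le_left : harmonicSubmodule n k ≤ _)

/-- The orbit stays in the image of 𝓗_k at the same m and l, because rotations in θ act by scalars
and O(n) acts through h. -/
theorem isKFinite_vec (hn : 1 ≤ n) (s : ℂ) (m : ℤ) (l k : ℕ) {h : MvPolynomial (Fin n) ℂ}
    (hh : h ∈ harmonicPoly n k) : IsKFinite (vec n s m l k h) := by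
  refine Submodule.finiteDimensional_of_le
    (S₂ := (harmonicSubmodule n k).map (sep n m ∘ₗ radVec n hn s m l k)) (Submodule.span_le.2 ?_)
  rintro _ ⟨g, rfl⟩
  beta_reduce
  rw [kAct_vec hn, vec_eq_sep hn]
  refine Submodule.smul_mem _ _ ⟨_, ?_, rfl⟩
  exact mem_harmonicSubmodule.2 (polyComp_mem _ hh)

/-! ### Membership in the compact picture -/

theorem radVec_neg (hn : 1 ≤ n) (s : ℂ) (m : ℤ) (l : ℕ) {k : ℕ} {h : MvPolynomial (Fin n) ℂ}
    (hh : h.IsHomogeneous k) (y : Eucl n) :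
    (radVec n hn s m l k h : Eucl n → ℂ) (-y) = (-1) ^ k * (radVec n hn s m l k h : Eucl n → ℂ) y := by
  have h1 := ev_smul_apply (isHomogeneous_r2_pow_mul l hh) (-1) y
  rw [neg_one_smul] at h1
  have h2 : ∀ z, (radVec n hn s m l k h : Eucl n → ℂ) z =
    (ev ((polyCoord n).r2 ^ l * h) : Eucl n → ℂ) z *
      prof s (kummerCoeff (apar n m l k) (bpar n l k)) (‖z‖ ^ 2) := fun z => rfl
  rw [h2, h2, h1, norm_neg]
  push_cast
  rw [pow_add, pow_mul]
  norm_num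
  ring

theorem exp_quarter (m : ℤ) (j : ℤ) :
    Complex.exp (-Complex.I * m * (j * Real.pi) / 2) = Complex.I ^ (-(j * m)) := by
  rw [show -Complex.I * m * (j * Real.pi) / 2 = ((-(j * m) : ℤ) : ℂ) * (Real.pi / 2 * Complex.I) by
    push_cast; ring, Complex.exp_int_mul, Complex.exp_pi_div_two_mul_I]

/-- The congruence on m is the compatibility of e^{-imθ/2} with the parity (-1)^k = i^{2k} under (θ,
y) ↦ (θ + π, -y). -/
theorem I_zpow_of_modEq {m q : ℤ} {k : ℕ} (hm : m ≡ 2 * k + q [ZMOD 4]) (j : ℤ) :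
    Complex.I ^ (-(j * m)) * ((-1) ^ k) ^ j = Complex.I ^ (-(j * q)) := by
  obtain ⟨t, ht⟩ := hm.dvd
  have hm' : m = 2 * k + q - 4 * t := by linarith
  have hI2 : (Complex.I : ℂ) ^ (2 : ℤ) = -1 := by
    rw [show (2 : ℤ) = ((2 : ℕ) : ℤ) by rfl, zpow_natCast, Complex.I_sq]
  have hI : (Complex.I : ℂ) ≠ 0 := Complex.I_ne_zero
  have e1 : ((-1 : ℂ) ^ k) ^ j = Complex.I ^ (2 * k * j) := by
    rw [← hI2, ← zpow_natCast, ← zpow_mul, ← zpow_mul, mul_assoc]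
  have e2 : Complex.I ^ (4 * t * j) = 1 := by
    rw [show 4 * t * j = 2 * (2 * (t * j)) by ring, zpow_mul, hI2, zpow_mul]
    norm_num
  rw [e1, ← zpow_add₀ hI, hm',
    show -(j * (2 * k + q - 4 * t)) + 2 * k * j = -(j * q) + 4 * t * j by ring, zpow_add₀ hI, e2,
    mul_one]

theorem sep_mem_compactPicture {q m : ℤ} {k : ℕ} (hm : m ≡ 2 * k + q [ZMOD 4]) {g : Sm n}
    (hg : ∀ y, (g : Eucl n → ℂ) (-y) = (-1) ^ k * (g : Eucl n → ℂ) y) :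
    sep n m g ∈ compactPicture n q := by
  refine ⟨contDiff_sep m g, fun j θ y => ?_⟩
  have hgj : (g : Eucl n → ℂ) (((-1 : ℝ) ^ j) • y) = ((-1) ^ k) ^ j * (g : Eucl n → ℂ) y := by
    rcases Int.even_or_odd j with hj | hj
    · have : (((-1 : ℂ)) ^ k) ^ j = 1 := by
        rw [← zpow_natCast, ← zpow_mul, mul_comm, zpow_mul, hj.neg_one_zpow, one_zpow]
      rw [hj.neg_one_zpow, this]; simp
    · have : (((-1 : ℂ)) ^ k) ^ j = (-1) ^ k := by
        rw [← zpow_natCast, ← zpow_mul, mul_comm, zpow_mul, hj.neg_one_zpow]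
      rw [hj.neg_one_zpow, this, neg_one_smul, hg]
  rw [sep_apply, sep_apply, hgj, ← I_zpow_of_modEq hm j, ← exp_quarter]
  push_cast
  rw [show -Complex.I * m * (θ + j * Real.pi) / 2 =
    -Complex.I * m * θ / 2 + -Complex.I * m * (j * Real.pi) / 2 by ring, Complex.exp_add]
  ring

theorem vec_mem_compactPicture (hn : 1 ≤ n) {q m : ℤ} (s : ℂ) (l : ℕ) {k : ℕ}
    (hm : m ≡ 2 * k + q [ZMOD 4]) {h : MvPolynomial (Fin n) ℂ} (hh : h.IsHomogeneous k) :
    vec n s m l k h ∈ compactPicture n q := by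
  rw [vec_eq_sep hn]
  exact sep_mem_compactPicture hm (radVec_neg hn s m l hh)

theorem vec_mem_kerK (hn : 1 ≤ n) {q m : ℤ} (s : ℂ) {l k : ℕ} {lam : ℤ}
    (hlam : lam = (l : ℤ) * (2 * l + 2 * k + n - 2))
    (hm : m ≡ 2 * k + q [ZMOD 4]) {h : MvPolynomial (Fin n) ℂ} (hh : h ∈ harmonicPoly n k) :
    vec n s m l k h ∈ kerK n q s lam := by
  refine ⟨vec_mem_compactPicture hn s l hm hh.1, ?_, isKFinite_vec hn s m l k hh⟩
  rw [vec_eq_sep hn, omega_sep, radial_eq_radVec hn s m l k hh, map_smul, hlam]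
  congr 1
  push_cast
  ring

/-! ### The modules spanned by the vectors `F_{m,l,k}` -/

theorem vecSpan_le_kerK (hn : 1 ≤ n) (q : ℤ) (s : ℂ) {l k : ℕ} {lam : ℤ} (S : Set ℤ)
    (hlam : lam = (l : ℤ) * (2 * l + 2 * k + n - 2)) : vecSpan n q s l k S ≤ kerK n q s lam := by
  refine Submodule.span_le.2 ?_
  rintro _ ⟨m, -, hm, h, hh, rfl⟩
  exact vec_mem_kerK hn s hlam hm hh

theorem vecSpan_mono (q : ℤ) (s : ℂ) {l k : ℕ} {S T : Set ℤ} (hST : S ⊆ T) :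
    vecSpan n q s l k S ≤ vecSpan n q s l k T :=
  Submodule.span_mono fun _ ⟨m, hm, h⟩ => ⟨m, hST hm, h⟩

/-- Operators that are linear on smooth functions. -/
structure SmoothLinear (T : Fn n → Fn n) : Prop where
  add : ∀ F G, ContDiff ℝ ∞ F → ContDiff ℝ ∞ G → T (F + G) = T F + T G
  smul : ∀ (c : ℂ) F, ContDiff ℝ ∞ F → T (c • F) = c • T F

/-- Operators built from `fderiv` are additive only on differentiable functions, so smoothness has
to be carried along in the induction over the span. -/
theorem SmoothLinear.mem_of_span {T : Fn n → Fn n} (hT : SmoothLinear T) {X : Set (Fn n)}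
    {W : Submodule ℂ (Fn n)} (hX : ∀ F ∈ X, ContDiff ℝ ∞ F) (h : ∀ F ∈ X, T F ∈ W) :
    ∀ F ∈ Submodule.span ℂ X, T F ∈ W := by
  suffices H : ∀ F ∈ Submodule.span ℂ X, ContDiff ℝ ∞ F ∧ T F ∈ W from fun F hF => (H F hF).2
  intro F hF
  induction hF using Submodule.span_induction with
  | mem F hF => exact ⟨hX F hF, h F hF⟩
  | zero =>
    refine ⟨contDiff_const, ?_⟩
    have := hT.smul 0 0 contDiff_const
    rw [zero_smul, zero_smul] at this
    rw [this]; exact W.zero_mem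
  | add F G _ _ hF hG =>
    refine ⟨hF.1.add hG.1, ?_⟩
    rw [hT.add F G hF.1 hG.1]
    exact W.add_mem hF.2 hG.2
  | smul c F _ hF =>
    refine ⟨hF.1.const_smul c, ?_⟩
    rw [hT.smul c F hF.1]
    exact W.smul_mem c hF.2

theorem smoothLinear_dTheta : SmoothLinear (dTheta (n := n)) where
  add F G hF hG := by
    funext p
    simp only [dTheta, Pi.add_apply]
    rw [fderiv_add (hF.differentiable (by simp) p) (hG.differentiable (by simp) p)]
    rfl
  smul c F hF := by
    funext p
    simp only [dTheta, Pi.smul_apply]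
    rw [fderiv_const_smul (hF.differentiable (by simp) p)]
    rfl

theorem smoothLinear_euler : SmoothLinear (euler (n := n)) where
  add F G hF hG := by
    funext p
    simp only [euler, Pi.add_apply]
    rw [fderiv_add (hF.differentiable (by simp) p) (hG.differentiable (by simp) p)]
    rfl
  smul c F hF := by
    funext p
    simp only [euler, Pi.smul_apply]
    rw [fderiv_const_smul (hF.differentiable (by simp) p)]
    rfl

theorem smoothLinear_kappa : SmoothLinear (kappa (n := n)) where
  add F G hF hG := by
    funext p
    simp only [kappa, smoothLinear_dTheta.add F G hF hG, Pi.add_apply, mul_add]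
  smul c F hF := by
    funext p
    simp only [kappa, smoothLinear_dTheta.smul c F hF, Pi.smul_apply, smul_eq_mul]
    ring

theorem smoothLinear_etaPlus (s : ℂ) : SmoothLinear (etaPlus (n := n) s) where
  add F G hF hG := by
    funext p
    simp only [etaPlus, smoothLinear_dTheta.add F G hF hG, smoothLinear_euler.add F G hF hG,
      Pi.add_apply]
    ring
  smul c F hF := by
    funext p
    simp only [etaPlus, smoothLinear_dTheta.smul c F hF, smoothLinear_euler.smul c F hF,
      Pi.smul_apply, smul_eq_mul]
    ring

theorem smoothLinear_etaMinus (s : ℂ) : SmoothLinear (etaMinus (n := n) s) where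
  add F G hF hG := by
    funext p
    simp only [etaMinus, smoothLinear_dTheta.add F G hF hG, smoothLinear_euler.add F G hF hG,
      Pi.add_apply]
    ring
  smul c F hF := by
    funext p
    simp only [etaMinus, smoothLinear_dTheta.smul c F hF, smoothLinear_euler.smul c F hF,
      Pi.smul_apply, smul_eq_mul]
    ring

theorem vec_mem_vecSpan {q m : ℤ} (s : ℂ) (l : ℕ) {k : ℕ} {S : Set ℤ} (hmS : m ∈ S)
    (hm : m ≡ 2 * k + q [ZMOD 4]) {h : MvPolynomial (Fin n) ℂ} (hh : h ∈ harmonicPoly n k) :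
    vec n s m l k h ∈ vecSpan n q s l k S :=
  Submodule.subset_span ⟨m, hmS, hm, h, hh, rfl⟩

theorem modEq_add_four {m r : ℤ} (hm : m ≡ r [ZMOD 4]) : m + 4 ≡ r [ZMOD 4] := by
  simpa using hm.add (show (4 : ℤ) ≡ 0 [ZMOD 4] by decide)

theorem modEq_sub_four {m r : ℤ} (hm : m ≡ r [ZMOD 4]) : m - 4 ≡ r [ZMOD 4] := by
  simpa using hm.sub (show (4 : ℤ) ≡ 0 [ZMOD 4] by decide)

/-- The span of the `F_{m,l,k}` with `m` in a set closed under the nonzero steps is a submodule. -/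
theorem isSubrep_vecSpan (hn : 1 ≤ n) (q : ℤ) (s : ℂ) (l k : ℕ) (S : Set ℤ)
    (hup : ∀ m ∈ S, m ≡ 2 * k + q [ZMOD 4] → m ≠ -(2 * k + 4 * l + n) → m + 4 ∈ S)
    (hdown : ∀ m ∈ S, m ≡ 2 * k + q [ZMOD 4] → m ≠ 2 * k + 4 * l + n → m - 4 ∈ S) :
    IsSubrep n q s (vecSpan n q s l k S) := by
  have hsm : ∀ F ∈ {F | ∃ m ∈ S, m ≡ 2 * k + q [ZMOD 4] ∧ ∃ h ∈ harmonicPoly n k, F = vec n s m l k h},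
      ContDiff ℝ ∞ F := by
    rintro _ ⟨m, -, hm, h, hh, rfl⟩
    rw [vec_eq_sep hn]
    exact contDiff_sep _ _
  refine ⟨?_, ?_, ?_, ?_, fun u => ?_⟩
  · refine Submodule.span_le.2 ?_
    rintro _ ⟨m, -, hm, h, hh, rfl⟩
    exact vec_mem_compactPicture hn s l hm hh.1
  · refine smoothLinear_kappa.mem_of_span hsm ?_
    rintro _ ⟨m, hmS, hm, h, hh, rfl⟩
    rw [vec_eq_sep hn, kappa_sep, ← vec_eq_sep hn]
    exact Submodule.smul_mem _ _ (vec_mem_vecSpan s l hmS hm hh)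
  · refine (smoothLinear_etaPlus s).mem_of_span hsm ?_
    rintro _ ⟨m, hmS, hm, h, hh, rfl⟩
    rw [etaPlus_vec hn s m l k hh.1]
    -- At this weight η⁺ kills the vector, and m + 4 need not belong to `S`.
    by_cases h0 : m = -(2 * k + 4 * l + n)
    · rw [h0]
      push_cast
      rw [show (-(-(2 * (k : ℂ) + 4 * l + n) + (4 * l + 2 * k + n)) / 4) = 0 by ring, zero_smul]
      exact Submodule.zero_mem _
    · exact Submodule.smul_mem _ _ (vec_mem_vecSpan s l (hup m hmS hm h0) (modEq_add_four hm) hh)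
  · refine (smoothLinear_etaMinus s).mem_of_span hsm ?_
    rintro _ ⟨m, hmS, hm, h, hh, rfl⟩
    rw [etaMinus_vec hn s m l k hh.1]
    by_cases h0 : m = 2 * k + 4 * l + n
    · rw [h0]
      push_cast
      rw [show (-((4 * (l : ℂ) + 2 * k + n) - (2 * k + 4 * l + n)) / 4) = 0 by ring, zero_smul]
      exact Submodule.zero_mem _
    · exact Submodule.smul_mem _ _ (vec_mem_vecSpan s l (hdown m hmS hm h0) (modEq_sub_four hm) hh)
  · have : vecSpan n q s l k S ≤ (vecSpan n q s l k S).comap (kAct 0 u) := by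
      refine Submodule.span_le.2 ?_
      rintro _ ⟨m, hmS, hm, h, hh, rfl⟩
      change kAct 0 u _ ∈ vecSpan n q s l k S
      rw [kAct_vec hn]
      exact Submodule.smul_mem _ _ (vec_mem_vecSpan s l hmS hm (polyComp_mem _ hh))
    exact this

/-! ### Simultaneous solutions of the radial and the Casimir equations -/

/-- The equation `Ω'' F = 2λ F` for the factor of `F = e^{-imθ/2} g(y)` depending on `y`. -/
def RadialEq (s : ℂ) (m : ℤ) (lam : ℂ) (g : Sm n) : Prop :=
  (smCoord n).r2 * ((-2 * Complex.I * m * s) • g + (4 * s ^ 2) • ((smCoord n).r2 * g) +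
    (smCoord n).lap g) = (2 * lam) • g

theorem RadialEq.sub {s : ℂ} {m : ℤ} {lam : ℂ} {f g : Sm n} (hf : RadialEq s m lam f)
    (hg : RadialEq s m lam g) : RadialEq s m lam (f - g) := by
  unfold RadialEq at *
  rw [smul_sub (2 * lam), ← hf, ← hg, ← mul_sub, mul_sub (smCoord n).r2 f g, smul_sub, smul_sub, map_sub]
  congr 1
  abel

theorem RadialEq.r2lap {s : ℂ} {m : ℤ} {lam : ℂ} {g : Sm n} (hg : RadialEq s m lam g) :
    (smCoord n).r2lap g = (2 * lam) • g + (2 * Complex.I * m * s) • ((smCoord n).r2 * g) -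
      (4 * s ^ 2) • ((smCoord n).r2 * ((smCoord n).r2 * g)) := by
  unfold RadialEq at hg
  rw [← hg, CoordSystem.r2lap_apply]
  simp only [mul_add, mul_smul_comm]
  module

theorem E_E_of_casimir {c : ℂ} {g : Sm n} (hg : (smCoord n).casimir g = c • g) :
    (smCoord n).E ((smCoord n).E g) =
      (smCoord n).r2lap g - ((n : ℂ) - 2) • (smCoord n).E g - (c / 2) • g := by
  have h2 : (2 : Sm n) = algebraMap ℂ (Sm n) 2 := rfl
  have hn' : ((n : Sm n) - 2) = algebraMap ℂ (Sm n) (n - 2) := by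
    rw [h2, map_sub, map_natCast]
  rw [CoordSystem.casimir_eq, hn', h2, ← Algebra.smul_def, ← Algebra.smul_def] at hg
  have : (smCoord n).r2lap g - (smCoord n).E ((smCoord n).E g) - ((n : ℂ) - 2) • (smCoord n).E g =
      (c / 2) • g := by
    rw [div_eq_inv_mul, mul_smul, ← hg, smul_smul, inv_mul_cancel₀ two_ne_zero, one_smul]
  rw [← this]
  abel

theorem taylorPart_casimir (d : ℕ) (g : Sm n) :
    taylorPart d ((smCoord n).casimir g) = (2 : ℂ) • ((polyCoord n).r2lap (taylorPart d g) -
      ((d : ℂ) * (d + n - 2)) • taylorPart d g) := by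
  have h2 : (2 : Sm n) = algebraMap ℂ (Sm n) 2 := rfl
  have hn' : ((n : Sm n) - 2) = algebraMap ℂ (Sm n) (n - 2) := by
    rw [h2, map_sub, map_natCast]
  rw [CoordSystem.casimir_eq, hn', h2, ← Algebra.smul_def, ← Algebra.smul_def, map_smul, map_sub,
    map_sub, map_smul, taylorPart_E, taylorPart_E, taylorPart_r2lap, smul_smul, smul_smul, sub_sub,
    ← add_smul]
  congr 3
  ring

/-- The Casimir equation expresses E² through r²Δ, E and 1, and the radial equation expresses r²Δ g
as a smooth multiple of g. The result is E²g = (2 - n) Eg + b g. -/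
theorem eq_zero_of_flat_of_casimir {s : ℂ} {m : ℤ} {lam c : ℂ} {g : Sm n} (hr : RadialEq s m lam g)
    (hc : (smCoord n).casimir g = c • g) (hflat : ∀ d, taylorPart d g = 0) : g = 0 := by
  refine eq_zero_of_flat hflat (2 - n) (algebraMap ℂ (Sm n) (2 * lam - c / 2) +
    (2 * Complex.I * m * s) • (smCoord n).r2 - (4 * s ^ 2) • ((smCoord n).r2 * (smCoord n).r2)) ?_
  rw [E_E_of_casimir hc, hr.r2lap, sub_mul, add_mul, ← Algebra.smul_def, smul_mul_assoc,
    smul_mul_assoc, mul_assoc (smCoord n).r2]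
  module

theorem taylorPart_r2_mul_eq_zero {N : ℕ} {g : Sm n} (h : ∀ d < N, taylorPart d g = 0) :
    ∀ d < N + 2, taylorPart d ((smCoord n).r2 * g) = 0 := by
  intro d hd
  by_cases h2 : d < 2
  · exact taylorPart_r2_mul_of_lt h2 g
  · obtain ⟨e, rfl⟩ : ∃ e, d = 2 + e := ⟨d - 2, by omega⟩
    rw [taylorPart_r2_mul, h e (by omega), mul_zero]

/-- The lowest Taylor component of a simultaneous solution. -/
theorem lowest_term {s : ℂ} {m : ℤ} {lam c : ℂ} {g : Sm n} (hr : RadialEq s m lam g)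
    (hc : (smCoord n).casimir g = c • g) {N : ℕ} (hlow : ∀ d < N, taylorPart d g = 0)
    (hN : taylorPart N g ≠ 0) :
    (polyCoord n).r2lap (taylorPart N g) = (2 * lam) • taylorPart N g ∧
      c / 2 + N * (N + n - 2) = 2 * lam := by
  have h1 : (polyCoord n).r2lap (taylorPart N g) = (2 * lam) • taylorPart N g := by
    -- The terms of the radial equation carrying r² or r⁴ have no component in degree N.
    have h0 := taylorPart_r2_mul_eq_zero hlow
    have h2 := taylorPart_r2_mul_eq_zero h0
    rw [← taylorPart_r2lap, hr.r2lap, map_sub, map_add, map_smul, map_smul, map_smul,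
      h0 N (by omega), h2 N (by omega)]
    simp
  refine ⟨h1, ?_⟩
  have h3 := congrArg (taylorPart N) hc
  rw [taylorPart_casimir, h1, map_smul, ← sub_smul, smul_smul] at h3
  have h4 := smul_left_injective ℂ hN h3
  beta_reduce at h4
  linear_combination -h4 / 2

/-- Needed for n = 1, where the exponents 0 and 1 belong to the same eigenvalues and only parity
separates them. -/
theorem taylorPart_one_of_even {g : Sm n} (h : ∀ y, (g : Eucl n → ℂ) (-y) = (g : Eucl n → ℂ) y) :
    taylorPart 1 g = 0 := by
  have h0 : fderiv ℝ (g : Eucl n → ℂ) 0 = 0 := by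
    have h1 : (fun y => (g : Eucl n → ℂ) (-y)) = g := funext h
    have h2 := (differentiable_coe g (-0)).hasFDerivAt.comp (0 : Eucl n) (hasFDerivAt_id 0).neg
    have h3 : HasFDerivAt (fun y => (g : Eucl n → ℂ) (-y)) _ 0 := h2
    rw [h1] at h3
    have h4 := h3.fderiv
    rw [neg_zero] at h4
    ext v
    have h5 := congrArg (fun L => L v) h4
    simp only [ContinuousLinearMap.comp_apply, neg_apply,
      ContinuousLinearMap.id_apply, map_neg] at h5
    simpa using self_eq_neg.1 h5
  rw [taylorPart_succ]
  simp [taylorPart_zero, pd_apply, h0]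

theorem eq_zero_of_I_zpow {z : ℤ} (h : Complex.I ^ z = 1) : (4 : ℤ) ∣ z := by
  have h4 : (Complex.I : ℂ) ^ (4 : ℤ) = 1 := by
    rw [show (4 : ℤ) = ((4 : ℕ) : ℤ) by rfl, zpow_natCast, Complex.I_pow_four]
  have hz : Complex.I ^ z = Complex.I ^ (z % 4) := by
    conv_lhs => rw [← Int.emod_add_mul_ediv z 4, zpow_add₀ Complex.I_ne_zero, zpow_mul, h4, one_zpow,
      mul_one]
  rw [hz] at h
  have h1 := Int.emod_nonneg z (by norm_num : (4 : ℤ) ≠ 0)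
  have h2 := Int.emod_lt_of_pos z (by norm_num : (0 : ℤ) < 4)
  refine Int.dvd_of_emod_eq_zero ?_
  generalize z % 4 = r at *
  interval_cases r
  · rfl
  · rw [zpow_one] at h
    have := congrArg Complex.im h
    simp at this
  · rw [show (2 : ℤ) = ((2 : ℕ) : ℤ) by rfl, zpow_natCast, Complex.I_sq] at h
    norm_num at h
  · rw [show (3 : ℤ) = ((3 : ℕ) : ℤ) by rfl, zpow_natCast, Complex.I_pow_three] at h
    have := congrArg Complex.im h
    simp at this

/-- On the line there are no rotations, so C = 0 and `casimir_eq` reads k(k-1) h = 0. -/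
theorem degree_le_one_of_dim_one {k : ℕ} {h : MvPolynomial (Fin 1) ℂ} (hh : h ∈ harmonicPoly 1 k)
    (h0 : h ≠ 0) : k ≤ 1 := by
  rw [mem_harmonicPoly] at hh
  have h1 := (polyCoord 1).casimir_eq h
  have h2 : (polyCoord 1).casimir h = 0 := by
    simp [CoordSystem.casimir_apply, CoordSystem.rot_apply]
  rw [h2, CoordSystem.r2lap_apply, hh.2, polyCoord_E hh.1, map_smul, polyCoord_E hh.1] at h1
  by_contra hk
  have h3 : ((k : ℂ) * (k - 1)) • h = 0 := by
    have h4 : (2 : MvPolynomial (Fin 1) ℂ) * (((k : ℂ) * (k - 1)) • h) = 0 := by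
      rw [← neg_eq_zero, h1]
      simp only [MvPolynomial.smul_eq_C_mul]
      simp
      ring
    exact (mul_eq_zero.1 h4).resolve_left two_ne_zero
  have h5 : ((k : ℂ) * (k - 1)) ≠ 0 := by
    refine mul_ne_zero (Nat.cast_ne_zero.2 (by omega)) (sub_ne_zero.2 ?_)
    exact_mod_cast (by omega : k ≠ 1)
  exact h0 ((smul_eq_zero.1 h3).resolve_left h5)

/-- A simultaneous solution of the radial and the Casimir equation, with the parity of weight `m`,
is the `y`-dependent factor of some `F_{m,l,k}`. -/
theorem exists_radVec (hn : 1 ≤ n) {q : ℤ} {s : ℂ} {m lam : ℤ} (hlam : IsAdmissible n lam) {c : ℂ}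
    {g : Sm n} (hr : RadialEq s m lam g) (hc : (smCoord n).casimir g = c • g) (h0 : g ≠ 0)
    (hpar : ∀ y, (g : Eucl n → ℂ) (-y) = Complex.I ^ (m - q) * (g : Eucl n → ℂ) y) :
    ∃ l k, IsAdmissiblePair n lam l k ∧ m ≡ 2 * k + q [ZMOD 4] ∧
      ∃ h ∈ harmonicPoly n k, g = radVec n hn s m l k h := by
  have hex : ∃ d, taylorPart d g ≠ 0 := by
    by_contra hno
    push Not at hno
    exact h0 (eq_zero_of_flat_of_casimir hr hc hno)
  classical
  set N := Nat.find hex with hN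
  have hNne : taylorPart N g ≠ 0 := Nat.find_spec hex
  have hNlt : ∀ d < N, taylorPart d g = 0 := fun d hd => by
    simpa using Nat.find_min hex hd
  obtain ⟨h1, h2⟩ := lowest_term hr hc hNlt hNne
  obtain ⟨l, k, hNlk, hμ, h, hh, hP⟩ := exists_harmonic_of_r2lap_eq hn N _ _
    (isHomogeneous_taylorPart N g) hNne h1
  have hh' := (mem_harmonicPoly.1 hh).1
  have hh0 : h ≠ 0 := by rintro rfl; simp [hP] at hNne
  have hlamC : (lam : ℂ) = l * (2 * l + 2 * k + n - 2) := by linear_combination hμ / 2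
  have hlamZ : lam = (l : ℤ) * (2 * l + 2 * k + n - 2) := by exact_mod_cast hlamC
  have hcC : c = -2 * k * (k + n - 2) := by
    rw [hlamC, hNlk] at h2
    push_cast at h2
    linear_combination 2 * h2
  have hG := taylorPart_radVec hn s m l k hh'
  have hrG : RadialEq s m lam (radVec n hn s m l k h) := by
    unfold RadialEq
    rw [radial_eq_radVec hn s m l k hh, hlamC]
    congr 1; ring
  have hcG : (smCoord n).casimir (radVec n hn s m l k h) = c • radVec n hn s m l k h := by
    rw [casimir_radVec hn s m l k hh, hcC]
  -- Otherwise the difference satisfies the same two equations and starts in some degree N' > N.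
  have hgG : g = radVec n hn s m l k h := by
    rw [← sub_eq_zero]
    by_contra hD0
    have hrD := hr.sub hrG
    have hcD : (smCoord n).casimir (g - radVec n hn s m l k h) = c • (g - radVec n hn s m l k h) := by
      rw [map_sub, hc, hcG, smul_sub]
    have hex' : ∃ d, taylorPart d (g - radVec n hn s m l k h) ≠ 0 := by
      by_contra hno
      push Not at hno
      exact hD0 (eq_zero_of_flat_of_casimir hrD hcD hno)
    set N' := Nat.find hex' with hN'
    have hN'ne := Nat.find_spec hex'
    have hN'lt : ∀ d < N', taylorPart d (g - radVec n hn s m l k h) = 0 := fun d hd => by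
      simpa using Nat.find_min hex' hd
    rw [← hN'] at hN'ne
    have hNN' : N < N' := by
      by_contra hle
      rcases lt_or_eq_of_le (not_lt.1 hle) with hlt | heq
      · apply hN'ne
        rw [map_sub, hNlt _ hlt, hG.2 _ (hNlk ▸ hlt), sub_zero]
      · apply hN'ne
        rw [map_sub, heq, hP, hNlk, hG.1, sub_self]
    have h3 := (lowest_term hrD hcD hN'lt hN'ne).2
    have h4 : ((N' * (N' + n) + 2 * N : ℕ) : ℂ) = ((N * (N + n) + 2 * N' : ℕ) : ℂ) := by
      push_cast
      linear_combination h3 - h2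
    rw [Nat.cast_inj] at h4
    -- N and N' are distinct roots of the same quadratic x(x + n - 2) = 2λ - c/2, so their sum is 2
    -- - n. This forces n = 1, N = 0 and N' = 1.
    have h5 : N' + N + n = 2 := by
      obtain ⟨t, ht⟩ : ∃ t, N' = N + t + 1 := ⟨N' - N - 1, by omega⟩
      rw [ht] at h4 ⊢
      have h6 : ((t : ℤ) + 1) * (N + t + 1 + N + n - 2) = 0 := by
        zify at h4
        linear_combination h4
      have h7 : ((N : ℤ) + t + 1 + N + n - 2) = 0 :=
        (mul_eq_zero.1 h6).resolve_left (by positivity)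
      omega
    have hN0 : N = 0 := by omega
    have hN1 : N' = 1 := by omega
    have hk0 : k = 0 := by omega
    subst hk0
    have hg0 : (g : Eucl n → ℂ) 0 ≠ 0 := by
      rw [hN0, taylorPart_zero] at hNne
      intro h; rw [h] at hNne; simp at hNne
    -- As g does not vanish at the origin, its parity is even, and so is that of the difference,
    -- which then has no linear term.
    have hε : Complex.I ^ (m - q) = 1 := by
      have := hpar 0
      rw [neg_zero] at this
      exact (mul_right_cancel₀ hg0 (by rw [← this, one_mul] : Complex.I ^ (m - q) * (g : Eucl n → ℂ) 0 = 1 * _))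
    apply hN'ne
    rw [hN1]
    refine taylorPart_one_of_even fun y => ?_
    have e1 := hpar y
    have e2 := radVec_neg hn s m l hh' y
    rw [hε, one_mul] at e1
    rw [pow_zero, one_mul] at e2
    simp [e1, e2]
  refine ⟨l, k, ⟨hlamZ, ?_⟩, ?_, h, hh, hgG⟩
  · rcases hlam with ⟨rfl, -⟩ | ⟨hn2, l', j, hl', hlj, hl⟩
    · exact Or.inr ⟨rfl, degree_le_one_of_dim_one hh hh0⟩
    · refine Or.inl ⟨hn2, ?_⟩
      rcases Nat.eq_zero_or_pos l with rfl | hl0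
      · exfalso
        have : 0 < l' * ((n : ℤ) + 2 * j) := mul_pos (by omega) (by omega)
        rw [← hl, hlamZ] at this
        simp at this
      · exact hl0
  · obtain ⟨y, hy⟩ : ∃ y, (g : Eucl n → ℂ) y ≠ 0 := by
      by_contra hno
      push Not at hno
      exact h0 (Subtype.ext (funext hno))
    have e1 := hpar y
    rw [hgG, radVec_neg hn s m l hh' y, ← hgG] at e1
    have e2 := mul_right_cancel₀ hy e1
    have e3 : Complex.I ^ (m - q - 2 * k) = 1 := by
      have hI2 : (Complex.I : ℂ) ^ (2 : ℤ) = -1 := by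
        rw [show (2 : ℤ) = ((2 : ℕ) : ℤ) by rfl, zpow_natCast, Complex.I_sq]
      rw [zpow_sub₀ Complex.I_ne_zero, ← e2, zpow_mul, hI2, zpow_natCast]
      exact div_self (pow_ne_zero _ (by norm_num))
    have := eq_zero_of_I_zpow e3
    exact ((Int.modEq_iff_dvd.2 (by rwa [show m - (2 * (k : ℤ) + q) = m - q - 2 * k by ring]))).symm

/-! ### Finite-dimensional spaces of functions -/

/-- A finite-dimensional space of functions contains the pointwise derivatives of its curves. -/
theorem deriv_mem_of_finiteDimensional {X : Type*} (V : Submodule ℂ (X → ℂ)) [FiniteDimensional ℂ V]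
    {G : ℝ → X → ℂ} {G' : X → ℂ} (hG : ∀ t, G t ∈ V)
    (hd : ∀ x, HasDerivAt (fun t => G t x) (G' x) 0) : G' ∈ V := by
  -- A finite-dimensional subspace is closed for pointwise convergence, and the difference quotients
  -- converge pointwise.
  have hcl : IsClosed (V : Set (X → ℂ)) := V.closed_of_finiteDimensional
  have ht : Filter.Tendsto (fun t : ℝ => ((t : ℂ)⁻¹) • (G t - G 0)) (nhdsWithin 0 {0}ᶜ) (nhds G') := by
    rw [tendsto_pi_nhds]
    intro x
    have := hasDerivAt_iff_tendsto_slope_zero.1 (hd x)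
    refine this.congr fun t => ?_
    simp
  exact hcl.mem_of_tendsto ht (Filter.Eventually.of_forall fun t =>
    V.smul_mem _ (V.sub_mem (hG t) (hG 0)))

/-- Excluding Jordan chains of length two excludes all longer ones. -/
theorem apply_eq_zero_of_pow {K M : Type*} [CommRing K] [AddCommGroup M] [Module K M]
    {A : Module.End K M} (h : ∀ v, A (A v) = 0 → A v = 0) (k : ℕ) :
    ∀ v, (A ^ k) v = 0 → A v = 0 := by
  induction k with
  | zero => intro v hv; simp at hv; simp [hv]
  | succ k ih =>
    intro v hv
    rw [pow_succ, Module.End.mul_apply] at hv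
    exact h v (ih _ hv)

/-- If an operator on a finite-dimensional invariant space has no nontrivial generalized
eigenvectors, then the space is contained in any space containing its eigenvectors. -/
theorem le_of_eigenvectors_mem {M : Type*} [AddCommGroup M] [Module ℂ M] {V W : Submodule ℂ M}
    [FiniteDimensional ℂ V] (T : V →ₗ[ℂ] M) (hT : ∀ v, T v ∈ V)
    (hss : ∀ (μ : ℂ) (v w : V), T v = μ • (v : M) + w → T w = μ • (w : M) → w = 0)
    (hW : ∀ (μ : ℂ) (v : V), T v = μ • (v : M) → (v : M) ∈ W) : V ≤ W := by
  intro x hx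
  set D : Module.End ℂ V := T.codRestrict V hT with hD
  have hDv : ∀ v, (D v : M) = T v := fun v => rfl
  have htop := Module.End.iSup_maxGenEigenspace_eq_top D
  have hmem : (⟨x, hx⟩ : V) ∈ ⨆ μ : ℂ, Module.End.maxGenEigenspace D μ := by rw [htop]; trivial
  suffices H : ∀ v : V, v ∈ ⨆ μ : ℂ, Module.End.maxGenEigenspace D μ → (v : M) ∈ W from H _ hmem
  intro v hv
  induction hv using Submodule.iSup_induction' with
  | mem μ v hv =>
    obtain ⟨k, hk⟩ := (Module.End.mem_maxGenEigenspace D μ v).1 hv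
    have happ : ∀ w : V, (((D - μ • 1) w : V) : M) = T w - μ • (w : M) := fun w => rfl
    have h0 := apply_eq_zero_of_pow (A := D - μ • 1) (fun w hw => by
      refine hss μ w _ ?_ ?_
      · rw [happ]; abel
      · rw [← sub_eq_zero, ← happ, hw]; rfl) k v hk
    refine hW μ v ?_
    rw [← sub_eq_zero, ← happ, h0]; rfl
  | zero => exact W.zero_mem
  | add v w _ _ h1 h2 => exact W.add_mem h1 h2

theorem exists_eigenvector_mem {M : Type*} [AddCommGroup M] [Module ℂ M] {V : Submodule ℂ M}
    [FiniteDimensional ℂ V] (T : M →ₗ[ℂ] M) (hT : ∀ v ∈ V, T v ∈ V) {v : M} (hv : v ∈ V)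
    (hv0 : v ≠ 0) : ∃ (c : ℂ) (w : M), w ∈ V ∧ w ≠ 0 ∧ T w = c • w := by
  have : Nontrivial V := ⟨⟨⟨v, hv⟩, 0, fun h => hv0 (congrArg Subtype.val h)⟩⟩
  obtain ⟨c, hc⟩ := Module.End.exists_eigenvalue (T.restrict hT : Module.End ℂ V)
  obtain ⟨f, hf⟩ := hc.exists_hasEigenvector
  exact ⟨c, f, f.2, fun h => hf.2 (Subtype.ext h), congrArg Subtype.val hf.apply_eq_smul⟩

/-! ### Plane rotations -/

/-- The rotation of angle `t` in the plane of the coordinates `i ≠ j`. -/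
def planeRot {i j : Fin n} (hij : i ≠ j) (t : ℝ) : OrthGroup n :=
  LinearIsometry.toLinearIsometryEquiv
    (F := Eucl n) (E₁ := Eucl n) (R₁ := ℝ)
    { toFun := fun y => y + ((Real.cos t - 1) * y i - Real.sin t * y j) • EuclideanSpace.single i (1 : ℝ) +
        (Real.sin t * y i + (Real.cos t - 1) * y j) • EuclideanSpace.single j (1 : ℝ)
      map_add' := fun y z => by
        simp only [PiLp.add_apply]
        module
      map_smul' := fun c y => by
        simp only [PiLp.smul_apply, smul_eq_mul, RingHom.id_apply]
        module
      norm_map' := fun y => by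
        have key : ∀ a b : ℝ, ‖y + a • EuclideanSpace.single i (1 : ℝ) + b • EuclideanSpace.single j (1 : ℝ)‖ ^ 2 =
            ‖y‖ ^ 2 + 2 * a * y i + 2 * b * y j + a ^ 2 + b ^ 2 := by
          intro a b
          rw [norm_add_sq_real, norm_add_sq_real, norm_smul, norm_smul, inner_add_left,
            inner_smul_right, inner_smul_right, inner_smul_right, inner_smul_left]
          simp [EuclideanSpace.inner_single_right, hij.symm]
          ring
        refine (sq_eq_sq₀ (norm_nonneg _) (norm_nonneg _)).1 ?_
        simp only [LinearMap.coe_mk, AddHom.coe_mk]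
        rw [key]
        linear_combination ((y i) ^ 2 + (y j) ^ 2) * Real.sin_sq_add_cos_sq t }
    rfl

theorem planeRot_apply {i j : Fin n} (hij : i ≠ j) (t : ℝ) (y : Eucl n) :
    planeRot hij t y = y + ((Real.cos t - 1) * y i - Real.sin t * y j) • EuclideanSpace.single i (1 : ℝ) +
        (Real.sin t * y i + (Real.cos t - 1) * y j) • EuclideanSpace.single j (1 : ℝ) := rfl

theorem hasDerivAt_planeRot {i j : Fin n} (hij : i ≠ j) (g : Sm n) (y : Eucl n) :
    HasDerivAt (fun t => (g : Eucl n → ℂ) (planeRot hij t y))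
      (((smCoord n).rot i j g : Eucl n → ℂ) y) 0 := by
  have h0 : planeRot hij 0 y = y := by simp [planeRot_apply]
  have h1 : HasDerivAt (fun t => planeRot hij t y)
      ((-y j) • EuclideanSpace.single i (1 : ℝ) + (y i) • EuclideanSpace.single j (1 : ℝ)) 0 := by
    have hc := Real.hasDerivAt_cos 0
    have hs := Real.hasDerivAt_sin 0
    have a1 := ((((hc.sub_const 1).mul_const (y i)).sub (hs.mul_const (y j))).smul_const
      (EuclideanSpace.single i (1 : ℝ))).const_add y
    have a2 := ((hs.mul_const (y i)).add ((hc.sub_const 1).mul_const (y j))).smul_const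
      (EuclideanSpace.single j (1 : ℝ))
    have a3 := a1.add a2
    refine a3.congr_deriv ?_
    simp
  have h2 : HasFDerivAt (g : Eucl n → ℂ) (fderiv ℝ (g : Eucl n → ℂ) y) (planeRot hij 0 y) := by
    rw [h0]; exact (differentiable_coe g y).hasFDerivAt
  refine (h2.comp_hasDerivAt 0 h1).congr_deriv ?_
  rw [CoordSystem.rot_apply, map_add, map_smul, map_smul]
  change _ = (y i : ℂ) * (pd j g : Eucl n → ℂ) y - (y j : ℂ) * (pd i g : Eucl n → ℂ) y
  rw [pd_apply, pd_apply]
  simp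
  ring

/-- A finite-dimensional space of smooth functions stable under `O(n)` is stable under the
infinitesimal rotations. -/
theorem rot_mem {U : Submodule ℂ (Sm n)} [FiniteDimensional ℂ U]
    (hU : ∀ u : OrthGroup n, ∀ g ∈ U, smComp u g ∈ U) (i j : Fin n) :
    ∀ g ∈ U, (smCoord n).rot i j g ∈ U := by
  intro g hg
  by_cases hij : i = j
  · subst hij
    rw [CoordSystem.rot_apply, sub_self]
    exact U.zero_mem
  have hm := deriv_mem_of_finiteDimensional (U.map (Sm n).val.toLinearMap)
    (G := fun t => (smComp (planeRot hij t) g : Eucl n → ℂ))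
    (G' := ((smCoord n).rot i j g : Eucl n → ℂ))
    (fun t => ⟨_, hU _ g hg, rfl⟩) (fun y => hasDerivAt_planeRot hij g y)
  obtain ⟨f, hf, hfe⟩ := hm
  have : f = (smCoord n).rot i j g := Subtype.ext hfe
  rwa [← this]

theorem casimir_mem {U : Submodule ℂ (Sm n)} [FiniteDimensional ℂ U]
    (hU : ∀ u : OrthGroup n, ∀ g ∈ U, smComp u g ∈ U) : ∀ g ∈ U, (smCoord n).casimir g ∈ U := by
  intro g hg
  rw [CoordSystem.casimir_apply]
  exact U.sum_mem fun i _ => U.sum_mem fun j _ => rot_mem hU i j _ (rot_mem hU i j g hg)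

/-- A finite-dimensional `O(n)`-stable space of solutions of the radial equation contains no
nonzero flat function. -/
theorem eq_zero_of_flat_of_mem {U : Submodule ℂ (Sm n)} [FiniteDimensional ℂ U]
    (hU : ∀ u : OrthGroup n, ∀ g ∈ U, smComp u g ∈ U) {s : ℂ} {m : ℤ} {lam : ℂ}
    (hr : ∀ g ∈ U, RadialEq s m lam g) {g : Sm n} (hg : g ∈ U) (hflat : ∀ d, taylorPart d g = 0) :
    g = 0 := by
  -- The flat elements form a subspace stable under the Casimir operator. If it were nonzero it
  -- would contain an eigenvector, which flatness forces to vanish.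
  set U₀ : Submodule ℂ (Sm n) := U ⊓ ⨅ d, LinearMap.ker (taylorPart d) with hU₀
  have hmem : ∀ f, f ∈ U₀ ↔ f ∈ U ∧ ∀ d, taylorPart d f = 0 := fun f => by
    simp [hU₀, Submodule.mem_iInf]
  have : FiniteDimensional ℂ U₀ := Submodule.finiteDimensional_of_le inf_le_left
  have hstab : ∀ f ∈ U₀, (smCoord n).casimir f ∈ U₀ := by
    intro f hf
    rw [hmem] at hf ⊢
    refine ⟨casimir_mem hU f hf.1, fun d => ?_⟩
    rw [taylorPart_casimir, hf.2 d]
    simp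
  by_contra h0
  obtain ⟨c, f, hf, hf0, hfe⟩ := exists_eigenvector_mem _ hstab ((hmem g).2 ⟨hg, hflat⟩) h0
  have hfU := (hmem f).1 hf
  exact hf0 (eq_zero_of_flat_of_casimir (hr f hfU.1) hfe hfU.2)

/-- A finite-dimensional `O(n)`-stable space of solutions of the radial equation, with the parity of
weight `m`, is contained in any space containing the `y`-dependent factors of the `F_{m,l,k}`. -/
theorem le_of_radVec_mem (hn : 1 ≤ n) {U W : Submodule ℂ (Sm n)} [FiniteDimensional ℂ U]
    (hU : ∀ u : OrthGroup n, ∀ g ∈ U, smComp u g ∈ U) {q : ℤ} {s : ℂ} {m lam : ℤ}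
    (hlam : IsAdmissible n lam) (hr : ∀ g ∈ U, RadialEq s m lam g)
    (hpar : ∀ g ∈ U, ∀ y, (g : Eucl n → ℂ) (-y) = Complex.I ^ (m - q) * (g : Eucl n → ℂ) y)
    (hW : ∀ l k, IsAdmissiblePair n lam l k → m ≡ 2 * k + q [ZMOD 4] → ∀ h ∈ harmonicPoly n k,
      radVec n hn s m l k h ∈ W) : U ≤ W := by
  refine le_of_eigenvectors_mem ((smCoord n).casimir ∘ₗ U.subtype)
    (fun v => casimir_mem hU _ v.2) ?_ ?_
  · intro c v v₁ hv hv₁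
    -- A Jordan pair (v, v₁) of C for the eigenvalue c gives, in each degree d, a Jordan pair of r²Δ
    -- for c/2 + d(d+n-2). By semisimplicity every Taylor component of v₁ is zero, so v₁ is flat.
    have e1 : (v₁ : Sm n) = (smCoord n).casimir v - c • (v : Sm n) := by
      rw [eq_sub_iff_add_eq', ← hv]; rfl
    have e2 : (smCoord n).casimir (v₁ : Sm n) - c • (v₁ : Sm n) = 0 := sub_eq_zero.2 hv₁
    refine Subtype.ext (eq_zero_of_flat_of_mem hU hr v₁.2 fun d => ?_)
    have f1 := congrArg (taylorPart d) e1
    have f2 := congrArg (taylorPart d) e2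
    rw [map_sub, taylorPart_casimir, map_smul] at f1
    rw [map_sub, taylorPart_casimir, map_smul, map_zero] at f2
    have hz := r2lap_eq_of_sq hn d (taylorPart d (v : Sm n)) ((2 : ℂ)⁻¹ • taylorPart d (v₁ : Sm n))
      (c / 2 + d * (d + n - 2)) (isHomogeneous_taylorPart d _) (by rw [f1]; module) (by
        rw [map_smul]
        have : (polyCoord n).r2lap (taylorPart d (v₁ : Sm n)) =
          (c / 2 + d * (d + n - 2)) • taylorPart d (v₁ : Sm n) := by
          rw [← sub_eq_zero, ← smul_right_injective _ (two_ne_zero (α := ℂ)) |>.eq_iff]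
          rw [smul_zero, ← f2]
          module
        rw [this, smul_comm])
    exact (smul_eq_zero.1 hz).resolve_left (by norm_num)
  · intro c v hv
    by_cases h0 : (v : Sm n) = 0
    · rw [h0]; exact W.zero_mem
    obtain ⟨l, k, hlk, hm, h, hh, hg⟩ := exists_radVec hn hlam (hr v v.2) hv h0
      (hpar v v.2)
    rw [hg]
    exact hW l k hlk hm h hh

/-! ### The action of `K` -/

theorem hasDerivAt_theta {F : Fn n} (hF : ContDiff ℝ ∞ F) (θ : ℝ) (y : Eucl n) :
    HasDerivAt (fun t => F (t, y)) (dTheta F (θ, y)) θ :=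
  ((hF.differentiable (by simp)) (θ, y)).hasFDerivAt.comp_hasDerivAt θ
    ((hasDerivAt_id θ).prodMk (hasDerivAt_const θ y))

theorem kAct_apply (φ : ℝ) (u : OrthGroup n) (F : Fn n) (p : ℝ × Eucl n) :
    kAct φ u F p = F (p.1 - φ, u⁻¹ p.2) := rfl

theorem kAct_kAct (φ ψ : ℝ) (u v : OrthGroup n) (F : Fn n) :
    kAct φ u (kAct ψ v F) = kAct (φ + ψ) (u * v) F := by
  funext p
  rw [kAct_apply, kAct_apply, kAct_apply, mul_inv_rev, sub_sub]
  rfl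

theorem contDiff_kAct (φ : ℝ) (u : OrthGroup n) {F : Fn n} (hF : ContDiff ℝ ∞ F) :
    ContDiff ℝ ∞ (kAct φ u F) :=
  hF.comp ((contDiff_fst.sub contDiff_const).prodMk ((u⁻¹).contDiff.comp contDiff_snd))

theorem dTheta_kAct (φ : ℝ) (u : OrthGroup n) {F : Fn n} (hF : ContDiff ℝ ∞ F) :
    dTheta (kAct φ u F) = kAct φ u (dTheta F) := by
  funext p
  exact (hasDerivAt_theta (contDiff_kAct φ u hF) p.1 p.2).unique
    ((hasDerivAt_theta hF (p.1 - φ) (u⁻¹ p.2)).comp_sub_const p.1 φ)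

theorem lap_kAct (φ : ℝ) (u : OrthGroup n) {F : Fn n} (hF : ContDiff ℝ ∞ F) :
    lap (kAct φ u F) = kAct φ u (lap F) := by
  funext p
  exact laplacian_comp_orth u⁻¹ (hF.comp (contDiff_prodMk_right (p.1 - φ))) p.2

theorem omega_kAct (s : ℂ) (φ : ℝ) (u : OrthGroup n) {F : Fn n} (hF : ContDiff ℝ ∞ F) :
    omega s (kAct φ u F) = kAct φ u (omega s F) := by
  funext p
  rw [omega, dTheta_kAct φ u hF, lap_kAct φ u hF, kAct_apply, kAct_apply, kAct_apply, kAct_apply, omega]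
  simp only [(u⁻¹).norm_map]

theorem kAct_mem_compactPicture {q : ℤ} (φ : ℝ) (u : OrthGroup n) {F : Fn n}
    (hF : F ∈ compactPicture n q) : kAct φ u F ∈ compactPicture n q := by
  refine ⟨contDiff_kAct φ u hF.1, fun j θ y => ?_⟩
  rw [kAct_apply, kAct_apply, ← hF.2 j, map_smul]
  congr 2
  ring

/-- The span of the `K`-orbit of `F`. -/
def orbitSpan (F : Fn n) : Submodule ℂ (Fn n) :=
  Submodule.span ℂ (Set.range fun g : ℝ × OrthGroup n => kAct g.1 g.2 F)

theorem mem_orbitSpan (F : Fn n) : F ∈ orbitSpan F := by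
  refine Submodule.subset_span ⟨(0, 1), ?_⟩
  funext p
  change F (p.1 - 0, p.2) = F p
  rw [sub_zero]

theorem kAct_mem_orbitSpan (φ : ℝ) (u : OrthGroup n) {F G : Fn n} (hG : G ∈ orbitSpan F) :
    kAct φ u G ∈ orbitSpan F := by
  have : orbitSpan F ≤ (orbitSpan F).comap (kAct φ u) := by
    refine Submodule.span_le.2 ?_
    rintro _ ⟨g, rfl⟩
    change kAct φ u (kAct g.1 g.2 F) ∈ orbitSpan F
    rw [kAct_kAct]
    exact Submodule.subset_span ⟨(φ + g.1, u * g.2), rfl⟩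
  exact this hG

theorem orbitSpan_le_kerK {q lam : ℤ} {s : ℂ} {F : Fn n} (hF : F ∈ kerK n q s lam) :
    orbitSpan F ≤ kerK n q s lam := by
  have hfin : FiniteDimensional ℂ (orbitSpan F) := hF.2.2
  refine Submodule.span_le.2 ?_
  rintro _ ⟨g, rfl⟩
  refine ⟨kAct_mem_compactPicture _ _ hF.1, ?_, ?_⟩
  · rw [omega_kAct s _ _ hF.1.1, hF.2.1, map_smul]
  · refine Submodule.finiteDimensional_of_le (S₂ := orbitSpan F) (Submodule.span_le.2 ?_)
    rintro _ ⟨g', rfl⟩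
    exact kAct_mem_orbitSpan _ _ (Submodule.subset_span ⟨g, rfl⟩)

/-- ∂_θ G is the pointwise derivative at t = 0 of the translates G(θ + t, y), which stay in the
span. -/
theorem dTheta_mem_orbitSpan {F G : Fn n} [FiniteDimensional ℂ (orbitSpan F)] (hG : G ∈ orbitSpan F)
    (hGs : ContDiff ℝ ∞ G) : dTheta G ∈ orbitSpan F := by
  refine deriv_mem_of_finiteDimensional (orbitSpan F) (G := fun t => kAct (-t) 1 G)
    (fun t => kAct_mem_orbitSpan _ _ hG) fun p => ?_
  have h := (hasDerivAt_theta hGs (p.1 + 0) p.2)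
  have h2 := HasDerivAt.comp_const_add p.1 0 h
  rw [add_zero] at h2
  refine h2.congr_of_eventuallyEq (Filter.Eventually.of_forall fun t => ?_)
  change G (p.1 - -t, _) = G (p.1 + t, p.2)
  rw [sub_neg_eq_add]
  rfl

/-! ### Eigenfunctions of `∂_θ` -/

theorem hasDerivAt_exp_neg_mul {F : Fn n} (hF : ContDiff ℝ ∞ F) (μ : ℂ) (θ : ℝ) (y : Eucl n) :
    HasDerivAt (fun t : ℝ => Complex.exp (-μ * t) * F (t, y))
      (Complex.exp (-μ * θ) * (dTheta F (θ, y) - μ * F (θ, y))) θ := by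
  have h1 : HasDerivAt (fun t : ℝ => -μ * (t : ℂ)) (-μ) θ := by
    simpa using (Complex.ofRealCLM.hasDerivAt (x := θ)).const_mul (-μ)
  refine (h1.cexp.mul (hasDerivAt_theta hF θ y)).congr_deriv ?_
  ring

theorem eq_exp_mul_of_dTheta {F : Fn n} (hF : ContDiff ℝ ∞ F) {μ : ℂ} (h : dTheta F = μ • F)
    (θ : ℝ) (y : Eucl n) : F (θ, y) = Complex.exp (μ * θ) * F (0, y) := by
  have hd : ∀ t, HasDerivAt (fun t : ℝ => Complex.exp (-μ * t) * F (t, y)) 0 t := fun t => by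
    refine (hasDerivAt_exp_neg_mul hF μ t y).congr_deriv ?_
    rw [h]; simp
  have hc := is_const_of_deriv_eq_zero (fun t => (hd t).differentiableAt) (fun t => (hd t).deriv) θ 0
  simp only [Complex.ofReal_zero, mul_zero, Complex.exp_zero, one_mul] at hc
  rw [← hc, ← mul_assoc, ← Complex.exp_add]
  simp

theorem compactPicture_periodic {q : ℤ} {F : Fn n} (hF : F ∈ compactPicture n q) (y : Eucl n) :
    F (4 * Real.pi, y) = F (0, y) := by
  -- For j = 4 both the sign of y and the factor i^{-jq} become trivial.
  have h := hF.2 4 0 y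
  have h4 : Complex.I ^ (-(4 * q)) = 1 := by
    rw [← mul_neg, zpow_mul]
    have : Complex.I ^ (4 : ℤ) = 1 := by exact_mod_cast Complex.I_pow_four
    rw [this, one_zpow]
  rw [h4, one_mul] at h
  have h1 : (-1 : ℝ) ^ (4 : ℤ) = 1 := by norm_num
  rw [h1, one_smul] at h
  simpa using h

/-- A Jordan chain of ∂_θ would create a secular term t e^{μt}, which is incompatible with the
period 4π. -/
theorem eq_zero_of_generalized {q : ℤ} {F G : Fn n} (hF : F ∈ compactPicture n q)
    (hG : G ∈ compactPicture n q) {μ : ℂ} (h1 : dTheta F = μ • F + G) (h2 : dTheta G = μ • G) :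
    G = 0 := by
  have hz : ∀ y, G (0, y) = 0 := fun y => by
    by_contra h0
    have hGe := eq_exp_mul_of_dTheta hG.1 h2 (4 * Real.pi) y
    rw [compactPicture_periodic hG] at hGe
    have hexp : Complex.exp (μ * ((4 * Real.pi : ℝ) : ℂ)) = 1 := by
      refine mul_right_cancel₀ h0 ?_
      rw [← hGe, one_mul]
    -- This function is constant in t. Its values at 0 and 4π differ by 4π G(0, y), because e^{4πμ}
    -- = 1.
    have hd : ∀ t : ℝ, HasDerivAt
        (fun t : ℝ => Complex.exp (-μ * t) * F (t, y) - (t : ℂ) * G (0, y)) 0 t := fun t => by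
      have e1 : HasDerivAt (fun t : ℝ => (t : ℂ) * G (0, y)) (1 * G (0, y)) t := by
        simpa using (Complex.ofRealCLM.hasDerivAt (x := t)).mul_const (G (0, y))
      refine ((hasDerivAt_exp_neg_mul hF.1 μ t y).sub e1).congr_deriv ?_
      rw [h1, Pi.add_apply, Pi.smul_apply, smul_eq_mul, add_sub_cancel_left,
        eq_exp_mul_of_dTheta hG.1 h2 t y, ← mul_assoc, ← Complex.exp_add]
      simp
    have hc := is_const_of_deriv_eq_zero (fun t => (hd t).differentiableAt) (fun t => (hd t).deriv)
      (4 * Real.pi) 0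
    rw [compactPicture_periodic hF, neg_mul, Complex.exp_neg, hexp] at hc
    have : ((4 * Real.pi : ℝ) : ℂ) * G (0, y) = 0 := by
      simpa using hc
    rcases mul_eq_zero.1 this with h | h
    · exact (by positivity : (4 * Real.pi : ℝ) ≠ 0) (Complex.ofReal_eq_zero.1 h)
    · exact h0 h
  funext p
  have := eq_exp_mul_of_dTheta hG.1 h2 p.1 p.2
  rw [hz, mul_zero] at this
  exact this

/-- The period 4π forces μ = iN/2 with N an integer, which gives the weight m = -N. -/
theorem exists_sep_of_dTheta {q : ℤ} {F : Fn n} (hF : F ∈ compactPicture n q) {μ : ℂ}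
    (h : dTheta F = μ • F) : ∃ (m : ℤ) (g : Sm n), F = sep n m g := by
  by_cases h0 : ∀ y, F (0, y) = 0
  · refine ⟨0, 0, ?_⟩
    funext p
    have := eq_exp_mul_of_dTheta hF.1 h p.1 p.2
    rw [h0, mul_zero] at this
    rw [map_zero]
    exact this
  push Not at h0
  obtain ⟨y, hy⟩ := h0
  have he := eq_exp_mul_of_dTheta hF.1 h (4 * Real.pi) y
  rw [compactPicture_periodic hF] at he
  have hexp : Complex.exp (μ * ((4 * Real.pi : ℝ) : ℂ)) = 1 := by
    refine mul_right_cancel₀ hy ?_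
    rw [← he, one_mul]
  obtain ⟨N, hN⟩ := Complex.exp_eq_one_iff.1 hexp
  have hμ : μ = Complex.I * N / 2 := by
    have hpi : (Real.pi : ℂ) ≠ 0 := Complex.ofReal_ne_zero.2 Real.pi_ne_zero
    push_cast at hN
    refine mul_right_cancel₀ (mul_ne_zero (by norm_num : (4 : ℂ) ≠ 0) hpi) ?_
    rw [hN]; ring
  refine ⟨-N, ⟨fun y => F (0, y), show ContDiff ℝ ∞ _ from hF.1.comp (contDiff_prodMk_right 0)⟩, ?_⟩
  funext p
  rw [sep_apply, show F p = F (p.1, p.2) from rfl, eq_exp_mul_of_dTheta hF.1 h p.1 p.2, hμ]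
  push_cast
  congr 2
  ring

theorem neg_of_sep_mem_compactPicture {q m : ℤ} {g : Sm n} (h : sep n m g ∈ compactPicture n q)
    (y : Eucl n) : (g : Eucl n → ℂ) (-y) = Complex.I ^ (m - q) * (g : Eucl n → ℂ) y := by
  have h1 := h.2 1 0 y
  rw [sep_apply, sep_apply, zpow_one, neg_one_smul] at h1
  have h2 := exp_quarter m 1
  rw [one_mul] at h2
  simp only [Int.cast_one, zero_add, one_mul, Complex.ofReal_zero, mul_zero, zero_div, Complex.exp_zero]
    at h1 h2
  rw [h2] at h1
  rw [sub_eq_add_neg, zpow_add₀ Complex.I_ne_zero, mul_assoc, ← h1, ← mul_assoc,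
    ← zpow_add₀ Complex.I_ne_zero]
  simp

/-! ### The kernel as a sum of the modules `H_{l,k}` -/

/-- Diagonalizes twice inside the orbit span: first ∂_θ, which yields weights, then the Casimir
operator on the y-factors of one weight. -/
theorem kerK_le_iSup (hn : 1 ≤ n) (q : ℤ) (s : ℂ) {lam : ℤ} (hlam : IsAdmissible n lam) :
    kerK n q s lam ≤
      ⨆ p : {p : ℕ × ℕ // IsAdmissiblePair n lam p.1 p.2}, modH n q s p.1.1 p.1.2 := by
  intro F hF
  set W := ⨆ p : {p : ℕ × ℕ // IsAdmissiblePair n lam p.1 p.2}, modH n q s p.1.1 p.1.2 with hW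
  have hfin : FiniteDimensional ℂ (orbitSpan F) := hF.2.2
  have hker := orbitSpan_le_kerK hF
  have hsm : ∀ G ∈ orbitSpan F, ContDiff ℝ ∞ G := fun G hG => (hker hG).1.1
  let T : orbitSpan F →ₗ[ℂ] Fn n :=
    { toFun := fun v => dTheta v
      map_add' := fun v w => smoothLinear_dTheta.add _ _ (hsm v v.2) (hsm w w.2)
      map_smul' := fun c v => smoothLinear_dTheta.smul c _ (hsm v v.2) }
  refine le_of_eigenvectors_mem (V := orbitSpan F) (W := W) T
    (fun v => dTheta_mem_orbitSpan v.2 (hsm v v.2)) (fun μ v w hv hw => ?_) (fun μ v hv => ?_)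
    (mem_orbitSpan F)
  · exact Subtype.ext (eq_zero_of_generalized (hker v.2).1 (hker w.2).1 hv hw)
  · obtain ⟨m, g, hg⟩ := exists_sep_of_dTheta (hker v.2).1 hv
    -- The y-factors of weight m in the orbit span form a finite-dimensional O(n)-stable space,
    -- because `sep` is injective.
    have hfin' : FiniteDimensional ℂ ((orbitSpan F).comap (sep n m)) := by
      refine FiniteDimensional.of_injective
        ((sep n m).restrict (p := (orbitSpan F).comap (sep n m)) (q := orbitSpan F) fun _ h => h) ?_
      intro a b hab
      exact Subtype.ext (sep_injective m (congrArg Subtype.val hab))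
    have hle := le_of_radVec_mem hn (U := (orbitSpan F).comap (sep n m)) (W := W.comap (sep n m))
      (q := q) (s := s) (m := m) ?_ hlam ?_ ?_ ?_
    · rw [hg]
      exact hle (show sep n m g ∈ orbitSpan F from hg ▸ v.2)
    · intro u f hf
      change sep n m (smComp u f) ∈ orbitSpan F
      have := kAct_sep m 0 u⁻¹ f
      simp only [Complex.ofReal_zero, mul_zero, zero_div, Complex.exp_zero, one_smul, inv_inv] at this
      rw [← this]
      exact kAct_mem_orbitSpan _ _ hf
    · intro f hf
      have := (hker hf).2.1
      rw [omega_sep, ← map_smul] at this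
      exact sep_injective m this
    · intro f hf
      exact neg_of_sep_mem_compactPicture (hker hf).1
    · intro l k hlk hm h hh
      change sep n m _ ∈ W
      rw [← vec_eq_sep hn]
      exact (le_iSup (fun p : {p : ℕ × ℕ // IsAdmissiblePair n lam p.1 p.2} =>
        modH n q s p.1.1 p.1.2) ⟨(l, k), hlk⟩) (vec_mem_vecSpan s l (Set.mem_univ m) hm hh)

theorem kerK_eq_iSup (hn : 1 ≤ n) (q : ℤ) (s : ℂ) {lam : ℤ} (hlam : IsAdmissible n lam) :
    kerK n q s lam =
      ⨆ p : {p : ℕ × ℕ // IsAdmissiblePair n lam p.1 p.2}, modH n q s p.1.1 p.1.2 :=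
  le_antisymm (kerK_le_iSup hn q s hlam)
    (iSup_le fun p => vecSpan_le_kerK hn q s Set.univ p.2.1)

theorem IsSubrep.iSup {ι : Sort*} {q : ℤ} {s : ℂ} {W : ι → Submodule ℂ (Fn n)}
    (h : ∀ i, IsSubrep n q s (W i)) : IsSubrep n q s (⨆ i, W i) := by
  have hle : ∀ i, W i ≤ ⨆ i, W i := le_iSup W
  have key : ∀ T : Fn n → Fn n, SmoothLinear T → (∀ i, ∀ F ∈ W i, T F ∈ W i) →
      ∀ F ∈ ⨆ i, W i, T F ∈ ⨆ i, W i := by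
    intro T hT hW
    rw [Submodule.iSup_eq_span]
    refine hT.mem_of_span ?_ ?_
    · intro F hF
      obtain ⟨i, hi⟩ := Set.mem_iUnion.1 hF
      exact ((h i).le hi).1
    · intro F hF
      obtain ⟨i, hi⟩ := Set.mem_iUnion.1 hF
      exact Submodule.subset_span (Set.mem_iUnion.2 ⟨i, hW i F hi⟩)
  refine ⟨iSup_le fun i => (h i).le, key _ smoothLinear_kappa fun i => (h i).kappa_mem,
    key _ (smoothLinear_etaPlus s) fun i => (h i).etaPlus_mem,
    key _ (smoothLinear_etaMinus s) fun i => (h i).etaMinus_mem, fun u => ?_⟩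
  have : ⨆ i, W i ≤ (⨆ i, W i).comap (kAct 0 u) :=
    iSup_le fun i F hF => hle i ((h i).orth_mem u F hF)
  exact this

theorem isSubrep_modH (hn : 1 ≤ n) (q : ℤ) (s : ℂ) (l k : ℕ) : IsSubrep n q s (modH n q s l k) :=
  isSubrep_vecSpan hn q s l k Set.univ (fun _ _ _ _ => trivial) (fun _ _ _ _ => trivial)

/-- Stability follows from the decomposition into the H_{l,k}, so no commutator of Ω'' with η^± has
to be computed. -/
theorem isSubrep_kerK (hn : 1 ≤ n) (q : ℤ) (s : ℂ) {lam : ℤ} (hlam : IsAdmissible n lam) :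
    IsSubrep n q s (kerK n q s lam) := by
  rw [kerK_eq_iSup hn q s hlam]
  exact IsSubrep.iSup fun p => isSubrep_modH hn q s _ _

/-! ### Zonal harmonic polynomials -/

/-- `g` is invariant under the stabilizer of the basis vector `e i₀` in `O(n)`. -/
def IsZonal (i₀ : Fin n) (g : Sm n) : Prop :=
  ∀ u : OrthGroup n, u (EuclideanSpace.single i₀ 1) = EuclideanSpace.single i₀ 1 → smComp u g = g

theorem pd_smComp (u : OrthGroup n) {i : Fin n}
    (hu : u (EuclideanSpace.single i 1) = EuclideanSpace.single i 1) (g : Sm n) :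
    pd i (smComp u g) = smComp u (pd i g) := by
  ext y
  rw [smComp_apply, pd_apply, pd_apply]
  have h : HasFDerivAt (fun y => (g : Eucl n → ℂ) (u y))
      ((fderiv ℝ (g : Eucl n → ℂ) (u y)).comp (u : Eucl n →L[ℝ] Eucl n)) y :=
    (differentiable_coe g (u y)).hasFDerivAt.comp y (u : Eucl n →L[ℝ] Eucl n).hasFDerivAt
  have h2 : fderiv ℝ (smComp u g : Eucl n → ℂ) y = _ := h.fderiv
  rw [h2]
  change fderiv ℝ (g : Eucl n → ℂ) (u y) (u (EuclideanSpace.single i 1)) = _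
  rw [hu]

theorem IsZonal.pd {i₀ : Fin n} {g : Sm n} (hg : IsZonal i₀ g) : IsZonal i₀ (pd i₀ g) :=
  fun u hu => by rw [← pd_smComp u hu, hg u hu]

/-- The plane rotations away from the pole direction belong to the stabilizer of the pole;
differentiating their action gives zero. -/
theorem IsZonal.rot {i₀ : Fin n} {g : Sm n} (hg : IsZonal i₀ g) {i j : Fin n} (hi : i ≠ i₀)
    (hj : j ≠ i₀) : (smCoord n).rot i j g = 0 := by
  by_cases hij : i = j
  · rw [hij, CoordSystem.rot_apply, sub_self]
  ext y
  have h := hasDerivAt_planeRot hij g y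
  have hc : (fun t => (g : Eucl n → ℂ) (planeRot hij t y)) = fun _ => (g : Eucl n → ℂ) y := by
    funext t
    have := hg (planeRot hij t) (by simp [planeRot_apply, hi, hj])
    rw [← smComp_apply, this]
  rw [hc] at h
  exact h.unique (hasDerivAt_const _ _)

theorem ev_rot (i j : Fin n) (P : MvPolynomial (Fin n) ℂ) :
    (smCoord n).rot i j (ev P) = ev ((polyCoord n).rot i j P) := by
  have hX : ∀ i, ev (MvPolynomial.X i) = (coord i : Sm n) := fun i => by simp [ev]
  rw [CoordSystem.rot_apply, CoordSystem.rot_apply, map_sub, map_mul, map_mul]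
  change coord i * pd j (ev P) - coord j * pd i (ev P) =
    ev (MvPolynomial.X i) * ev (MvPolynomial.pderiv j P) -
      ev (MvPolynomial.X j) * ev (MvPolynomial.pderiv i P)
  rw [hX, hX, pd_ev, pd_ev]

theorem ev_pderiv_single {N : ℕ} {P : MvPolynomial (Fin n) ℂ} (hP : P.IsHomogeneous N) (i : Fin n) :
    (ev (MvPolynomial.pderiv i P) : Eucl n → ℂ) (EuclideanSpace.single i 1) =
      N * (ev P : Eucl n → ℂ) (EuclideanSpace.single i 1) := by
  have h := congrFun (congrArg Subtype.val (E_ev hP)) (EuclideanSpace.single i 1)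
  rw [smCoord_E_apply, ← pd_apply, pd_ev] at h
  exact h

theorem eq_zero_of_pderiv {N : ℕ} (hN : N ≠ 0) {P : MvPolynomial (Fin n) ℂ} (hP : P.IsHomogeneous N)
    (h : ∀ i, MvPolynomial.pderiv i P = 0) : P = 0 := by
  have hE := polyCoord_E hP
  rw [CoordSystem.E_apply, Finset.sum_eq_zero fun i _ => ?_] at hE
  · exact (smul_eq_zero.1 hE.symm).resolve_left (Nat.cast_ne_zero.2 hN)
  · change MvPolynomial.X i * MvPolynomial.pderiv i P = 0
    rw [h, mul_zero]

theorem eq_zero_of_isHomogeneous_zero {P : MvPolynomial (Fin n) ℂ} (hP : P.IsHomogeneous 0)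
    {y : Eucl n} (h : (ev P : Eucl n → ℂ) y = 0) : P = 0 := by
  have h2 := hP.totalDegree_le
  rw [Nat.le_zero, MvPolynomial.totalDegree_eq_zero_iff_eq_C] at h2
  rw [h2, ev_apply, MvPolynomial.eval_C] at h
  rw [h2, h, map_zero]

/-- Apply ∂ᵢ to xᵢ∂ⱼa - xⱼ∂ᵢa, which is zero except for i = i₀, and sum over i. The second
derivatives give E∂ⱼa and xⱼΔa = 0, and the first order terms give n∂ⱼa - 2∂ⱼa. -/
theorem CoordSystem.E_d_of_rot {A : Type*} [CommRing A] [Algebra ℂ A] (S : CoordSystem n A)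
    {i₀ j : Fin n} {a : A} (h0 : S.d i₀ a = 0) (hlap : S.lap a = 0)
    (hrot : ∀ i, i ≠ i₀ → S.rot i j a = 0) : S.E (S.d j a) + n * S.d j a = 2 * S.d j a := by
  have hr : ∀ i, S.x i * S.d j a - S.x j * S.d i a = if i = i₀ then S.x i₀ * S.d j a else 0 := by
    intro i
    by_cases hi : i = i₀
    · rw [if_pos hi, hi, h0, mul_zero, sub_zero]
    · rw [if_neg hi, ← S.rot_apply, hrot i hi]
  have hterm : ∀ i, S.x i * S.d i (S.d j a) + S.d j a =
      (if i = j then S.d j a else 0) + S.x j * S.d i (S.d i a) +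
        if i = i₀ then S.d j a else 0 := by
    intro i
    have h1 := congrArg (S.d i) (hr i)
    have h2 : S.d i (if i = i₀ then S.x i₀ * S.d j a else 0) = if i = i₀ then S.d j a else 0 := by
      by_cases hi : i = i₀
      · rw [if_pos hi, if_pos hi, hi, Derivation.leibniz, S.d_x, if_pos rfl, S.comm, h0, map_zero]
        simp
      · rw [if_neg hi, if_neg hi, map_zero]
    rw [h2, map_sub, Derivation.leibniz, Derivation.leibniz, S.d_x, S.d_x, if_pos rfl] at h1
    rw [← h1]
    by_cases hij : i = j
    · subst hij
      simp
      ring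
    · simp [hij]
  have e := Finset.sum_congr (rfl : (Finset.univ : Finset (Fin n)) = Finset.univ) fun i _ => hterm i
  simp only [Finset.sum_add_distrib, Finset.sum_ite_eq', Finset.mem_univ, if_true] at e
  rw [← Finset.mul_sum, ← S.lap_apply, hlap, ← S.E_apply, Finset.sum_const, Finset.card_univ,
    Fintype.card_fin, nsmul_eq_mul] at e
  rw [e]
  ring

/-- A harmonic polynomial that does not depend on `y i₀` and is killed by the infinitesimal rotations
of the other variables is constant. -/
theorem pderiv_eq_zero_of_rot {k : ℕ} {i₀ : Fin n} {h : MvPolynomial (Fin n) ℂ}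
    (hh : h ∈ harmonicPoly n k) (h0 : MvPolynomial.pderiv i₀ h = 0)
    (hrot : ∀ i j, i ≠ i₀ → j ≠ i₀ → (polyCoord n).rot i j h = 0) (hk : n + k ≠ 3) (hk1 : 1 ≤ k)
    {j : Fin n} (hj : j ≠ i₀) : MvPolynomial.pderiv j h = 0 := by
  have e := (polyCoord n).E_d_of_rot h0 (mem_harmonicPoly.1 hh).2 fun i hi => hrot i j hi hj
  have hE : (polyCoord n).E ((polyCoord n).d j h) = _ := polyCoord_E (hh.1.pderiv (i := j))
  rw [hE] at e
  change ((k - 1 : ℕ) : ℂ) • MvPolynomial.pderiv j h + n * MvPolynomial.pderiv j h =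
    2 * MvPolynomial.pderiv j h at e
  -- As ∂ⱼh has degree k - 1, the relation becomes (n + k - 3) ∂ⱼh = 0.
  have hz : (((n + (k - 1) : ℕ) : ℂ) - ((2 : ℕ) : ℂ)) • MvPolynomial.pderiv j h = 0 := by
    rw [sub_smul, Nat.cast_add, add_smul, add_comm, Nat.cast_smul_eq_nsmul ℂ n,
      Nat.cast_smul_eq_nsmul ℂ 2, nsmul_eq_mul, nsmul_eq_mul, e, sub_eq_zero]
    push_cast
    rfl
  refine (smul_eq_zero.1 hz).resolve_left fun hc => hk ?_
  have := Nat.cast_injective (sub_eq_zero.1 hc)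
  omega

/-- A zonal harmonic polynomial that vanishes at the pole is zero. -/
theorem eq_zero_of_isZonal {i₀ : Fin n} {k : ℕ} : ∀ {h : MvPolynomial (Fin n) ℂ},
    h ∈ harmonicPoly n k → IsZonal i₀ (ev h) →
    (ev h : Eucl n → ℂ) (EuclideanSpace.single i₀ 1) = 0 → h = 0 := by
  induction k with
  | zero =>
    intro h hh _ h0
    exact eq_zero_of_isHomogeneous_zero hh.1 h0
  | succ k ih =>
    intro h hh hz h0
    -- The derivative along the pole is again harmonic and zonal, and by Euler's identity it
    -- vanishes at the pole together with h.
    have hp : MvPolynomial.pderiv i₀ h = 0 := by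
      refine ih (mem_harmonicPoly.2 ⟨hh.1.pderiv, ?_⟩) ?_ ?_
      · have h2 := (mem_harmonicPoly.1 hh).2
        rw [CoordSystem.lap_apply] at h2 ⊢
        have h3 := congrArg (MvPolynomial.pderiv i₀) h2
        rw [map_sum, map_zero] at h3
        rw [← h3]
        refine Finset.sum_congr rfl fun i _ => ?_
        change (polyCoord n).d i ((polyCoord n).d i ((polyCoord n).d i₀ h)) =
          (polyCoord n).d i₀ ((polyCoord n).d i ((polyCoord n).d i h))
        rw [(polyCoord n).comm i i₀, (polyCoord n).comm i i₀]
      · rw [← pd_ev]; exact hz.pd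
      · rw [ev_pderiv_single hh.1, h0, mul_zero]
    refine eq_zero_of_pderiv k.succ_ne_zero hh.1 fun j => ?_
    by_cases hj : j = i₀
    · rw [hj, hp]
    -- Degree one is treated apart: for n = 2 it is the excluded case n + k = 3 of
    -- `pderiv_eq_zero_of_rot`. The reflection eⱼ ↦ -eⱼ fixes the pole and makes h(eⱼ) = 0.
    by_cases hk : k = 0
    · subst hk
      refine eq_zero_of_isHomogeneous_zero (hh.1.pderiv (i := j)) (y := EuclideanSpace.single j 1) ?_
      rw [ev_pderiv_single hh.1]
      have h1 := hz (ℝ ∙ (EuclideanSpace.single j (1 : ℝ) : Eucl n))ᗮ.reflection (by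
        refine Submodule.reflection_mem_subspace_eq_self ?_
        rw [Submodule.mem_orthogonal_singleton_iff_inner_right, EuclideanSpace.inner_single_left]
        simp [hj])
      have h2 := congrFun (congrArg Subtype.val h1) (EuclideanSpace.single j 1)
      rw [smComp_apply, Submodule.reflection_orthogonalComplement_singleton_eq_neg] at h2
      have h3 := ev_smul_apply hh.1 (-1) (EuclideanSpace.single j 1)
      rw [neg_one_smul, h2] at h3
      have h4 : (ev h : Eucl n → ℂ) (EuclideanSpace.single j 1) = 0 := by
        push_cast at h3
        linear_combination h3 / 2
      rw [h4, mul_zero]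
    · refine pderiv_eq_zero_of_rot hh hp (fun i j hi hj => ?_) ?_ (by omega) hj
      · apply ev_injective
        rw [← ev_rot, hz.rot hi hj, map_zero]
      · have h1 := i₀.2
        have h2 := j.2
        have h3 : (j : ℕ) ≠ i₀ := fun h => hj (Fin.ext h)
        omega

/-! ### Irreducibility of `𝓗_k(ℝⁿ)` -/

/-- An isometric action is irreducible if no nonzero invariant subspace is killed by a functional `ε`
and the only vector invariant under the symmetries of `ε` on which `ε` vanishes is zero. -/
theorem eq_top_of_isometric {V Γ : Type*} [NormedAddCommGroup V] [InnerProductSpace ℂ V]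
    [FiniteDimensional ℂ V] [Group Γ] (ρ : Γ → V →ₗ[ℂ] V)
    (hρ : ∀ u x y, inner ℂ (ρ u x) y = inner ℂ x (ρ u⁻¹ y)) (ε : V →ₗ[ℂ] ℂ) (Z : Subgroup Γ)
    (hε : ∀ u ∈ Z, ∀ x, ε (ρ u x) = ε x)
    (hzonal : ∀ z, (∀ u ∈ Z, ρ u z = z) → ε z = 0 → z = 0)
    (hvanish : ∀ W : Submodule ℂ V, (∀ u, ∀ w ∈ W, ρ u w ∈ W) → (∀ w ∈ W, ε w = 0) → W = ⊥)
    {W : Submodule ℂ V} (hW : ∀ u, ∀ w ∈ W, ρ u w ∈ W) (hW0 : W ≠ ⊥) : W = ⊤ := by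
  have key : ∀ W : Submodule ℂ V, (∀ u, ∀ w ∈ W, ρ u w ∈ W) → W ≠ ⊥ →
      ∃ z ∈ W, (∀ u ∈ Z, ρ u z = z) ∧ ε z ≠ 0 := by
    intro W hW hW0
    -- The Riesz representative of ε on W inherits the symmetries of ε, and ε(z) = |z|².
    set z : W := (InnerProductSpace.toDual ℂ W).symm
      (LinearMap.toContinuousLinearMap (ε ∘ₗ W.subtype)) with hz
    have hzw : ∀ w ∈ W, inner ℂ (z : V) w = ε w := fun w hw =>
      InnerProductSpace.toDual_symm_apply (𝕜 := ℂ) (E := W) (x := ⟨w, hw⟩)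
    refine ⟨z, z.2, fun u hu => ?_, fun h0 => hW0 (hvanish W hW fun w hw => ?_)⟩
    · have hd : ρ u z - z ∈ W := W.sub_mem (hW u z z.2) z.2
      rw [← sub_eq_zero, ← inner_self_eq_zero (𝕜 := ℂ), inner_sub_left, hρ, hzw _ hd,
        hzw _ (hW _ _ hd), hε _ (Z.inv_mem hu), sub_self]
    · rw [← hzw z z.2, inner_self_eq_zero] at h0
      rw [← hzw w hw, h0, inner_zero_left]
  by_contra hne
  have hO : Wᗮ ≠ ⊥ := fun h => hne (Submodule.orthogonal_eq_bot_iff.1 h)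
  obtain ⟨z₁, hz₁, hi₁, he₁⟩ := key W hW hW0
  obtain ⟨z₂, hz₂, hi₂, he₂⟩ := key Wᗮ (fun u w hw => by
    rw [Submodule.mem_orthogonal'] at hw ⊢
    intro v hv
    rw [hρ]
    exact hw _ (hW _ _ hv)) hO
  -- If W were proper, both W and its orthogonal complement would contain such a vector. This
  -- combination is invariant and killed by ε, so the two vectors would be proportional and yet
  -- orthogonal.
  have h0 := hzonal (ε z₂ • z₁ - ε z₁ • z₂)
    (fun u hu => by rw [map_sub, map_smul, map_smul, hi₁ u hu, hi₂ u hu])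
    (by simp [mul_comm])
  have h1 : ε z₂ • z₁ ∈ Wᗮ := by
    rw [sub_eq_zero.1 h0]
    exact Wᗮ.smul_mem _ hz₂
  have h2 : ε z₂ • z₁ = 0 := by
    have := Submodule.inner_right_of_mem_orthogonal (W.smul_mem (ε z₂) hz₁) h1
    exact inner_self_eq_zero.1 this
  rcases smul_eq_zero.1 h2 with h | h
  · exact he₂ h
  · exact he₁ (by rw [h, map_zero])

/-- The inner product of `L²` of the unit ball. -/
def ballInner (f g : Sm n) : ℂ :=
  ∫ y in Metric.ball (0 : Eucl n) 1, (starRingEnd ℂ) ((f : Eucl n → ℂ) y) * (g : Eucl n → ℂ) y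

theorem integrableOn_ballInner (f g : Sm n) : MeasureTheory.IntegrableOn
    (fun y => (starRingEnd ℂ) ((f : Eucl n → ℂ) y) * (g : Eucl n → ℂ) y)
    (Metric.ball (0 : Eucl n) 1) := by
  have hc : Continuous fun y => (starRingEnd ℂ) ((f : Eucl n → ℂ) y) * (g : Eucl n → ℂ) y :=
    (Complex.continuous_conj.comp (contDiff_coe f).continuous).mul (contDiff_coe g).continuous
  exact (hc.continuousOn.integrableOn_compact (isCompact_closedBall (0 : Eucl n) 1)).mono_set
    Metric.ball_subset_closedBall

theorem ballInner_conj (f g : Sm n) : (starRingEnd ℂ) (ballInner g f) = ballInner f g := by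
  rw [ballInner, ballInner, ← integral_conj]
  congr 1
  funext y
  simp [mul_comm]

theorem ballInner_add_left (f g h : Sm n) :
    ballInner (f + g) h = ballInner f h + ballInner g h := by
  rw [ballInner, ballInner, ballInner,
    ← MeasureTheory.integral_add (integrableOn_ballInner f h) (integrableOn_ballInner g h)]
  congr 1
  funext y
  simp [add_mul]

theorem ballInner_smul_left (c : ℂ) (f g : Sm n) :
    ballInner (c • f) g = (starRingEnd ℂ) c * ballInner f g := by
  rw [ballInner, ballInner, ← MeasureTheory.integral_const_mul]
  congr 1
  funext y
  simp [mul_assoc]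

theorem ballInner_self (f : Sm n) : ballInner f f =
    ((∫ y in Metric.ball (0 : Eucl n) 1, ‖(f : Eucl n → ℂ) y‖ ^ 2 : ℝ) : ℂ) := by
  rw [ballInner, ← integral_complex_ofReal]
  congr 1
  funext y
  rw [Complex.conj_mul']
  push_cast
  rfl

theorem eq_zero_of_ballInner_self {f : Sm n} (h : ballInner f f = 0) {y : Eucl n} (hy : ‖y‖ < 1) :
    (f : Eucl n → ℂ) y = 0 := by
  have hf := (contDiff_coe f).continuous
  rw [ballInner_self, Complex.ofReal_eq_zero, MeasureTheory.integral_eq_zero_iff_of_nonneg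
    (fun y => by positivity)] at h
  · have := MeasureTheory.Measure.eqOn_open_of_ae_eq h Metric.isOpen_ball
      (hf.norm.pow 2).continuousOn continuousOn_const (mem_ball_zero_iff.2 hy)
    simpa using this
  · exact ((hf.norm.pow 2).continuousOn.integrableOn_compact
      (isCompact_closedBall (0 : Eucl n) 1)).mono_set Metric.ball_subset_closedBall

theorem ballInner_smComp (u : OrthGroup n) (f g : Sm n) :
    ballInner (smComp u f) (smComp u g) = ballInner f g := by
  have h := u.measurePreserving.setIntegral_preimage_emb u.toHomeomorph.measurableEmbedding
    (fun y => (starRingEnd ℂ) ((f : Eucl n → ℂ) y) * (g : Eucl n → ℂ) y) (Metric.ball 0 1)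
  rw [LinearIsometryEquiv.preimage_ball, map_zero] at h
  exact h

/-- By homogeneity every point can be scaled into the open unit ball. -/
theorem eq_zero_of_vanish_ball {k : ℕ} {P : MvPolynomial (Fin n) ℂ} (hP : P.IsHomogeneous k)
    (h : ∀ y : Eucl n, ‖y‖ < 1 → (ev P : Eucl n → ℂ) y = 0) : P = 0 := by
  apply ev_injective
  rw [map_zero]
  ext y
  have hpos : 0 < ‖y‖ + 1 := by positivity
  have h1 := ev_smul_apply hP (‖y‖ + 1)⁻¹ y
  rw [h _ (by
    rw [norm_smul, norm_inv, Real.norm_of_nonneg hpos.le, inv_mul_lt_iff₀ hpos]; linarith)] at h1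
  refine (mul_eq_zero.1 h1.symm).resolve_left (pow_ne_zero _ ?_)
  rw [Complex.ofReal_ne_zero]
  exact inv_ne_zero hpos.ne'

theorem smComp_smComp (u v : OrthGroup n) (g : Sm n) : smComp u (smComp v g) = smComp (v * u) g := rfl

theorem polyComp_polyComp (u v : OrthGroup n) (P : MvPolynomial (Fin n) ℂ) :
    polyComp u (polyComp v P) = polyComp (v * u) P := by
  apply ev_injective
  rw [ev_polyComp, ev_polyComp, ev_polyComp, smComp_smComp]

theorem polyComp_one (P : MvPolynomial (Fin n) ℂ) : polyComp 1 P = P := by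
  apply ev_injective
  rw [ev_polyComp]
  rfl

/-- The inner product on `𝓗_k(ℝⁿ)`. -/
@[reducible] def harmonicCore (n k : ℕ) : InnerProductSpace.Core ℂ (harmonicSubmodule n k) where
  inner P Q := ballInner (ev (P : MvPolynomial (Fin n) ℂ)) (ev (Q : MvPolynomial (Fin n) ℂ))
  conj_inner_symm P Q := ballInner_conj _ _
  re_inner_nonneg P := by
    rw [ballInner_self]
    change 0 ≤ ∫ y in Metric.ball (0 : Eucl n) 1, _
    exact MeasureTheory.integral_nonneg fun y => by positivity
  add_left P Q R := by
    rw [Submodule.coe_add, map_add, ballInner_add_left]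
  smul_left P Q c := by
    rw [Submodule.coe_smul, map_smul, ballInner_smul_left]
  definite P h := Subtype.ext (eq_zero_of_vanish_ball (mem_harmonicSubmodule.1 P.2).1
    fun _ hy => eq_zero_of_ballInner_self h hy)

theorem exists_orth_eq {v w : Eucl n} (h : ‖v‖ = ‖w‖) : ∃ u : OrthGroup n, u v = w :=
  ⟨_, Submodule.reflection_sub h⟩

/-- Harmonic polynomials of degree `k` form an irreducible representation of `O(n)`. -/
theorem harmonic_irreducible (hn : 1 ≤ n) {k : ℕ} {W : Submodule ℂ (MvPolynomial (Fin n) ℂ)}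
    (hWk : W ≤ harmonicSubmodule n k) (hW : ∀ u : OrthGroup n, ∀ h ∈ W, polyComp u h ∈ W)
    (hW0 : W ≠ ⊥) : W = harmonicSubmodule n k := by
  let i₀ : Fin n := ⟨0, hn⟩
  let e : Eucl n := EuclideanSpace.single i₀ 1
  let : NormedAddCommGroup (harmonicSubmodule n k) := (harmonicCore n k).toNormedAddCommGroup
  let : InnerProductSpace ℂ (harmonicSubmodule n k) := InnerProductSpace.ofCore (harmonicCore n k).toCore
  have hin : ∀ P Q : harmonicSubmodule n k, inner ℂ P Q =
    ballInner (ev (P : MvPolynomial (Fin n) ℂ)) (ev (Q : MvPolynomial (Fin n) ℂ)) := fun P Q => rfl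
  let ρ : OrthGroup n → harmonicSubmodule n k →ₗ[ℂ] harmonicSubmodule n k := fun u =>
    (polyComp u⁻¹).toLinearMap.restrict fun h hh =>
      mem_harmonicSubmodule.2 (polyComp_mem _ (mem_harmonicSubmodule.1 hh))
  have hρc : ∀ u h, (ρ u h : MvPolynomial (Fin n) ℂ) = polyComp u⁻¹ h := fun u h => rfl
  -- Evaluation at the pole e; its symmetries are the stabilizer of e.
  let ε : harmonicSubmodule n k →ₗ[ℂ] ℂ :=
    { toFun := fun h => (ev (h : MvPolynomial (Fin n) ℂ) : Eucl n → ℂ) e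
      map_add' := fun f g => by simp
      map_smul' := fun c f => by simp }
  have hεc : ∀ h, ε h = (ev (h : MvPolynomial (Fin n) ℂ) : Eucl n → ℂ) e := fun h => rfl
  let Z : Subgroup (OrthGroup n) :=
    { carrier := {u | u e = e}
      mul_mem' := fun {a b} ha hb => by
        change a (b e) = e
        rw [show b e = e from hb]; exact ha
      one_mem' := rfl
      inv_mem' := fun {a} ha => by
        change a.symm e = e
        rw [LinearIsometryEquiv.symm_apply_eq]; exact (show a e = e from ha).symm }
  have key := eq_top_of_isometric ρ (fun u x y => ?_) ε Z (fun u hu x => ?_) (fun z hz h0 => ?_)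
    (fun W' hW' h0 => ?_) (W := W.submoduleOf (harmonicSubmodule n k)) (fun u w hw => hW _ _ hw) ?_
  · refine le_antisymm hWk fun h hh => ?_
    have : (⟨h, hh⟩ : harmonicSubmodule n k) ∈ W.submoduleOf (harmonicSubmodule n k) := by
      rw [key]; trivial
    exact this
  · rw [hin, hin, hρc, hρc, ← ballInner_smComp u, ← ev_polyComp, ← ev_polyComp, polyComp_polyComp,
      inv_mul_cancel, polyComp_one, inv_inv]
  · rw [hεc, hεc, hρc, ev_polyComp, smComp_apply, show u⁻¹ e = e from Z.inv_mem hu]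
  · refine Subtype.ext (eq_zero_of_isZonal (mem_harmonicSubmodule.1 z.2) (i₀ := i₀) (fun u hu => ?_) h0)
    have := congrArg Subtype.val (hz u⁻¹ (Z.inv_mem hu))
    rw [hρc, inv_inv] at this
    rw [← ev_polyComp, this]
  · refine (Submodule.eq_bot_iff _).2 fun h hh => Subtype.ext ?_
    refine eq_zero_of_vanish_ball (mem_harmonicSubmodule.1 h.2).1 fun y _ => ?_
    -- O(n) is transitive on spheres, so an invariant space of homogeneous polynomials vanishing at
    -- the pole vanishes everywhere.
    have hu : ∃ u : OrthGroup n, ‖y‖ • u e = y := by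
      obtain ⟨u, hu⟩ := exists_orth_eq (v := ‖y‖ • e) (w := y) (by simp [norm_smul, e])
      exact ⟨u, by rw [← map_smul, hu]⟩
    obtain ⟨u, hu⟩ := hu
    have h1 := h0 _ (hW' u⁻¹ h hh)
    rw [hεc, hρc, inv_inv, ev_polyComp, smComp_apply] at h1
    rw [← hu, ev_smul_apply (mem_harmonicSubmodule.1 h.2).1, h1, mul_zero]
  · intro hb
    refine hW0 ((Submodule.eq_bot_iff _).2 fun h hh => ?_)
    have : (⟨h, hWk hh⟩ : harmonicSubmodule n k) ∈ W.submoduleOf (harmonicSubmodule n k) := hh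
    rw [hb] at this
    exact congrArg Subtype.val ((Submodule.mem_bot ℂ).1 this)

/-! ### Existence of harmonic polynomials -/

/-- For n ≥ 2 the powers of x₁ + i x₂ are harmonic because 1 + i² = 0. Nonvanishing of 𝓗_k is what
makes the inclusions between the modules strict. -/
theorem exists_harmonic_ne_zero {k : ℕ} (h : 2 ≤ n ∨ n = 1 ∧ k ≤ 1) :
    ∃ P ∈ harmonicPoly n k, P ≠ 0 := by
  rcases h with h | ⟨rfl, hk⟩
  · let i : Fin n := ⟨0, by omega⟩
    let j : Fin n := ⟨1, by omega⟩
    have hij : i ≠ j := by simp [i, j]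
    set p : MvPolynomial (Fin n) ℂ := MvPolynomial.X i + MvPolynomial.C Complex.I * MvPolynomial.X j
      with hp
    have hd : ∀ t, MvPolynomial.pderiv t p =
        MvPolynomial.C ((if t = i then 1 else 0) + (if t = j then Complex.I else 0)) := fun t => by
      rw [hp, map_add, MvPolynomial.pderiv_C_mul, MvPolynomial.pderiv_X, MvPolynomial.pderiv_X]
      by_cases h1 : t = i <;> by_cases h2 : t = j <;>
        simp [h1, h2, hij, hij.symm, Ne.symm]
    have hp0 : p ≠ 0 := fun h0 => by
      have := hd i
      rw [h0] at this
      simp [hij] at this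
    refine ⟨p ^ k, ⟨?_, ?_⟩, pow_ne_zero _ hp0⟩
    · have := MvPolynomial.IsHomogeneous.pow (((MvPolynomial.isHomogeneous_X ℂ i).add
        ((MvPolynomial.isHomogeneous_X ℂ j).C_mul Complex.I)) : p.IsHomogeneous 1) k
      rwa [one_mul] at this
    · have h2 : ∀ t, MvPolynomial.pderiv t (MvPolynomial.pderiv t (p ^ k)) =
          (k : MvPolynomial (Fin n) ℂ) * ((k - 1 : ℕ) : MvPolynomial (Fin n) ℂ) * p ^ (k - 1 - 1) *
            MvPolynomial.pderiv t p ^ 2 := fun t => by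
        have h3 : MvPolynomial.pderiv t (MvPolynomial.pderiv t p) = 0 := by
          rw [hd, MvPolynomial.pderiv_C]
        simp only [Derivation.leibniz_pow, Derivation.leibniz, smul_eq_mul, nsmul_eq_mul, h3,
          Derivation.map_natCast]
        ring
      simp only [h2]
      rw [← Finset.mul_sum]
      have h4 : ∑ t, MvPolynomial.pderiv t p ^ 2 = 0 := by
        simp only [hd, ← map_pow]
        rw [← map_sum]
        have h5 : ∀ t, (((if t = i then 1 else 0) + (if t = j then Complex.I else 0)) ^ 2 : ℂ) =
            (if t = i then 1 else 0) + (if t = j then -1 else 0) := fun t => by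
          by_cases h1 : t = i
          · simp [h1, hij]
          · by_cases h2 : t = j <;> simp [h1, h2, hij.symm]
        simp only [h5, Finset.sum_add_distrib, Finset.sum_ite_eq', Finset.mem_univ, if_true]
        simp
      rw [h4, mul_zero]
  · refine ⟨MvPolynomial.X 0 ^ k, mem_harmonicPoly.2 ⟨?_, ?_⟩, pow_ne_zero _ (MvPolynomial.X_ne_zero _)⟩
    · simpa using (MvPolynomial.isHomogeneous_X ℂ (0 : Fin 1)).pow k
    · exact lap_eq_zero_of_lt_two (by simpa using (MvPolynomial.isHomogeneous_X ℂ (0 : Fin 1)).pow k)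
        (by omega)

/-! ### Weight decomposition -/

theorem SmoothLinear.map_sum {T : Fn n → Fn n} (hT : SmoothLinear T) {ι : Type*} (S : Finset ι)
    {F : ι → Fn n} (hF : ∀ i, ContDiff ℝ ∞ (F i)) :
    ContDiff ℝ ∞ (∑ i ∈ S, F i) ∧ T (∑ i ∈ S, F i) = ∑ i ∈ S, T (F i) := by
  classical
  induction S using Finset.induction_on with
  | empty =>
    refine ⟨contDiff_const, ?_⟩
    have := hT.smul 0 0 contDiff_const
    rw [zero_smul, zero_smul] at this
    simpa using this
  | insert a S ha ih =>
    rw [Finset.sum_insert ha, Finset.sum_insert ha, hT.add _ _ (hF a) ih.1, ih.2]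
    exact ⟨(hF a).add ih.1, rfl⟩

/-- A subspace stable under `κ` contains the weight components of its elements. -/
theorem sep_mem_of_sum_mem {W : Submodule ℂ (Fn n)} (hW : ∀ F ∈ W, kappa F ∈ W) (S : Finset ℤ) :
    ∀ g : ℤ → Sm n, ∑ m ∈ S, sep n m (g m) ∈ W → ∀ m ∈ S, sep n m (g m) ∈ W := by
  induction S using Finset.induction_on with
  | empty => intro g _ m hm; simp at hm
  | insert a S ha ih =>
    intro g hg
    have hk := hW _ hg
    rw [(smoothLinear_kappa.map_sum (insert a S) fun m => contDiff_sep m (g m)).2] at hk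
    -- κ - a/2 kills the component of weight a and scales that of weight m by (m - a)/2 ≠ 0.
    have hd := W.sub_mem hk (W.smul_mem ((a : ℂ) / 2) hg)
    rw [Finset.smul_sum, ← Finset.sum_sub_distrib, Finset.sum_insert ha, kappa_sep, sub_self,
      zero_add] at hd
    have hS : ∀ m ∈ S, sep n m (g m) ∈ W := by
      intro m hm
      have h1 := ih (fun m => (((m : ℂ) - a) / 2) • g m) (by
        convert hd using 2 with m hm
        rw [kappa_sep, map_smul, ← sub_smul]
        congr 1
        ring) m hm
      rw [map_smul] at h1
      refine (W.smul_mem_iff ?_).1 h1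
      have : (m : ℂ) ≠ a := fun h => ha (Int.cast_injective h ▸ hm)
      exact div_ne_zero (sub_ne_zero.2 this) two_ne_zero
    intro m hm
    rcases Finset.mem_insert.1 hm with rfl | hm
    · have h2 := W.sub_mem hg (W.sum_mem hS)
      rwa [Finset.sum_insert ha, add_sub_cancel_right] at h2
    · exact hS m hm

theorem eq_zero_of_sum_sep {S : Finset ℤ} {g : ℤ → Sm n} (h : ∑ m ∈ S, sep n m (g m) = 0) :
    ∀ m ∈ S, g m = 0 := by
  intro m hm
  have hk : ∀ F ∈ (⊥ : Submodule ℂ (Fn n)), kappa F ∈ (⊥ : Submodule ℂ (Fn n)) := fun F hF => by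
    rw [(Submodule.mem_bot ℂ).1 hF, Submodule.mem_bot]
    have := smoothLinear_kappa.smul 0 (0 : Fn n) contDiff_const
    rwa [zero_smul, zero_smul] at this
  have := sep_mem_of_sum_mem hk S g ((Submodule.mem_bot ℂ).2 h) m hm
  exact sep_injective m (by rw [(Submodule.mem_bot ℂ).1 this, map_zero])

/-- Elements of the span of the `F_{m,l,k}` as finite sums over `m`. -/
theorem exists_finsupp_of_mem_vecSpan (hn : 1 ≤ n) {q : ℤ} {s : ℂ} {l k : ℕ} {S : Set ℤ} {F : Fn n}
    (hF : F ∈ vecSpan n q s l k S) :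
    ∃ h : ℤ →₀ MvPolynomial (Fin n) ℂ, (∀ m, h m ∈ harmonicSubmodule n k) ∧
      (∀ m ∈ h.support, m ∈ S ∧ m ≡ 2 * k + q [ZMOD 4]) ∧
      F = h.sum fun m p => sep n m (radVec n hn s m l k p) := by
  classical
  induction hF using Submodule.span_induction with
  | mem F hF =>
    obtain ⟨m, hmS, hm, h, hh, rfl⟩ := hF
    refine ⟨Finsupp.single m h, fun m' => ?_, fun m' hm' => ?_, ?_⟩
    · rw [Finsupp.single_apply]
      split_ifs
      · exact mem_harmonicSubmodule.2 hh
      · exact Submodule.zero_mem _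
    · have := Finsupp.support_single_subset hm'
      rw [Finset.mem_singleton] at this
      rw [this]
      exact ⟨hmS, hm⟩
    · rw [Finsupp.sum_single_index (by simp), vec_eq_sep hn]
  | zero => exact ⟨0, fun m => Submodule.zero_mem _, fun m hm => by simp at hm, by simp⟩
  | add F G _ _ hF hG =>
    obtain ⟨f, hf, hf', rfl⟩ := hF
    obtain ⟨g, hg, hg', rfl⟩ := hG
    refine ⟨f + g, fun m => Submodule.add_mem _ (hf m) (hg m), fun m hm => ?_, ?_⟩
    · rcases Finset.mem_union.1 (Finsupp.support_add hm) with h | h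
      · exact hf' m h
      · exact hg' m h
    · rw [Finsupp.sum_add_index' (by simp) (by simp)]
  | smul c F _ hF =>
    obtain ⟨f, hf, hf', rfl⟩ := hF
    refine ⟨c • f, fun m => Submodule.smul_mem _ c (hf m), fun m hm => hf' m (Finsupp.support_smul hm), ?_⟩
    rw [Finsupp.sum_smul_index' (by simp), Finsupp.smul_sum]
    simp

/-- Different weights are independent, so a span determines its weights in the residue class.
Inclusions of modules thereby become inclusions of sets of integers. -/
theorem vec_mem_vecSpan_iff (hn : 1 ≤ n) {q m : ℤ} {s : ℂ} {l k : ℕ} {S : Set ℤ}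
    (hm : m ≡ 2 * k + q [ZMOD 4]) {h : MvPolynomial (Fin n) ℂ} (hh : h ∈ harmonicPoly n k)
    (h0 : h ≠ 0) : vec n s m l k h ∈ vecSpan n q s l k S ↔ m ∈ S := by
  classical
  refine ⟨fun hv => ?_, fun hmS => vec_mem_vecSpan s l hmS hm hh⟩
  obtain ⟨f, hf, hfS, hfe⟩ := exists_finsupp_of_mem_vecSpan hn hv
  by_contra hmS
  have hms : m ∉ f.support := fun h => hmS (hfS m h).1
  have hsum : ∑ m' ∈ insert m f.support, sep n m' (if m' = m then -radVec n hn s m l k h else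
      radVec n hn s m' l k (f m')) = 0 := by
    rw [Finset.sum_insert hms, if_pos rfl, map_neg, ← vec_eq_sep hn, hfe, Finsupp.sum,
      neg_add_eq_sub, sub_eq_zero]
    refine Finset.sum_congr rfl fun m' hm' => ?_
    rw [if_neg (by rintro rfl; exact hms hm')]
  have := eq_zero_of_sum_sep hsum m (Finset.mem_insert_self _ _)
  rw [if_pos rfl, neg_eq_zero] at this
  exact h0 (radVec_injective hn s m l k hh.1 this)

theorem vecSpan_le_iff (hn : 1 ≤ n) {q : ℤ} {s : ℂ} {l k : ℕ} (hk : ∃ h ∈ harmonicPoly n k, h ≠ 0)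
    {S T : Set ℤ} : vecSpan n q s l k S ≤ vecSpan n q s l k T ↔
      ∀ m ∈ S, m ≡ 2 * k + q [ZMOD 4] → m ∈ T := by
  obtain ⟨h, hh, h0⟩ := hk
  refine ⟨fun hle m hmS hm => ?_, fun hST => Submodule.span_le.2 ?_⟩
  · exact (vec_mem_vecSpan_iff hn hm hh h0).1 (hle (vec_mem_vecSpan s l hmS hm hh))
  · rintro _ ⟨m, hmS, hm, h, hh, rfl⟩
    exact vec_mem_vecSpan s l (hST m hmS hm) hm hh

theorem vecSpan_union (q : ℤ) (s : ℂ) (l k : ℕ) (S T : Set ℤ) :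
    vecSpan n q s l k S ⊔ vecSpan n q s l k T = vecSpan n q s l k (S ∪ T) := by
  refine le_antisymm (sup_le (vecSpan_mono q s Set.subset_union_left)
    (vecSpan_mono q s Set.subset_union_right)) (Submodule.span_le.2 ?_)
  rintro _ ⟨m, hmS | hmT, hm, h, hh, rfl⟩
  · exact Submodule.mem_sup_left (vec_mem_vecSpan s l hmS hm hh)
  · exact Submodule.mem_sup_right (vec_mem_vecSpan s l hmT hm hh)

theorem vecSpan_empty (q : ℤ) (s : ℂ) (l k : ℕ) : vecSpan n q s l k ∅ = ⊥ := by
  refine (Submodule.eq_bot_iff _).2 fun F hF => ?_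
  have : vecSpan n q s l k ∅ ≤ ⊥ := Submodule.span_le.2 (by rintro _ ⟨m, hm, -⟩; exact hm.elim)
  exact (Submodule.mem_bot ℂ).1 (this hF)

/-! ### The submodules of `H_{l,k}` -/

/-- If a submodule contains one nonzero vector `F_{m,l,k}`, then it contains them all. -/
theorem vec_mem_of_vec_mem (hn : 1 ≤ n) {q m : ℤ} {s : ℂ} {l k : ℕ} {W : Submodule ℂ (Fn n)}
    (hW : IsSubrep n q s W) {h : MvPolynomial (Fin n) ℂ} (hh : h ∈ harmonicPoly n k) (h0 : h ≠ 0)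
    (hv : vec n s m l k h ∈ W) {h' : MvPolynomial (Fin n) ℂ} (hh' : h' ∈ harmonicPoly n k) :
    vec n s m l k h' ∈ W := by
  -- The harmonic h for which F_{m,l,k} lies in W form an O(n)-stable subspace of 𝓗_k, which is
  -- irreducible.
  set U : Submodule ℂ (MvPolynomial (Fin n) ℂ) :=
    harmonicSubmodule n k ⊓ W.comap (sep n m ∘ₗ radVec n hn s m l k) with hU
  have hmem : ∀ p, p ∈ U ↔ p ∈ harmonicPoly n k ∧ vec n s m l k p ∈ W := fun p => by
    rw [hU, Submodule.mem_inf, mem_harmonicSubmodule, vec_eq_sep hn]; rfl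
  have := harmonic_irreducible hn (W := U) (k := k) inf_le_left (fun u p hp => ?_) (fun hb => ?_)
  · exact ((hmem h').1 (by rw [this]; exact mem_harmonicSubmodule.2 hh')).2
  · rw [hmem] at hp ⊢
    refine ⟨polyComp_mem u hp.1, ?_⟩
    have := hW.orth_mem u⁻¹ _ hp.2
    rw [kAct_vec hn] at this
    simpa using this
  · have := (hmem h).2 ⟨hh, hv⟩
    rw [hb] at this
    exact h0 ((Submodule.mem_bot ℂ).1 this)

/-- A set of weights in the class of `r` modulo `4` that is closed under the raising steps, except
from `-A`, and under the lowering steps, except from `A`. -/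
structure StepClosed (A r : ℤ) (M : Set ℤ) : Prop where
  modEq : ∀ m ∈ M, m ≡ r [ZMOD 4]
  up : ∀ m ∈ M, m ≠ -A → m + 4 ∈ M
  down : ∀ m ∈ M, m ≠ A → m - 4 ∈ M

/-- Climbing by steps of 4 can stop only at -A. The alternatives say that -A is not in the class,
that the start lies above it, or that the target is not beyond it. -/
theorem StepClosed.mem_up {A r : ℤ} {M : Set ℤ} (hM : StepClosed A r M) {m m' : ℤ} (hm : m ∈ M)
    (hm' : m' ≡ r [ZMOD 4]) (hle : m ≤ m') (h : ¬ -A ≡ r [ZMOD 4] ∨ -A < m ∨ m' ≤ -A) : m' ∈ M := by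
  obtain ⟨t, ht⟩ := ((hM.modEq m hm).trans hm'.symm).dvd
  have key : ∀ j : ℕ, m + 4 * j ≤ m' → m + 4 * j ∈ M := by
    intro j
    induction j with
    | zero => intro _; simpa using hm
    | succ j ih =>
      intro hj
      push_cast at hj
      have h1 := ih (by linarith)
      have h2 := hM.up _ h1 fun he => by
        rcases h with h | h | h
        · exact h (he ▸ hM.modEq _ h1)
        · have : (0 : ℤ) ≤ j := Int.natCast_nonneg j
          linarith
        · linarith
      push_cast
      rwa [show m + 4 * ((j : ℤ) + 1) = m + 4 * j + 4 by ring]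
  have h3 := key t.toNat (by omega)
  rwa [show m + 4 * (t.toNat : ℤ) = m' by omega] at h3

/-- The reflection m ↦ -m exchanges raising and lowering, so statements about descending follow from
those about climbing. -/
theorem StepClosed.neg {A r : ℤ} {M : Set ℤ} (hM : StepClosed A r M) :
    StepClosed A (-r) {m | -m ∈ M} where
  modEq m hm := by simpa using (hM.modEq _ hm).neg
  up m hm h := by
    have := hM.down _ hm fun he => h (by rw [← he, neg_neg])
    change -(m + 4) ∈ M
    rwa [neg_add']
  down m hm h := by
    have := hM.up _ hm fun he => h (neg_injective he)
    change -(m - 4) ∈ M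
    rwa [neg_sub, sub_eq_neg_add]

theorem StepClosed.mem_down {A r : ℤ} {M : Set ℤ} (hM : StepClosed A r M) {m m' : ℤ} (hm : m ∈ M)
    (hm' : m' ≡ r [ZMOD 4]) (hle : m' ≤ m) (h : ¬ A ≡ r [ZMOD 4] ∨ m < A ∨ A ≤ m') : m' ∈ M := by
  have := hM.neg.mem_up (m := -m) (m' := -m') (by simpa using hm) hm'.neg (by linarith) (by
    rcases h with h | h | h
    · exact Or.inl fun h' => h (by simpa using h'.neg)
    · exact Or.inr (Or.inl (by linarith))
    · exact Or.inr (Or.inr (by linarith)))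
  simpa using this

/-- Stability under κ splits W into weight components, and irreducibility of 𝓗_k makes each of them
all or nothing. Hence a single fixed harmonic h₁ suffices to detect the weights of W. -/
theorem exists_stepClosed (hn : 1 ≤ n) {q : ℤ} {s : ℂ} {l k : ℕ} {W : Submodule ℂ (Fn n)}
    (hk : ∃ h ∈ harmonicPoly n k, h ≠ 0) (hW : IsSubrep n q s W) (hle : W ≤ modH n q s l k) :
    ∃ M : Set ℤ, StepClosed (2 * k + 4 * l + n) (2 * k + q) M ∧ W = vecSpan n q s l k M := by
  obtain ⟨h₁, hh₁, hh0⟩ := hk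
  refine ⟨{m | m ≡ 2 * k + q [ZMOD 4] ∧ vec n s m l k h₁ ∈ W}, ⟨fun m hm => hm.1, ?_, ?_⟩,
    le_antisymm (fun F hF => ?_) (Submodule.span_le.2 ?_)⟩
  · rintro m ⟨hm, hv⟩ hne
    refine ⟨modEq_add_four hm, ?_⟩
    have := hW.etaPlus_mem _ hv
    rw [etaPlus_vec hn s m l k hh₁.1] at this
    refine (W.smul_mem_iff ?_).1 this
    intro h0
    refine hne ?_
    have h1 : ((m : ℤ) : ℂ) = ((-(2 * k + 4 * l + n) : ℤ) : ℂ) := by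
      push_cast
      linear_combination -4 * h0
    exact Int.cast_injective h1
  · rintro m ⟨hm, hv⟩ hne
    refine ⟨modEq_sub_four hm, ?_⟩
    have := hW.etaMinus_mem _ hv
    rw [etaMinus_vec hn s m l k hh₁.1] at this
    refine (W.smul_mem_iff ?_).1 this
    intro h0
    refine hne ?_
    have h1 : ((m : ℤ) : ℂ) = ((2 * k + 4 * l + n : ℤ) : ℂ) := by
      push_cast
      linear_combination 4 * h0
    exact Int.cast_injective h1
  · obtain ⟨f, hf, hfS, hfe⟩ := exists_finsupp_of_mem_vecSpan hn (hle hF)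
    have hmem := sep_mem_of_sum_mem hW.kappa_mem f.support (fun m => radVec n hn s m l k (f m))
      (by rw [hfe] at hF; exact hF)
    rw [hfe]
    refine Submodule.sum_mem _ fun m hm => ?_
    have h1 := hmem m hm
    beta_reduce
    rw [← vec_eq_sep hn] at h1 ⊢
    have h2 := mem_harmonicSubmodule.1 (hf m)
    refine vec_mem_vecSpan s l ?_ (hfS m hm).2 h2
    exact ⟨(hfS m hm).2, vec_mem_of_vec_mem hn hW h2 (Finsupp.mem_support_iff.1 hm) h1 hh₁⟩
  · rintro _ ⟨m, hmS, -, h, hh, rfl⟩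
    exact vec_mem_of_vec_mem hn hW hh₁ hh0 hmS.2 hh

theorem disjoint_vecSpan (hn : 1 ≤ n) {q : ℤ} {s : ℂ} {l k : ℕ} {S T : Set ℤ}
    (hT : IsSubrep n q s (vecSpan n q s l k T)) (hST : Disjoint S T) :
    Disjoint (vecSpan n q s l k S) (vecSpan n q s l k T) := by
  rw [Submodule.disjoint_def]
  intro F hFS hFT
  obtain ⟨f, hf, hfS, hfe⟩ := exists_finsupp_of_mem_vecSpan hn hFS
  have hmem := sep_mem_of_sum_mem hT.kappa_mem f.support (fun m => radVec n hn s m l k (f m))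
    (by rw [hfe] at hFT; exact hFT)
  rw [hfe, Finsupp.sum, Finset.sum_eq_zero]
  intro m hm
  exfalso
  have h1 := hmem m hm
  rw [← vec_eq_sep hn, vec_mem_vecSpan_iff hn (hfS m hm).2 (mem_harmonicSubmodule.1 (hf m))
    (Finsupp.mem_support_iff.1 hm)] at h1
  exact Set.disjoint_left.1 hST (hfS m hm).1 h1

/-! ### Independence of the modules `H_{l,k}` -/

/-- Distinct admissible pairs have distinct degrees `2l + k`. -/
theorem admissiblePair_injective {lam : ℤ} {l k l' k' : ℕ} (h : IsAdmissiblePair n lam l k)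
    (h' : IsAdmissiblePair n lam l' k') (he : 2 * l + k = 2 * l' + k') : l = l' ∧ k = k' := by
  rcases h with ⟨h1, h2⟩
  rcases h' with ⟨h1', h2'⟩
  by_cases hn : n = 1
  · omega
  · have hn2 : (2 : ℤ) ≤ n := by omega
    have hl : (1 : ℤ) ≤ l := by omega
    have he' : (2 : ℤ) * l + k = 2 * l' + k' := by exact_mod_cast he
    -- Subtracting the two expressions for λ at equal degree. The second factor vanishes only for n
    -- = 2 and k = k' = 0, where the degrees again give l = l'.
    have hz : ((l : ℤ) - l') * (k + k' + n - 2) = 0 := by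
      have hk' : (k' : ℤ) = 2 * l + k - 2 * l' := by linarith
      rw [hk'] at h1' ⊢
      linear_combination h1' - h1
    rcases mul_eq_zero.1 hz with h | h
    · omega
    · have : (k : ℤ) = 0 ∧ (k' : ℤ) = 0 := by omega
      omega

/-- In the component of degree N, pairs of larger degree do not contribute, pairs of smaller degree
are gone by induction, and only one pair has degree N. -/
theorem eq_zero_of_sum_radVec (hn : 1 ≤ n) {lam m : ℤ} {s : ℂ}
    (S : Finset {p : ℕ × ℕ // IsAdmissiblePair n lam p.1 p.2})
    {h : {p : ℕ × ℕ // IsAdmissiblePair n lam p.1 p.2} → MvPolynomial (Fin n) ℂ}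
    (hh : ∀ p ∈ S, h p ∈ harmonicPoly n p.1.2)
    (hsum : ∑ p ∈ S, radVec n hn s m p.1.1 p.1.2 (h p) = 0) : ∀ p ∈ S, h p = 0 := by
  suffices H : ∀ N : ℕ, ∀ p ∈ S, 2 * p.1.1 + p.1.2 = N → h p = 0 from fun p hp => H _ p hp rfl
  intro N
  induction N using Nat.strong_induction_on with
  | _ N ih =>
    intro p hp hN
    have h1 := congrArg (taylorPart N) hsum
    rw [map_sum, map_zero, Finset.sum_eq_single_of_mem p hp, ← hN,
      (taylorPart_radVec hn s m p.1.1 p.1.2 (hh p hp).1).1] at h1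
    · exact (mul_eq_zero.1 h1).resolve_left (pow_ne_zero _ (r2_ne_zero hn))
    · intro p' hp' hne
      rcases lt_trichotomy (2 * p'.1.1 + p'.1.2) N with hlt | heq | hgt
      · rw [ih _ hlt p' hp' rfl, map_zero, map_zero]
      · have := admissiblePair_injective p'.2 p.2 (heq.trans hN.symm)
        exact absurd (Subtype.ext (Prod.ext this.1 this.2)) hne
      · exact (taylorPart_radVec hn s m p'.1.1 p'.1.2 (hh p' hp').1).2 N hgt

/-- A relation is split first by weight and then, within one weight, by the lowest degree 2l + k. -/
theorem iSupIndep_modH (hn : 1 ≤ n) (q : ℤ) (s : ℂ) (lam : ℤ) :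
    iSupIndep (fun p : {p : ℕ × ℕ // IsAdmissiblePair n lam p.1 p.2} =>
      modH n q s p.1.1 p.1.2) := by
  classical
  rw [iSupIndep_iff_finsetSum_eq_zero_imp_eq_zero]
  intro S v hv hsum
  have hex : ∀ p, ∃ h : ℤ →₀ MvPolynomial (Fin n) ℂ, p ∈ S →
      (∀ m, h m ∈ harmonicSubmodule n p.1.2) ∧
        v p = h.sum fun m x => sep n m (radVec n hn s m p.1.1 p.1.2 x) := fun p => by
    by_cases hp : p ∈ S
    · obtain ⟨h, h1, -, h2⟩ := exists_finsupp_of_mem_vecSpan hn (hv p hp)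
      exact ⟨h, fun _ => ⟨h1, h2⟩⟩
    · exact ⟨0, fun h => absurd h hp⟩
  choose f hf using hex
  have hv' : ∀ p ∈ S, v p = ∑ m ∈ S.biUnion fun p => (f p).support,
      sep n m (radVec n hn s m p.1.1 p.1.2 (f p m)) := fun p hp => by
    rw [(hf p hp).2]
    exact Finsupp.sum_of_support_subset _ (Finset.subset_biUnion_of_mem (fun p => (f p).support) hp) _
      (by simp)
  have hsum' : ∑ m ∈ S.biUnion fun p => (f p).support,
      sep n m (∑ p ∈ S, radVec n hn s m p.1.1 p.1.2 (f p m)) = 0 := by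
    simp only [map_sum]
    rw [Finset.sum_comm, ← hsum]
    exact Finset.sum_congr rfl fun p hp => (hv' p hp).symm
  intro p hp
  rw [hv' p hp]
  refine Finset.sum_eq_zero fun m hm => ?_
  rw [eq_zero_of_sum_radVec hn S (h := fun p => f p m)
    (fun p hp => mem_harmonicSubmodule.1 ((hf p hp).1 m)) (eq_zero_of_sum_sep hsum' m hm) p hp,
    map_zero, map_zero]

/-! ### Composition factors of `H_{l,k}` -/

/-- Modulo 4 the terms 2k cancel and 4l drops out, so q alone decides whether the barrier A is a
weight of H_{l,k}. -/
theorem highest_modEq_iff {q : ℤ} {l k : ℕ} :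
    (2 * k + 4 * l + n : ℤ) ≡ 2 * k + q [ZMOD 4] ↔ q ≡ n [ZMOD 4] := by
  unfold Int.ModEq
  omega

theorem lowest_modEq_iff {q : ℤ} {l k : ℕ} :
    -(2 * k + 4 * l + n : ℤ) ≡ 2 * k + q [ZMOD 4] ↔ q ≡ -n [ZMOD 4] := by
  unfold Int.ModEq
  omega

theorem isSubrep_bot (hn : 1 ≤ n) (q : ℤ) (s : ℂ) : IsSubrep n q s ⊥ := by
  rw [← vecSpan_empty q s 0 0]
  exact isSubrep_vecSpan hn q s 0 0 ∅ (fun _ h => h.elim) (fun _ h => h.elim)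

theorem isSubrep_modHPlus (hn : 1 ≤ n) {q : ℤ} (s : ℂ) (l k : ℕ) (hq : q ≡ n [ZMOD 4]) :
    IsSubrep n q s (modHPlus n q s l k) := by
  refine isSubrep_vecSpan hn q s l k _ (fun m hm _ _ => ?_) (fun m hm hmr hne => ?_)
  · simp only [Set.mem_ofPred_eq] at hm ⊢
    omega
  · simp only [Set.mem_ofPred_eq] at hm ⊢
    unfold Int.ModEq at hq hmr
    omega

theorem isSubrep_modHMinus (hn : 1 ≤ n) {q : ℤ} (s : ℂ) (l k : ℕ) (hq : q ≡ -n [ZMOD 4]) :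
    IsSubrep n q s (modHMinus n q s l k) := by
  refine isSubrep_vecSpan hn q s l k _ (fun m hm hmr hne => ?_) (fun m hm _ _ => ?_)
  · simp only [Set.mem_ofPred_eq] at hm ⊢
    unfold Int.ModEq at hq hmr
    omega
  · simp only [Set.mem_ofPred_eq] at hm ⊢
    omega

/-- The quotient of two spans is irreducible if no set of weights closed under the steps lies strictly
between the sets of weights. -/
theorem isSimpleStep_vecSpan (hn : 1 ≤ n) {q : ℤ} {s : ℂ} {l k : ℕ}
    (hk : ∃ h ∈ harmonicPoly n k, h ≠ 0) {S T : Set ℤ}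
    (hS : IsSubrep n q s (vecSpan n q s l k S)) (hT : IsSubrep n q s (vecSpan n q s l k T))
    (hST : S ⊆ T) (hne : ∃ m ∈ T, m ≡ 2 * k + q [ZMOD 4] ∧ m ∉ S)
    (h : ∀ M, StepClosed (2 * k + 4 * l + n) (2 * k + q) M → (∃ m ∈ M, m ∈ T ∧ m ∉ S) →
      ∀ m ∈ T, m ≡ 2 * k + q [ZMOD 4] → m ∉ S → m ∈ M) :
    IsSimpleStep n q s (vecSpan n q s l k S) (vecSpan n q s l k T) := by
  refine ⟨hS, hT, lt_of_le_not_ge (vecSpan_mono q s hST) fun hle => ?_, fun U hU hSU hUT => ?_⟩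
  · obtain ⟨m, hmT, hm, hmS⟩ := hne
    exact hmS ((vecSpan_le_iff hn hk).1 hle m hmT hm)
  · obtain ⟨M, hM, rfl⟩ := exists_stepClosed hn hk hU (hUT.trans (vecSpan_mono q s (Set.subset_univ T)))
    rw [vecSpan_le_iff hn hk] at hSU hUT
    by_cases hex : ∃ m ∈ M, m ∈ T ∧ m ∉ S
    · refine Or.inr (le_antisymm ((vecSpan_le_iff hn hk).2 hUT) ((vecSpan_le_iff hn hk).2 ?_))
      intro m hmT hm
      by_cases hmS : m ∈ S
      · exact hSU m hmS hm
      · exact h M hM hex m hmT hm hmS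
    · push Not at hex
      exact Or.inl (le_antisymm ((vecSpan_le_iff hn hk).2 fun m hmM hm => hex m hmM (hUT m hmM hm))
        ((vecSpan_le_iff hn hk).2 hSU))

theorem isIrred_vecSpan (hn : 1 ≤ n) {q : ℤ} {s : ℂ} {l k : ℕ}
    (hk : ∃ h ∈ harmonicPoly n k, h ≠ 0) {T : Set ℤ}
    (hT : IsSubrep n q s (vecSpan n q s l k T)) (hne : ∃ m ∈ T, m ≡ 2 * k + q [ZMOD 4])
    (h : ∀ M, StepClosed (2 * k + 4 * l + n) (2 * k + q) M → (∃ m ∈ M, m ∈ T) →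
      ∀ m ∈ T, m ≡ 2 * k + q [ZMOD 4] → m ∈ M) :
    IsIrred n q s (vecSpan n q s l k T) := by
  obtain ⟨m, hmT, hm⟩ := hne
  have := isSimpleStep_vecSpan hn hk (S := ∅) (T := T)
    (by rw [vecSpan_empty]; exact isSubrep_bot hn q s) hT (Set.empty_subset T)
    ⟨m, hmT, hm, id⟩ (fun M hM ⟨m, hmM, hmT, _⟩ m' hm'T hm' _ => h M hM ⟨m, hmM, hmT⟩ m' hm'T hm')
  rwa [vecSpan_empty] at this

theorem IsIrred.eq_of_le {q : ℤ} {s : ℂ} {V W : Submodule ℂ (Fn n)} (hV : IsIrred n q s V)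
    (hW : IsIrred n q s W) (hle : V ≤ W) : W = V := by
  rcases hW.eq_or_eq V hV.right bot_le hle with h | h
  · exact absurd h hV.lt.ne'
  · exact h.symm

theorem exists_stepClosed_of_isIrred (hn : 1 ≤ n) {q : ℤ} {s : ℂ} {l k : ℕ} {W : Submodule ℂ (Fn n)}
    (hk : ∃ h ∈ harmonicPoly n k, h ≠ 0) (hW : IsIrred n q s W) (hle : W ≤ modH n q s l k) :
    ∃ M : Set ℤ, StepClosed (2 * k + 4 * l + n) (2 * k + q) M ∧ M.Nonempty ∧
      W = vecSpan n q s l k M := by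
  obtain ⟨M, hM, rfl⟩ := exists_stepClosed hn hk hW.right hle
  refine ⟨M, hM, Set.nonempty_iff_ne_empty.2 ?_, rfl⟩
  rintro rfl
  exact hW.lt.ne' (vecSpan_empty q s l k)

/-- Neither barrier is a weight, so any weight reaches every other one. -/
theorem isIrred_modH (hn : 1 ≤ n) {q : ℤ} (s : ℂ) {l k : ℕ} (hk : ∃ h ∈ harmonicPoly n k, h ≠ 0)
    (h1 : ¬ q ≡ n [ZMOD 4]) (h2 : ¬ q ≡ -n [ZMOD 4]) : IsIrred n q s (modH n q s l k) := by
  refine isIrred_vecSpan hn hk (isSubrep_modH hn q s l k) ⟨2 * k + q, trivial, Int.ModEq.refl _⟩ ?_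
  rintro M hM ⟨m, hmM, -⟩ m' - hm'
  rcases le_total m m' with h | h
  · exact hM.mem_up hmM hm' h (Or.inl (lowest_modEq_iff.not.2 h2))
  · exact hM.mem_down hmM hm' h (Or.inl (highest_modEq_iff.not.2 h1))

/-- A set of weights closed under the steps containing a weight `≥ A` contains them all. -/
theorem StepClosed.mem_of_le {A r : ℤ} {M : Set ℤ} (hM : StepClosed A r M) (hA : 0 < A)
    (hAr : A ≡ r [ZMOD 4]) {m : ℤ} (hm : m ∈ M) (hle : A ≤ m) {m' : ℤ} (hm' : m' ≡ r [ZMOD 4])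
    (hle' : A ≤ m') : m' ∈ M :=
  hM.mem_up (hM.mem_down hm hAr hle (Or.inr (Or.inr le_rfl))) hm' hle' (Or.inr (Or.inl (by linarith)))

/-- A set of weights closed under the steps containing a weight `≤ -A` contains them all. -/
theorem StepClosed.mem_of_ge {A r : ℤ} {M : Set ℤ} (hM : StepClosed A r M) (hA : 0 < A)
    (hAr : -A ≡ r [ZMOD 4]) {m : ℤ} (hm : m ∈ M) (hle : m ≤ -A) {m' : ℤ} (hm' : m' ≡ r [ZMOD 4])
    (hle' : m' ≤ -A) : m' ∈ M :=
  hM.mem_down (hM.mem_up hm hAr hle (Or.inr (Or.inr le_rfl))) hm' hle' (Or.inr (Or.inl (by linarith)))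

/-- A set of weights closed under the steps containing a weight strictly between `-A` and `A` contains
all weights. -/
theorem StepClosed.mem_of_between {A r : ℤ} {M : Set ℤ} (hM : StepClosed A r M) {m : ℤ} (hm : m ∈ M)
    (h1 : -A < m) (h2 : m < A) {m' : ℤ} (hm' : m' ≡ r [ZMOD 4]) : m' ∈ M := by
  rcases le_total m m' with h | h
  · exact hM.mem_up hm hm' h (Or.inr (Or.inl h1))
  · exact hM.mem_down hm hm' h (Or.inr (Or.inl h2))

theorem highest_pos (hn : 1 ≤ n) (l k : ℕ) : (0 : ℤ) < 2 * k + 4 * l + n := by omega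

theorem isIrred_modHPlus (hn : 1 ≤ n) {q : ℤ} (s : ℂ) {l k : ℕ} (hk : ∃ h ∈ harmonicPoly n k, h ≠ 0)
    (hq : q ≡ n [ZMOD 4]) : IsIrred n q s (modHPlus n q s l k) := by
  refine isIrred_vecSpan hn hk (isSubrep_modHPlus hn s l k hq)
    ⟨2 * k + 4 * l + n, by simp, highest_modEq_iff.2 hq⟩ ?_
  rintro M hM ⟨m, hmM, hm⟩ m' hm'T hm'
  exact hM.mem_of_le (highest_pos hn l k) (highest_modEq_iff.2 hq) hmM hm hm' hm'T

theorem isIrred_modHMinus (hn : 1 ≤ n) {q : ℤ} (s : ℂ) {l k : ℕ} (hk : ∃ h ∈ harmonicPoly n k, h ≠ 0)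
    (hq : q ≡ -n [ZMOD 4]) : IsIrred n q s (modHMinus n q s l k) := by
  refine isIrred_vecSpan hn hk (isSubrep_modHMinus hn s l k hq)
    ⟨-(2 * k + 4 * l + n), by simp, lowest_modEq_iff.2 hq⟩ ?_
  rintro M hM ⟨m, hmM, hm⟩ m' hm'T hm'
  exact hM.mem_of_ge (highest_pos hn l k) (lowest_modEq_iff.2 hq) hmM hm hm' hm'T

/-- As -A is not a weight, climbing is never obstructed, and every nonzero submodule contains H⁺. -/
theorem irred_iff_eq_modHPlus (hn : 1 ≤ n) {q : ℤ} (s : ℂ) {l k : ℕ}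
    (hk : ∃ h ∈ harmonicPoly n k, h ≠ 0) (h1 : q ≡ n [ZMOD 4]) (h2 : ¬ q ≡ -n [ZMOD 4])
    (W : Submodule ℂ (Fn n)) :
    W ≤ modH n q s l k ∧ IsIrred n q s W ↔ W = modHPlus n q s l k := by
  refine ⟨fun ⟨hle, hW⟩ => ?_, ?_⟩
  · refine (isIrred_modHPlus hn s hk h1).eq_of_le hW ?_
    obtain ⟨M, hM, ⟨m, hm⟩, rfl⟩ := exists_stepClosed_of_isIrred hn hk hW hle
    refine (vecSpan_le_iff hn hk).2 fun m' hm'A hm' => ?_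
    rcases le_total m (2 * k + 4 * l + n) with h | h
    · exact hM.mem_up hm hm' (h.trans hm'A) (Or.inl (lowest_modEq_iff.not.2 h2))
    · exact hM.mem_of_le (highest_pos hn l k) (highest_modEq_iff.2 h1) hm h hm' hm'A
  · rintro rfl
    exact ⟨vecSpan_mono q s (Set.subset_univ _), isIrred_modHPlus hn s hk h1⟩

theorem irred_iff_eq_modHMinus (hn : 1 ≤ n) {q : ℤ} (s : ℂ) {l k : ℕ}
    (hk : ∃ h ∈ harmonicPoly n k, h ≠ 0) (h1 : ¬ q ≡ n [ZMOD 4]) (h2 : q ≡ -n [ZMOD 4])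
    (W : Submodule ℂ (Fn n)) :
    W ≤ modH n q s l k ∧ IsIrred n q s W ↔ W = modHMinus n q s l k := by
  refine ⟨fun ⟨hle, hW⟩ => ?_, ?_⟩
  · refine (isIrred_modHMinus hn s hk h2).eq_of_le hW ?_
    obtain ⟨M, hM, ⟨m, hm⟩, rfl⟩ := exists_stepClosed_of_isIrred hn hk hW hle
    refine (vecSpan_le_iff hn hk).2 fun m' hm'A hm' => ?_
    rcases le_total m (-(2 * k + 4 * l + n)) with h | h
    · exact hM.mem_of_ge (highest_pos hn l k) (lowest_modEq_iff.2 h2) hm h hm' hm'A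
    · exact hM.mem_down hm hm' (le_trans hm'A h) (Or.inl (highest_modEq_iff.not.2 h1))
  · rintro rfl
    exact ⟨vecSpan_mono q s (Set.subset_univ _), isIrred_modHMinus hn s hk h2⟩

theorem irred_iff_eq_modHPlus_or_modHMinus (hn : 1 ≤ n) {q : ℤ} (s : ℂ) {l k : ℕ}
    (hk : ∃ h ∈ harmonicPoly n k, h ≠ 0) (h1 : q ≡ n [ZMOD 4]) (h2 : q ≡ -n [ZMOD 4])
    (W : Submodule ℂ (Fn n)) :
    W ≤ modH n q s l k ∧ IsIrred n q s W ↔ W = modHPlus n q s l k ∨ W = modHMinus n q s l k := by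
  refine ⟨fun ⟨hle, hW⟩ => ?_, ?_⟩
  · have hP := (isIrred_modHPlus hn s (l := l) hk h1).eq_of_le hW
    have hN := (isIrred_modHMinus hn s (l := l) hk h2).eq_of_le hW
    obtain ⟨M, hM, ⟨m, hm⟩, rfl⟩ := exists_stepClosed_of_isIrred hn hk hW hle
    rcases le_or_gt m (-(2 * k + 4 * l + n)) with h | h
    · exact Or.inr (hN ((vecSpan_le_iff hn hk).2 fun m' hm'A hm' =>
        hM.mem_of_ge (highest_pos hn l k) (lowest_modEq_iff.2 h2) hm h hm' hm'A))
    · refine Or.inl (hP ((vecSpan_le_iff hn hk).2 fun m' hm'A hm' => ?_))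
      rcases lt_or_ge m (2 * k + 4 * l + n) with h' | h'
      · exact hM.mem_of_between hm h h' hm'
      · exact hM.mem_of_le (highest_pos hn l k) (highest_modEq_iff.2 h1) hm h' hm' hm'A
  · rintro (rfl | rfl)
    · exact ⟨vecSpan_mono q s (Set.subset_univ _), isIrred_modHPlus hn s hk h1⟩
    · exact ⟨vecSpan_mono q s (Set.subset_univ _), isIrred_modHMinus hn s hk h2⟩

theorem disjoint_modHPlus_modHMinus (hn : 1 ≤ n) {q : ℤ} (s : ℂ) (l k : ℕ) (h2 : q ≡ -n [ZMOD 4]) :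
    Disjoint (modHPlus n q s l k) (modHMinus n q s l k) := by
  refine disjoint_vecSpan hn (isSubrep_modHMinus hn s l k h2) (Set.disjoint_left.2 fun m h h' => ?_)
  simp only [Set.mem_ofPred_eq] at h h'
  omega

theorem modHPlus_sup_modHMinus (q : ℤ) (s : ℂ) (l k : ℕ) :
    modHPlus n q s l k ⊔ modHMinus n q s l k = vecSpan n q s l k
      ({m | 2 * k + 4 * l + n ≤ m} ∪ {m | m ≤ -(2 * k + 4 * l + n)}) :=
  vecSpan_union q s l k _ _

theorem isSubrep_sup (hn : 1 ≤ n) {q : ℤ} (s : ℂ) (l k : ℕ) (h1 : q ≡ n [ZMOD 4])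
    (h2 : q ≡ -n [ZMOD 4]) : IsSubrep n q s (modHPlus n q s l k ⊔ modHMinus n q s l k) := by
  rw [sup_eq_iSup]
  refine IsSubrep.iSup fun b => ?_
  cases b
  · exact isSubrep_modHMinus hn s l k h2
  · exact isSubrep_modHPlus hn s l k h1

theorem isSimpleStep_modHPlus_sup (hn : 1 ≤ n) {q : ℤ} (s : ℂ) {l k : ℕ}
    (hk : ∃ h ∈ harmonicPoly n k, h ≠ 0) (h1 : q ≡ n [ZMOD 4]) (h2 : q ≡ -n [ZMOD 4]) :
    IsSimpleStep n q s (modHPlus n q s l k) (modHPlus n q s l k ⊔ modHMinus n q s l k) := by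
  have hsub := isSubrep_sup hn s l k h1 h2
  have hpos := highest_pos hn l k
  rw [modHPlus_sup_modHMinus] at hsub ⊢
  refine isSimpleStep_vecSpan hn hk (isSubrep_modHPlus hn s l k h1) hsub Set.subset_union_left
    ⟨-(2 * k + 4 * l + n), Or.inr (by simp), lowest_modEq_iff.2 h2, fun h => ?_⟩ ?_
  · simp only [Set.mem_ofPred_eq] at h
    omega
  · rintro M hM ⟨m, hmM, hmT, hmS⟩ m' hm'T hm' hm'S
    exact hM.mem_of_ge hpos (lowest_modEq_iff.2 h2) hmM (hmT.resolve_left hmS) hm'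
      (hm'T.resolve_left hm'S)

theorem isSimpleStep_sup_modH (hn : 1 ≤ n) {q : ℤ} (s : ℂ) {l k : ℕ}
    (hk : ∃ h ∈ harmonicPoly n k, h ≠ 0) (h1 : q ≡ n [ZMOD 4]) (h2 : q ≡ -n [ZMOD 4])
    (hA : (2 : ℤ) < 2 * k + 4 * l + n) :
    IsSimpleStep n q s (modHPlus n q s l k ⊔ modHMinus n q s l k) (modH n q s l k) := by
  have hsub := isSubrep_sup hn s l k h1 h2
  rw [modHPlus_sup_modHMinus] at hsub ⊢
  refine isSimpleStep_vecSpan hn hk hsub (isSubrep_modH hn q s l k) (Set.subset_univ _)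
    -- The weight A - 4 lies strictly between -A and A because A > 2, so the last quotient is
    -- nonzero.
    ⟨2 * k + 4 * l + n - 4, trivial, modEq_sub_four (highest_modEq_iff.2 h1), fun h => ?_⟩ ?_
  · simp only [Set.mem_union, Set.mem_ofPred_eq] at h
    omega
  · rintro M hM ⟨m, hmM, -, hmS⟩ m' - hm' -
    simp only [Set.mem_union, Set.mem_ofPred_eq, not_or, not_le] at hmS
    exact hM.mem_of_between hmM hmS.2 hmS.1 hm'

end SingularSchrodinger

end



/-! ### Assembly of the four cases. -/

theorem mainTheorem3 (n : ℕ) (hn : 1 ≤ n) (q : ℤ) (s : ℂ) (lam : ℤ) (hlam : IsAdmissible n lam)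
    (l k : ℕ) (hlk : IsAdmissiblePair n lam l k) :
    -- `ker(Ω'' - 2λ)_K` and `H_{l,k} ⊆ ker(Ω'' - 2λ)_K` are `sl₂ × O(n)`-modules
    (IsSubrep n q s (kerK n q s lam) ∧ IsSubrep n q s (modH n q s l k) ∧
      modH n q s l k ≤ kerK n q s lam) ∧
    -- `q ≢ n`, `q ≢ -n`
    (¬ q ≡ n [ZMOD 4] → ¬ q ≡ -n [ZMOD 4] →
      IsIrred n q s (modH n q s l k) ∧
      iSupIndep (fun p : {p : ℕ × ℕ // IsAdmissiblePair n lam p.1 p.2} =>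
        modH n q s p.1.1 p.1.2) ∧
      kerK n q s lam =
        ⨆ p : {p : ℕ × ℕ // IsAdmissiblePair n lam p.1 p.2}, modH n q s p.1.1 p.1.2) ∧
    -- `q ≡ n`, `q ≢ -n`
    (q ≡ n [ZMOD 4] → ¬ q ≡ -n [ZMOD 4] →
      ∀ W, W ≤ modH n q s l k ∧ IsIrred n q s W ↔ W = modHPlus n q s l k) ∧
    -- `q ≢ n`, `q ≡ -n`
    (¬ q ≡ n [ZMOD 4] → q ≡ -n [ZMOD 4] →
      ∀ W, W ≤ modH n q s l k ∧ IsIrred n q s W ↔ W = modHMinus n q s l k) ∧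
    -- `q ≡ n`, `q ≡ -n`
    (q ≡ n [ZMOD 4] → q ≡ -n [ZMOD 4] →
      (∀ W, W ≤ modH n q s l k ∧ IsIrred n q s W ↔
        W = modHPlus n q s l k ∨ W = modHMinus n q s l k) ∧
      Disjoint (modHPlus n q s l k) (modHMinus n q s l k) ∧
      IsSimpleStep n q s ⊥ (modHPlus n q s l k) ∧
      IsSimpleStep n q s (modHPlus n q s l k) (modHPlus n q s l k ⊔ modHMinus n q s l k) ∧
      IsSimpleStep n q s (modHPlus n q s l k ⊔ modHMinus n q s l k) (modH n q s l k)) := by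
  have hdim : 2 ≤ n ∨ n = 1 ∧ k ≤ 1 := hlk.2.imp And.left id
  have hk := exists_harmonic_ne_zero hdim
  refine ⟨⟨isSubrep_kerK hn q s hlam, isSubrep_modH hn q s l k,
    vecSpan_le_kerK hn q s Set.univ hlk.1⟩, fun h1 h2 => ⟨isIrred_modH hn s hk h1 h2,
    iSupIndep_modH hn q s lam, kerK_eq_iSup hn q s hlam⟩, irred_iff_eq_modHPlus hn s hk,
    irred_iff_eq_modHMinus hn s hk, fun h1 h2 => ⟨irred_iff_eq_modHPlus_or_modHMinus hn s hk h1 h2,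
    disjoint_modHPlus_modHMinus hn s l k h2, isIrred_modHPlus hn s hk h1,
    isSimpleStep_modHPlus_sup hn s hk h1 h2, isSimpleStep_sup_modH hn s hk h1 h2 ?_⟩⟩
  -- The two congruences make n even, so n ≥ 2 and admissibility gives l ≥ 1; hence A ≥ 6.
  have hpair := hlk.2
  unfold Int.ModEq at h1 h2
  omega
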